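/- **Setting.** Let $d\in\{2,3\}$, $\ell\in\{0,\dots,d-1\}$ and $\beta\in\left(-\frac{d-\ell}{2},\frac{d-\ell}{2}\right)$. Let $\Omega\subset\mathbb R^d$ be a bounded connected open set with Lipschitz boundary. Let $\Lambda\subset\Omega$ be an $\ell$-dimensional compact set which is a union of $m\ge 1$ pieces $\varphi_i([0,1]^\ell)$, where for some $\rho_i>0$ and a fixed $L$ one has $\rho_i|s-t|\le|\varphi_i(s)-\varphi_i(t)|\le L\rho_i|s-t|$ (for example a point, a polygonal line, a planar polygon, or any compact $C^1$ submanifold of dimension $\ell$). Write $d_\Lambda(x)=\operatorname{dist}(x,\Lambda)$ and, for scalar or vector functions, $\|u\|_{L^2_\beta(\omega)}^2=\int_\omega |u|^2 d_\Lambda^{2\beta}\,dx$. Let $H^1_\beta(\Omega)$ be the space of $u\in L^2_\beta(\Omega)$ with weak gradient in $L^2_\beta(\Omega)$, and let $H^1_{\beta,0}(\Omega)$ be the closure of $C_c^\infty(\Omega)$ in it. Let $\mathcal T_H$ be a finite conforming simplicial mesh of $\overline\Omega$ such that each element $T$ contains a ball of some radius $r_T>0$ with $\operatorname{diam}T\le\kappa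 r_T$, and $\operatorname{diam}T\le H\le\kappa\operatorname{diam}T$. Let $\mathcal N$ be the set of its nodes and $\mathcal N_{int}=\mathcal N\cap\Omega$. Let $S_H$ be the space of continuous functions on $\overline\Omega$ that are affine on each element, $V_H=\{f\in S_H: f=0\text{ on }\partial\Omega\}$, and let $\lambda_v\in S_H$ $(v\in\mathcal N)$ be the nodal basis functions. Put $$\omega_v=\omega_{v,0}=\Omega\cap\bigcup_{T\ni v}T,\qquad \omega_{v,k}=\Omega\cap\operatorname{int}\bigcup\{T\in\mathcal T_H: T\cap\overline{\omega_{v,k-1}}\ne\emptyset\}\quad(k\ge1).$$ For $v\in\mathcal N_{int}$ let $\mathcal P_v:L^2_\beta(\omega_v)\to V_H|_{\omega_v}$ be the projection given by $\int_{\omega_v}(\mathcal P_vu)\,w\,d_\Lambda^{2\beta}dx=\int_{\omega_v}u\,w\,d_\Lambda^{2\beta}dx$ for all $w\in V_H|_{\omega_v}$, and set $$I_H^\beta u=\sum_{v\in\mathcal N_{int}}(\mathcal P_vu)(v)\,\lambda_v .$$ **Lemma.** There is a constant $C$, depending only on $d,\ell,m,\beta,\kappa,L,\Omega$ (in particular neither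 on the mesh, nor on $H$, nor on $u$ and $v$, nor on $\Lambda$ otherwise than through $\ell, m, L$), such that the following holds. 1. $I_H^\beta$ is a linear projection of $H^1_\beta(\Omega)$ onto $V_H$, and $V_H\subset H^1_{\beta,0}(\Omega)$: it is linear, $I_H^\beta u\in V_H$ for all $u\in H^1_\beta(\Omega)$, and $I_H^\beta u=u$ for all $u\in V_H$. 2. For all $u\in H^1_\beta(\Omega)$ and $v\in\mathcal N$: $\|I_H^\beta u\|_{L^2_\beta(\omega_v)}\le C\|u\|_{L^2_\beta(\omega_{v,1})}$. 3. The three estimates $$\|\nabla I_H^\beta u\|_{L^2_\beta(\omega_v)}\le C\|\nabla u\|_{L^2_\beta(\omega_{v,k})},\quad \|u-I_H^\beta u\|_{L^2_\beta(\omega_v)}\le CH\|\nabla u\|_{L^2_\beta(\omega_{v,k})},\quad \|\nabla(u-I_H^\beta u)\|_{L^2_\beta(\omega_v)}\le C\|\nabla u\|_{L^2_\beta(\omega_{v,k})}$$ hold in each of the following cases: (a) $k=1$, $u\in H^1_\beta(\Omega)$, and $v\in\mathcal N$ with $\overline{\omega_{v,1}}\subset\Omega$; (b) $k=1$, $u\in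 H^1_{\beta,0}(\Omega)$, and $v\in\mathcal N$ such that some element $T\subset\overline{\omega_{v,1}}$ has a $(d-1)$-dimensional face contained in $\partial\Omega$; (c) $k=2$, $u\in H^1_{\beta,0}(\Omega)$, and every $v\in\mathcal N$. -/

import Mathlib

open MeasureTheory Metric Set
open scoped ENNReal NNReal ContDiff

noncomputable section

namespace WeightedQI

/-- The Euclidean space `ℝ^d`. -/
abbrev E (d : ℕ) : Type := EuclideanSpace ℝ (Fin d)

variable {d : ℕ}

/-! ### The domain and the singular set -/

/-- Bounded, open, connected, with Lipschitz boundary: near each boundary point `Ω` is, in suitable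
Cartesian coordinates with vertical direction `n`, the set strictly above the graph of a Lipschitz
function (`γ` is that function, extended to be constant in the direction `n`). -/
structure IsLipschitzDomain (Ω : Set (E d)) : Prop where
  isOpen : IsOpen Ω
  isBounded : Bornology.IsBounded Ω
  isConnected : IsConnected Ω
  lipschitz : ∀ x ∈ frontier Ω, ∃ (n : E d) (γ : E d → ℝ) (M : ℝ≥0) (r : ℝ),
    ‖n‖ = 1 ∧ 0 < r ∧ LipschitzWith M γ ∧ (∀ (y : E d) (t : ℝ), γ (y + t • n) = γ y) ∧
    ∀ y ∈ ball x r, (y ∈ Ω ↔ γ y < inner ℝ n y)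

/-- `Λ` is an `ℓ`-dimensional compact piecewise Lipschitz surface: the union of `m` pieces, each the
image of the cube `[0,1]^ℓ` under a map that is bi-Lipschitz with distortion at most `L`, up to
a scaling factor `ρ i` (so that `L` does not see the size of the pieces). A point (`ℓ = 0`), a
polygonal line (`ℓ = 1`), a polygon in a plane (`ℓ = 2`) and each compact `C¹` submanifold
of dimension `ℓ`, with or without boundary, are of this form for some `m` and `L`. -/
def IsFracture (ℓ m : ℕ) (L : ℝ) (Λ : Set (E d)) : Prop :=
  ∃ (φ : Fin m → E ℓ → E d) (ρ : Fin m → ℝ),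
    (∀ i, 0 < ρ i) ∧
    (∀ i, ∀ s t : E ℓ, (∀ j, s j ∈ Icc (0 : ℝ) 1) → (∀ j, t j ∈ Icc (0 : ℝ) 1) →
      ρ i * dist s t ≤ dist (φ i s) (φ i t) ∧ dist (φ i s) (φ i t) ≤ L * ρ i * dist s t) ∧
    Λ = ⋃ i, φ i '' {s | ∀ j, s j ∈ Icc (0 : ℝ) 1}

/-! ### Weighted Lebesgue and Sobolev spaces -/

/-- The measure `d_Λ(x)^{2β} dx`, where `d_Λ` is the distance to `Λ`. -/
def wMeas (Λ : Set (E d)) (β : ℝ) : Measure (E d) :=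
  volume.withDensity fun x => ENNReal.ofReal (infDist x Λ ^ (2 * β))

/-- The norm of `L²_β(D)`, i.e. `(∫_D |u|² d_Λ^{2β} dx)^{1/2}`, for scalar or vector functions. -/
def wNorm {F : Type*} [NormedAddCommGroup F] (Λ : Set (E d)) (β : ℝ) (D : Set (E d))
    (u : E d → F) : ℝ≥0∞ :=
  eLpNorm u 2 ((wMeas Λ β).restrict D)

/-- Membership in `L²_β(D)`. -/
def MemL2 {F : Type*} [NormedAddCommGroup F] (Λ : Set (E d)) (β : ℝ) (D : Set (E d))
    (u : E d → F) : Prop :=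
  MemLp u 2 ((wMeas Λ β).restrict D)

/-- Test functions: `C_c^∞(Ω)`. -/
def IsTest (Ω : Set (E d)) (φ : E d → ℝ) : Prop :=
  ContDiff ℝ ∞ φ ∧ HasCompactSupport φ ∧ tsupport φ ⊆ Ω

/-- `g` is the weak gradient of `u` on `Ω`. -/
def HasWeakGrad (Ω : Set (E d)) (u : E d → ℝ) (g : E d → E d) : Prop :=
  LocallyIntegrableOn u Ω ∧ LocallyIntegrableOn g Ω ∧
    ∀ φ : E d → ℝ, IsTest Ω φ → ∀ e : E d,
      ∫ x in Ω, u x * fderiv ℝ φ x e = -∫ x in Ω, inner ℝ (g x) e * φ x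

open Classical in
/-- The weak gradient (unique a.e. on `Ω` if it exists; `0` if there is none). -/
def weakGrad (Ω : Set (E d)) (u : E d → ℝ) : E d → E d :=
  if h : ∃ g, HasWeakGrad Ω u g then h.choose else 0

/-- Membership in `H¹_β(Ω)`. -/
def MemH1 (Λ : Set (E d)) (β : ℝ) (Ω : Set (E d)) (u : E d → ℝ) : Prop :=
  MemL2 Λ β Ω u ∧ ∃ g, HasWeakGrad Ω u g ∧ MemL2 Λ β Ω g

/-- Membership in the subspace of `H¹_β(Ω)` of functions vanishing on `∂Ω`: the closure of
`C_c^∞(Ω)` in `H¹_β(Ω)`. -/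
def MemH1Zero (Λ : Set (E d)) (β : ℝ) (Ω : Set (E d)) (u : E d → ℝ) : Prop :=
  MemH1 Λ β Ω u ∧ ∀ ε : ℝ≥0∞, 0 < ε → ∃ φ : E d → ℝ, IsTest Ω φ ∧
    wNorm Λ β Ω (fun x => u x - φ x) < ε ∧
    wNorm Λ β Ω (fun x => weakGrad Ω u x - gradient φ x) < ε

/-! ### The mesh and the finite element spaces -/

/-- The (closed) elements of the mesh are the convex hulls of the faces with `d + 1` vertices. -/
def elements (K : Geometry.SimplicialComplex ℝ (E d)) : Set (Finset (E d)) :=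
  {t | t ∈ K.faces ∧ t.card = d + 1}

/-- `K` is a conforming simplicial mesh of `Ω` of size `H`, shape regular and quasi-uniform with
parameter `κ`. -/
structure IsMesh (Ω : Set (E d)) (κ H : ℝ) (K : Geometry.SimplicialComplex ℝ (E d)) : Prop where
  finite : K.faces.Finite
  space_eq : K.space = closure Ω
  pure : ∀ s ∈ K.faces, ∃ t ∈ elements K, s ⊆ t
  shapeRegular : ∀ t ∈ elements K, ∃ (c : E d) (r : ℝ), 0 < r ∧
    closedBall c r ⊆ convexHull ℝ (t : Set (E d)) ∧ diam (convexHull ℝ (t : Set (E d))) ≤ κ * r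
  quasiUniform : ∀ t ∈ elements K,
    diam (convexHull ℝ (t : Set (E d))) ≤ H ∧ H ≤ κ * diam (convexHull ℝ (t : Set (E d)))

/-- The conforming `P₁` space `S_H`: continuous on `closure Ω`, affine on each element. Functions
live on `closure Ω`; they are extended by `0` to have a unique representative. -/
def SH (Ω : Set (E d)) (K : Geometry.SimplicialComplex ℝ (E d)) : Set (E d → ℝ) :=
  {f | ContinuousOn f (closure Ω) ∧ (∀ x ∉ closure Ω, f x = 0) ∧
    ∀ t ∈ elements K, ∃ A : E d →ᵃ[ℝ] ℝ, ∀ x ∈ convexHull ℝ (t : Set (E d)), f x = A x}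

/-- The space `V_H` of the functions in `S_H` that vanish on `∂Ω`. -/
def VH (Ω : Set (E d)) (K : Geometry.SimplicialComplex ℝ (E d)) : Set (E d → ℝ) :=
  {f | f ∈ SH Ω K ∧ ∀ x ∈ frontier Ω, f x = 0}

open Classical in
/-- The nodal basis function `λ_v`: the (unique) function in `S_H` with value `1` at the node `v`
and `0` at the other nodes. -/
def hat (Ω : Set (E d)) (K : Geometry.SimplicialComplex ℝ (E d)) (v : E d) : E d → ℝ :=
  if h : ∃ f ∈ SH Ω K, ∀ w ∈ K.vertices, f w = if w = v then 1 else 0 then h.choose else 0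

/-- The extended patches: `ω_{v,0} = ω_v` is the union of the elements with vertex `v`,
within `Ω`, and `ω_{v,k+1}` is the interior of the union of the elements that meet the closure of
`ω_{v,k}`, within `Ω`. -/
def patch (Ω : Set (E d)) (K : Geometry.SimplicialComplex ℝ (E d)) (v : E d) : ℕ → Set (E d)
  | 0 => (⋃ t ∈ {t | t ∈ elements K ∧ v ∈ t}, convexHull ℝ (t : Set (E d))) ∩ Ω
  | k + 1 => interior (⋃ t ∈ {t | t ∈ elements K ∧
      (convexHull ℝ (t : Set (E d)) ∩ closure (patch Ω K v k)).Nonempty},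
        convexHull ℝ (t : Set (E d))) ∩ Ω

/-- An element in the closure of `D` has a `(d-1)`-dimensional face on `∂Ω`. -/
def HasBoundaryFace (Ω : Set (E d)) (K : Geometry.SimplicialComplex ℝ (E d))
    (D : Set (E d)) : Prop :=
  ∃ t ∈ elements K, convexHull ℝ (t : Set (E d)) ⊆ closure D ∧
    ∃ f ⊆ t, f.card = d ∧ convexHull ℝ (f : Set (E d)) ⊆ frontier Ω

/-! ### The quasi-interpolation operator -/

/-- `p` represents the weighted `L²` projection of `u` onto the restriction of `V_H` to `ω_v`. -/
def IsLocalProj (Ω : Set (E d)) (K : Geometry.SimplicialComplex ℝ (E d)) (Λ : Set (E d)) (β : ℝ)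
    (v : E d) (u p : E d → ℝ) : Prop :=
  p ∈ VH Ω K ∧ ∀ w ∈ VH Ω K,
    ∫ x in patch Ω K v 0, p x * w x ∂(wMeas Λ β) = ∫ x in patch Ω K v 0, u x * w x ∂(wMeas Λ β)

open Classical in
/-- The local projection `P_v u` (only its values on `ω_v`, which are unique, are meaningful). -/
def localProj (Ω : Set (E d)) (K : Geometry.SimplicialComplex ℝ (E d)) (Λ : Set (E d)) (β : ℝ)
    (v : E d) (u : E d → ℝ) : E d → ℝ :=
  if h : ∃ p, IsLocalProj Ω K Λ β v u p then h.choose else 0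

/-- `I_H^β u = ∑ (P_v u)(v) λ_v`, summed over the interior nodes `v`. -/
def quasiInterp (Ω : Set (E d)) (K : Geometry.SimplicialComplex ℝ (E d)) (Λ : Set (E d)) (β : ℝ)
    (u : E d → ℝ) : E d → ℝ :=
  fun x => ∑ᶠ v ∈ K.vertices ∩ Ω, localProj Ω K Λ β v u v * hat Ω K v x

/-- The three local estimates of `I = I_H^β u` on `D` by the gradient of `u` on `D'`:
`‖∇I‖ ≤ C ‖∇u‖`, `‖u - I‖ ≤ C H ‖∇u‖` and `‖∇(u - I)‖ ≤ C ‖∇u‖`. -/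
def GradientBounds (Ω Λ : Set (E d)) (β H : ℝ) (C : ℝ≥0) (u I : E d → ℝ)
    (D D' : Set (E d)) : Prop :=
  wNorm Λ β D (weakGrad Ω I) ≤ C * wNorm Λ β D' (weakGrad Ω u) ∧
  wNorm Λ β D (u - I) ≤ C * ENNReal.ofReal H * wNorm Λ β D' (weakGrad Ω u) ∧
  wNorm Λ β D (weakGrad Ω (u - I)) ≤ C * wNorm Λ β D' (weakGrad Ω u)

end WeightedQI

end

open MeasureTheory Metric Set
open scoped ENNReal NNReal ContDiff

noncomputable section

namespace WeightedQI

variable {d : ℕ}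

/-! ### Measures for which averaging over balls is bounded on `L²` -/

/-! Apart from null sets and local finiteness, the weight enters only through `AvgBounded`, a form
of the A₂ condition. To obtain it for `d_Λ^{2β}`, each piece of `Λ` is covered by balls through a
grid in its parameter cube; the `s`-neighbourhood of `Λ` thus occupies at most `C R^ℓ s^(d-ℓ)` of a
ball of radius `R`, and summing over dyadic layers makes `d_Λ^(-γ)` an A₁ weight for `0 ≤ γ < d - ℓ`
(`IsFracture.exists_lintegral_le`). A₁ weights and their inverses satisfy `AvgBounded`, which covers
both signs of `β`. All bounds are scale invariant, so the constant sees `Λ` only through `ℓ`, `m`,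
`L`.

Weighted Poincaré and Friedrichs inequalities then follow directly, with explicit constants and no
compactness argument. The difference `φ x - φ y` is the integral of the gradient along a segment;
averaging over `y` and substituting `z = x + t(y - x)` turns it into ball averages of the gradient
at radius `tR`, and the Jacobian `t^(-d)` is compensated exactly by the scaling in `AvgBounded`
(`AvgBounded.segment`). This gives the inequalities on one element and lets `L²` bounds pass from an
element to a neighbour through a small ball around the barycenter of their common face. A patch has
boundedly many elements, by volume, and is connected through faces: inside a Lipschitz domain,
nearby points are joined by three segments which in general position miss all faces of codimension
two (`star_connected`). Chaining yields `AvgBounded.exists_poincare_patch`.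

For the operator, an inverse estimate bounds a nodal value by the weighted norm on an element, and
the local projections are contractions; this is the `L²` stability. If `ω_{v,1}` stays away from the
boundary, some function of `V_H` equals 1 on it, so linearity and reproduction of `V_H` improve
stability to `‖I u - c‖ ≤ C ‖u - c‖` for every constant `c` (`quasiInterp_element_le`). Inserting
the Poincaré inequality, or the Friedrichs inequality with `c = 0` if there is a boundary face,
gives the gradient bounds (`gradientBounds_of_approx`). If neither is available for `ω_{v,1}`, this
patch touches the boundary, and a generic segment that leaves the domain near a contact point
exhibits a boundary face in `ω_{v,2}`.

The Poincaré inequalities are proved for smooth functions. Elsewhere `u` is approximated by test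
functions, from the definition of `H¹_{β,0}`, or in the interior by mollification, which is bounded
on `L²(μ)` again by `AvgBounded`. For `V_H ⊂ H¹_{β,0}`, a finite element function is truncated near
its zero set, which makes its support compact in `Ω`, and then mollified. -/

/-- Averaging over balls of a fixed radius is bounded on `L²(μ)`, uniformly in the radius. For
`μ = w dx` this is the Muckenhoupt condition `A₂`. -/
def AvgBounded (A : ℝ≥0) (μ : Measure (E d)) : Prop :=
  ∀ s : ℝ, 0 < s → ∀ g : E d → ℝ≥0∞, Measurable g →
    ∫⁻ x, (∫⁻ y in closedBall x s, g y) ^ 2 ∂μ ≤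
      A * ENNReal.ofReal s ^ (2 * d) * ∫⁻ x, g x ^ 2 ∂μ

lemma sq_lintegral_mul_le {α : Type*} [MeasurableSpace α] (ν : Measure α) {f g : α → ℝ≥0∞}
    (hf : AEMeasurable f ν) (hg : AEMeasurable g ν) :
    (∫⁻ a, f a * g a ∂ν) ^ 2 ≤ (∫⁻ a, f a ^ 2 ∂ν) * ∫⁻ a, g a ^ 2 ∂ν := by
  have h := ENNReal.lintegral_mul_le_Lp_mul_Lq ν Real.HolderConjugate.two_two hf hg
  calc (∫⁻ a, f a * g a ∂ν) ^ 2
      ≤ ((∫⁻ a, f a ^ (2 : ℝ) ∂ν) ^ (1 / (2 : ℝ)) * (∫⁻ a, g a ^ (2 : ℝ) ∂ν) ^ (1 / (2 : ℝ))) ^ 2 := by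
        gcongr; exact h
    _ = (∫⁻ a, f a ^ 2 ∂ν) * ∫⁻ a, g a ^ 2 ∂ν := by
        rw [mul_pow, ← ENNReal.rpow_natCast, ← ENNReal.rpow_natCast, ← ENNReal.rpow_mul,
          ← ENNReal.rpow_mul]
        simp

lemma sq_lintegral_le {α : Type*} [MeasurableSpace α] (ν : Measure α) {f : α → ℝ≥0∞}
    (hf : AEMeasurable f ν) : (∫⁻ a, f a ∂ν) ^ 2 ≤ ν univ * ∫⁻ a, f a ^ 2 ∂ν := by
  have h := sq_lintegral_mul_le ν (aemeasurable_const (b := (1 : ℝ≥0∞))) hf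
  simpa using h

lemma ENNReal.add_sq_le (a b : ℝ≥0∞) : (a + b) ^ 2 ≤ 2 * (a ^ 2 + b ^ 2) := by
  have h := ENNReal.rpow_add_le_mul_rpow_add_rpow a b (p := 2) (by norm_num)
  norm_num at h
  exact_mod_cast h

/-- The moving ball is a measurable subset of the product, so its indicator can be absorbed into the
integrand of a parameter integral over a fixed space. -/
lemma measurable_lintegral_closedBall {α : Type*} [MeasurableSpace α] {g : α → E d → ℝ≥0∞}
    (hg : Measurable fun p : α × E d => g p.1 p.2) {c : α → E d} (hc : Measurable c)
    {r : α → ℝ} (hr : Measurable r) :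
    Measurable fun a => ∫⁻ y in closedBall (c a) (r a), g a y := by
  have h : ∀ a, ∫⁻ y in closedBall (c a) (r a), g a y =
      ∫⁻ y, {p : α × E d | dist p.2 (c p.1) ≤ r p.1}.indicator (fun p => g p.1 p.2) (a, y) := by
    intro a
    rw [← lintegral_indicator measurableSet_closedBall]
    rfl
  simp_rw [h]
  have hS : MeasurableSet {p : α × E d | dist p.2 (c p.1) ≤ r p.1} :=
    measurableSet_le (measurable_snd.dist (hc.comp measurable_fst)) (hr.comp measurable_fst)
  exact (hg.indicator hS).lintegral_prod_right'

/-- Change of variables by the homothety with centre `x` and ratio `t`. -/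
lemma lintegral_closedBall_segment {g : E d → ℝ≥0∞} (x : E d) {t R : ℝ}
    (ht : 0 < t) :
    ∫⁻ y in closedBall x R, g (x + t • (y - x)) =
      ENNReal.ofReal t⁻¹ ^ d * ∫⁻ z in closedBall x (t * R), g z := by
  set e : E d ≃ᵐ E d := (MeasurableEquiv.subRight x).trans
    ((Homeomorph.smulOfNeZero t ht.ne').toMeasurableEquiv.trans (MeasurableEquiv.addLeft x)) with he
  have hemap : Measure.map e volume = ENNReal.ofReal t⁻¹ ^ d • (volume : Measure (E d)) := by
    have h1 : ⇑e = (fun z => x + z) ∘ (fun z => t • z) ∘ (fun z => z - x) := rfl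
    rw [h1, ← Measure.map_map (by fun_prop) (by fun_prop), ← Measure.map_map (by fun_prop)
      (by fun_prop), (measurePreserving_sub_right volume x).map_eq,
      Measure.map_addHaar_smul _ ht.ne', Measure.map_smul,
      (measurePreserving_add_left volume x).map_eq]
    rw [← ENNReal.ofReal_pow (inv_nonneg.2 ht.le), inv_pow]
    simp [abs_of_pos ht]
  have h2 : ∀ y, g (x + t • (y - x)) = g (e y) := fun y => rfl
  have h3 : closedBall x R = e ⁻¹' closedBall x (t * R) := by
    ext y
    change _ ↔ dist (x + t • (y - x)) x ≤ t * R
    simp [dist_eq_norm, norm_smul, abs_of_pos ht, ht]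
  simp_rw [h2]
  rw [h3, ← lintegral_indicator (e.measurable measurableSet_closedBall)]
  have h4 : ∀ y, (e ⁻¹' closedBall x (t * R)).indicator (fun a => g (e a)) y =
      (closedBall x (t * R)).indicator g (e y) := fun y => rfl
  simp_rw [h4]
  rw [← lintegral_map_equiv _ e, hemap, lintegral_smul_measure,
    lintegral_indicator measurableSet_closedBall, smul_eq_mul]

/-- For fixed `t` the inner integral is `t^(-d)` times a ball average at radius `tR`, and the bound
of `AvgBounded` at that radius carries `t^(2d)`. The powers cancel, so integrating over `t` costs
nothing and no singular kernel has to be estimated. -/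
lemma AvgBounded.segment {A : ℝ≥0} {μ : Measure (E d)} [SFinite μ] (hμ : AvgBounded A μ) {R : ℝ}
    (hR : 0 < R) {X Y : Set (E d)} (hX : MeasurableSet X)
    (hXY : ∀ x ∈ X, Y ⊆ closedBall x R) {g : E d → ℝ≥0∞} (hg : Measurable g) :
    ∫⁻ x in X, (∫⁻ y in Y, ∫⁻ t in Ioc (0 : ℝ) 1, g (x + t • (y - x))) ^ 2 ∂μ ≤
      A * ENNReal.ofReal R ^ (2 * d) * ∫⁻ x, g x ^ 2 ∂μ := by
  set G : E d → ℝ → ℝ≥0∞ := fun x t =>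
    ENNReal.ofReal t⁻¹ ^ d * ∫⁻ z in closedBall x (t * R), g z with hG
  have hGm : Measurable (Function.uncurry G) := by
    have h1 : Measurable fun p : E d × ℝ => ∫⁻ z in closedBall p.1 (p.2 * R), g z :=
      measurable_lintegral_closedBall (g := fun _ => g) (by fun_prop) (by fun_prop) (by fun_prop)
    have h2 : Measurable fun p : E d × ℝ => ENNReal.ofReal p.2⁻¹ ^ d := by fun_prop
    exact h2.mul h1
  have key : ∀ x ∈ X, (∫⁻ y in Y, ∫⁻ t in Ioc (0 : ℝ) 1, g (x + t • (y - x))) ^ 2 ≤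
      ∫⁻ t in Ioc (0 : ℝ) 1, G x t ^ 2 := by
    intro x hx
    have h1 : ∫⁻ y in Y, ∫⁻ t in Ioc (0 : ℝ) 1, g (x + t • (y - x)) ≤
        ∫⁻ t in Ioc (0 : ℝ) 1, G x t := by
      calc _ ≤ ∫⁻ y in closedBall x R, ∫⁻ t in Ioc (0 : ℝ) 1, g (x + t • (y - x)) :=
            lintegral_mono_set (hXY x hx)
        _ = ∫⁻ t in Ioc (0 : ℝ) 1, ∫⁻ y in closedBall x R, g (x + t • (y - x)) := by
            refine lintegral_lintegral_swap ?_
            have : Measurable fun p : E d × ℝ => g (x + p.2 • (p.1 - x)) :=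
              hg.comp (by fun_prop)
            exact this.aemeasurable
        _ = ∫⁻ t in Ioc (0 : ℝ) 1, G x t :=
            setLIntegral_congr_fun measurableSet_Ioc fun t ht =>
              lintegral_closedBall_segment x ht.1
    calc _ ≤ (∫⁻ t in Ioc (0 : ℝ) 1, G x t) ^ 2 := by gcongr
      _ ≤ (volume.restrict (Ioc (0 : ℝ) 1)) univ * ∫⁻ t in Ioc (0 : ℝ) 1, G x t ^ 2 :=
          sq_lintegral_le _ (hGm.comp measurable_prodMk_left).aemeasurable
      _ = _ := by rw [Measure.restrict_apply_univ, Real.volume_Ioc]; norm_num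
  calc _ ≤ ∫⁻ x in X, (∫⁻ t in Ioc (0 : ℝ) 1, G x t ^ 2) ∂μ := setLIntegral_mono' hX key
    _ ≤ ∫⁻ x, (∫⁻ t in Ioc (0 : ℝ) 1, G x t ^ 2) ∂μ := setLIntegral_le_lintegral _ _
    _ = ∫⁻ t in Ioc (0 : ℝ) 1, (∫⁻ x, G x t ^ 2 ∂μ) :=
        lintegral_lintegral_swap (hGm.pow_const 2).aemeasurable
    _ ≤ ∫⁻ _t in Ioc (0 : ℝ) 1, A * ENNReal.ofReal R ^ (2 * d) * ∫⁻ x, g x ^ 2 ∂μ := by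
        refine setLIntegral_mono' measurableSet_Ioc fun t ht => ?_
        simp only [hG, mul_pow]
        rw [lintegral_const_mul' _ _ (by finiteness)]
        calc _ ≤ (ENNReal.ofReal t⁻¹ ^ d) ^ 2 *
              (A * ENNReal.ofReal (t * R) ^ (2 * d) * ∫⁻ x, g x ^ 2 ∂μ) := by
              gcongr
              exact hμ _ (mul_pos ht.1 hR) g hg
          _ = (ENNReal.ofReal t⁻¹ * ENNReal.ofReal t) ^ (2 * d) *
              (A * ENNReal.ofReal R ^ (2 * d) * ∫⁻ x, g x ^ 2 ∂μ) := by
              rw [ENNReal.ofReal_mul ht.1.le]; ring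
          _ = _ := by
              rw [← ENNReal.ofReal_mul (inv_nonneg.2 ht.1.le), inv_mul_cancel₀ ht.1.ne']
              simp
    _ = _ := by simp

/-- The basic weighted estimate: `F` is bounded by averages over `Y` of `k` and of line integrals
of `g`. -/
lemma AvgBounded.lintegral_sq_le {A : ℝ≥0} {μ : Measure (E d)} [SFinite μ] (hμ : AvgBounded A μ)
    {R : ℝ} (hR : 0 < R) {X Y : Set (E d)} (hX : MeasurableSet X) (hY : MeasurableSet Y)
    (hXY : ∀ x ∈ X, Y ⊆ closedBall x R)
    {g k F : E d → ℝ≥0∞} (hg : Measurable g) (hk : Measurable k) (hF : Measurable F)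
    (h : ∀ x ∈ X, volume Y * F x ≤
      ∫⁻ y in Y, (k y + ENNReal.ofReal R * ∫⁻ t in Ioc (0 : ℝ) 1, g (x + t • (y - x)))) :
    volume Y ^ 2 * ∫⁻ x in X, F x ^ 2 ∂μ ≤ 2 * (A * ENNReal.ofReal R ^ (2 * d)) *
      (∫⁻ x in Y, k x ^ 2 ∂μ + ENNReal.ofReal R ^ 2 * ∫⁻ x, g x ^ 2 ∂μ) := by
  set P : E d → ℝ≥0∞ := fun x => ∫⁻ y in Y, ∫⁻ t in Ioc (0 : ℝ) 1, g (x + t • (y - x))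
  -- Cutting `k` off outside `Y` allows the integral over the full ball that `AvgBounded` refers to.
  set Q : E d → ℝ≥0∞ := fun x => ∫⁻ y in closedBall x R, Y.indicator k y
  have hQm : Measurable Q := measurable_lintegral_closedBall (g := fun _ => Y.indicator k)
    ((hk.indicator hY).comp measurable_snd) measurable_id measurable_const
  have hpt : ∀ x ∈ X, volume Y ^ 2 * F x ^ 2 ≤ 2 * (Q x ^ 2 + (ENNReal.ofReal R * P x) ^ 2) := by
    intro x hx
    have hm : Measurable fun y => ∫⁻ t in Ioc (0 : ℝ) 1, g (x + t • (y - x)) := by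
      have : Measurable fun p : E d × ℝ => g (x + p.2 • (p.1 - x)) := hg.comp (by fun_prop)
      exact this.lintegral_prod_right'
    calc volume Y ^ 2 * F x ^ 2 = (volume Y * F x) ^ 2 := by ring
      _ ≤ (∫⁻ y in Y, (k y + ENNReal.ofReal R * ∫⁻ t in Ioc (0 : ℝ) 1, g (x + t • (y - x)))) ^ 2 := by
          gcongr; exact h x hx
      _ = ((∫⁻ y in Y, k y) + ENNReal.ofReal R * P x) ^ 2 := by
          rw [lintegral_add_left hk, lintegral_const_mul _ hm]
      _ ≤ (Q x + ENNReal.ofReal R * P x) ^ 2 := by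
          gcongr
          rw [← lintegral_indicator hY, ← setLIntegral_univ]
          simp only [Q]
          rw [lintegral_indicator hY, lintegral_indicator hY]
          simp only [Measure.restrict_univ, Measure.restrict_restrict hY]
          rw [inter_eq_left.2 (hXY x hx)]
      _ ≤ _ := ENNReal.add_sq_le _ _
  calc volume Y ^ 2 * ∫⁻ x in X, F x ^ 2 ∂μ
      = ∫⁻ x in X, volume Y ^ 2 * F x ^ 2 ∂μ := by rw [lintegral_const_mul _ (hF.pow_const 2)]
    _ ≤ ∫⁻ x in X, 2 * (Q x ^ 2 + (ENNReal.ofReal R * P x) ^ 2) ∂μ := setLIntegral_mono' hX hpt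
    _ = 2 * (∫⁻ x in X, Q x ^ 2 ∂μ + ENNReal.ofReal R ^ 2 * ∫⁻ x in X, P x ^ 2 ∂μ) := by
        rw [lintegral_const_mul' _ _ (by finiteness), lintegral_add_left (hQm.pow_const 2)]
        simp only [mul_pow]
        rw [lintegral_const_mul' _ _ (by finiteness)]
    _ ≤ 2 * (A * ENNReal.ofReal R ^ (2 * d) * ∫⁻ x in Y, k x ^ 2 ∂μ +
        ENNReal.ofReal R ^ 2 * (A * ENNReal.ofReal R ^ (2 * d) * ∫⁻ x, g x ^ 2 ∂μ)) := by
        gcongr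
        · calc ∫⁻ x in X, Q x ^ 2 ∂μ ≤ ∫⁻ x, Q x ^ 2 ∂μ := setLIntegral_le_lintegral _ _
            _ ≤ _ := hμ R hR _ (hk.indicator hY)
            _ = _ := by
              rw [← lintegral_indicator hY]
              congr 2 with x
              by_cases hx : x ∈ Y <;> simp [hx]
        · exact hμ.segment hR hX hXY hg
    _ = _ := by ring

/-- The comparison of volumes and of measures. -/
lemma AvgBounded.measure_le {A : ℝ≥0} {μ : Measure (E d)} (hμ : AvgBounded A μ) {R : ℝ}
    (hR : 0 < R) {X Y : Set (E d)} (hX : MeasurableSet X) (hY : MeasurableSet Y)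
    (hXY : ∀ x ∈ X, Y ⊆ closedBall x R) :
    volume Y ^ 2 * μ X ≤ A * ENNReal.ofReal R ^ (2 * d) * μ Y := by
  -- Test with the indicator of `Y`: for every `x ∈ X` its integral over the ball is the full volume
  -- of `Y`.
  have h := hμ R hR (Y.indicator 1) (measurable_one.indicator hY)
  calc volume Y ^ 2 * μ X = ∫⁻ x in X, volume Y ^ 2 ∂μ := by simp
    _ ≤ ∫⁻ x in X, (∫⁻ y in closedBall x R, Y.indicator 1 y) ^ 2 ∂μ := by
        refine setLIntegral_mono' hX fun x hx => ?_
        gcongr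
        rw [lintegral_indicator hY, Measure.restrict_restrict hY, inter_eq_left.2 (hXY x hx)]
        simp
    _ ≤ ∫⁻ x, (∫⁻ y in closedBall x R, Y.indicator 1 y) ^ 2 ∂μ := setLIntegral_le_lintegral _ _
    _ ≤ _ := h
    _ = _ := by
        congr 1
        rw [← lintegral_indicator_one hY]
        congr 1 with x
        by_cases hx : x ∈ Y <;> simp [hx]

/-! ### Powers of the distance to a fracture -/

/-- The crude factor `ℓ + 1` instead of `√ℓ` stays positive for `ℓ = 0`, so that one can divide by
it. -/
lemma euclidean_dist_le {ℓ : ℕ} {a : ℝ} (ha : 0 ≤ a) (p q : E ℓ) (h : ∀ j, |p j - q j| ≤ a) :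
    dist p q ≤ (ℓ + 1) * a := by
  rw [EuclideanSpace.dist_eq]
  refine Real.sqrt_le_iff.2 ⟨by positivity, ?_⟩
  calc ∑ i, dist (p i) (q i) ^ 2 ≤ ∑ _i : Fin ℓ, a ^ 2 := by
        gcongr with i
        exact h i
    _ = ℓ * a ^ 2 := by simp
    _ ≤ ((ℓ + 1) * a) ^ 2 := by
        have : (0 : ℝ) ≤ ℓ := Nat.cast_nonneg _
        nlinarith [sq_nonneg a, mul_nonneg this (sq_nonneg a),
          mul_nonneg (mul_nonneg this this) (sq_nonneg a)]

/-- The neighbourhoods of one piece of a fracture: volume estimate. -/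
lemma volume_nhds_piece_le {ℓ : ℕ} (hℓ : ℓ ≤ d) {L ρ : ℝ} (hL : 1 ≤ L) (hρ : 0 < ρ)
    {φ : E ℓ → E d} {Q : Set (E ℓ)}
    (hφ : ∀ p ∈ Q, ∀ q ∈ Q, ρ * dist p q ≤ dist (φ p) (φ q) ∧
      dist (φ p) (φ q) ≤ L * ρ * dist p q)
    (z : E d) {R s : ℝ} (hs : 0 < s) (hsR : s ≤ R) :
    volume (closedBall z R ∩ {y | ∃ p ∈ Q, dist y (φ p) < s}) ≤
      ENNReal.ofReal ((8 * L * (ℓ + 1) + 3) ^ ℓ * 2 ^ d * R ^ ℓ * s ^ (d - ℓ)) *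
        volume (ball (0 : E d) 1) := by
  have hR : 0 < R := hs.trans_le hsR
  set Q' : Set (E ℓ) := {p | p ∈ Q ∧ φ p ∈ closedBall z (2 * R)} with hQ'
  have hsub : closedBall z R ∩ {y | ∃ p ∈ Q, dist y (φ p) < s} ⊆ {y | ∃ p ∈ Q', dist y (φ p) < s} := by
    rintro y ⟨hy, p, hp, hyp⟩
    refine ⟨p, ⟨hp, ?_⟩, hyp⟩
    rw [mem_closedBall] at hy ⊢
    linarith [dist_triangle_left (φ p) z y]
  rcases Q'.eq_empty_or_nonempty with hemp | ⟨p₀, hp₀, hp₀'⟩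
  · have : closedBall z R ∩ {y | ∃ p ∈ Q, dist y (φ p) < s} = ∅ := by
      refine subset_empty_iff.1 (hsub.trans ?_)
      simp [hemp]
    simp [this]
  -- The mesh width of a grid in parameter space, chosen so that the images of two parameters in one
  -- cell are at most `s` apart.
  set a : ℝ := s / (L * ρ * (ℓ + 1)) with ha
  have hapos : 0 < a := by positivity
  set c : E ℓ → Fin ℓ → ℤ := fun p j => ⌊(p j - p₀ j) / a⌋ with hc
  -- The images of `Q'` have mutual distances at most `4R`, so by the lower Lipschitz bound its
  -- parameters lie within `4R/ρ` of `p₀`; this bounds the cell indices.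
  set N : ℤ := ⌈4 * R / (ρ * a)⌉ with hN
  set I : Finset (Fin ℓ → ℤ) := Fintype.piFinset fun _ => Finset.Icc (-N) N with hI
  have hcI : ∀ p ∈ Q', c p ∈ I := by
    rintro p ⟨hp, hp'⟩
    rw [hI, Fintype.mem_piFinset]
    intro j
    have h1 : |p j - p₀ j| ≤ 4 * R / ρ := by
      have h2 : |p j - p₀ j| ≤ dist p p₀ := by
        rw [dist_eq_norm]
        exact PiLp.norm_apply_le (p - p₀) j
      have h3 := (hφ p hp p₀ hp₀).1
      rw [le_div_iff₀ hρ]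
      rw [mem_closedBall] at hp₀' hp'
      have := dist_triangle_right (φ p) (φ p₀) z
      nlinarith [mul_le_mul_of_nonneg_left h2 hρ.le]
    rw [abs_le] at h1
    have h4 : 4 * R / ρ / a ≤ N := by
      rw [div_div]; exact Int.le_ceil _
    have h5 : (p j - p₀ j) / a ≤ 4 * R / ρ / a := by gcongr; exact h1.2
    have h6 : -(4 * R / ρ / a) ≤ (p j - p₀ j) / a := by
      rw [← neg_div]; gcongr; exact h1.1
    rw [Finset.mem_Icc]
    refine ⟨Int.le_floor.2 ?_, Int.floor_le_iff.2 ?_⟩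
    · push_cast; linarith
    · linarith
  -- One representative parameter per cell. Empty cells get an arbitrary one; their balls only
  -- enlarge the cover.
  have hex : ∀ b : Fin ℓ → ℤ, ∃ q, (∃ p ∈ Q', c p = b) → q ∈ Q' ∧ c q = b := by
    intro b
    by_cases h : ∃ p ∈ Q', c p = b
    · obtain ⟨p, hp, hpb⟩ := h
      exact ⟨p, fun _ => ⟨hp, hpb⟩⟩
    · exact ⟨0, fun h' => (h h').elim⟩
  choose r hr using hex
  have hcov : closedBall z R ∩ {y | ∃ p ∈ Q, dist y (φ p) < s} ⊆
      ⋃ b ∈ I, closedBall (φ (r b)) (2 * s) := by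
    refine hsub.trans ?_
    rintro y ⟨p, hp, hyp⟩
    refine mem_biUnion (hcI p hp) ?_
    obtain ⟨hq, hcq⟩ := hr (c p) ⟨p, hp, rfl⟩
    have h1 : dist p (r (c p)) ≤ (ℓ + 1) * a := by
      refine euclidean_dist_le hapos.le _ _ fun j => ?_
      have h2 : ⌊(r (c p) j - p₀ j) / a⌋ = ⌊(p j - p₀ j) / a⌋ := congrFun hcq j
      have h3 := Int.abs_sub_lt_one_of_floor_eq_floor h2
      rw [← sub_div, abs_div, abs_of_pos hapos, div_lt_one hapos] at h3
      rw [abs_sub_comm]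
      have : r (c p) j - p j = r (c p) j - p₀ j - (p j - p₀ j) := by ring
      rw [this]
      exact h3.le
    have h2 := (hφ p hp.1 _ hq.1).2
    have h3 : L * ρ * ((ℓ + 1) * a) = s := by
      rw [ha]; field_simp
    have h4 : dist (φ p) (φ (r (c p))) ≤ s := by
      rw [← h3]; exact h2.trans (by gcongr)
    rw [mem_closedBall]
    linarith [dist_triangle y (φ p) (φ (r (c p)))]
  -- The 3 collects the rounding of `N`, counted twice, and the cell of index 0; it can be
  -- multiplied by `R / s` because `s ≤ R`.
  have hNle : (2 * N + 1 : ℝ) ≤ (8 * L * (ℓ + 1) + 3) * (R / s) := by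
    have h1 : (N : ℝ) < 4 * R / (ρ * a) + 1 := Int.ceil_lt_add_one _
    have h2 : 4 * R / (ρ * a) = 4 * L * (ℓ + 1) * (R / s) := by
      rw [ha]; field_simp
    have h3 : 1 ≤ R / s := (one_le_div hs).2 hsR
    rw [h2] at h1
    linarith
  have hN0 : 0 ≤ N := Int.ceil_nonneg (by positivity)
  have hcard : (I.card : ℝ) ≤ ((8 * L * (ℓ + 1) + 3) * (R / s)) ^ ℓ := by
    rw [hI, Fintype.card_piFinset]
    simp only [Int.card_Icc, Finset.prod_const, Finset.card_univ, Fintype.card_fin]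
    push_cast
    gcongr
    calc (((N + 1 - -N).toNat : ℕ) : ℝ) = ((N + 1 - -N : ℤ) : ℝ) := by
          have : (((N + 1 - -N).toNat : ℕ) : ℤ) = N + 1 - -N := Int.toNat_of_nonneg (by omega)
          exact_mod_cast this
      _ = 2 * N + 1 := by push_cast; ring
      _ ≤ _ := hNle
  calc volume (closedBall z R ∩ {y | ∃ p ∈ Q, dist y (φ p) < s})
      ≤ ∑ b ∈ I, volume (closedBall (φ (r b)) (2 * s)) :=
        (measure_mono hcov).trans (measure_biUnion_finset_le _ _)
    _ = I.card * (ENNReal.ofReal ((2 * s) ^ d) * volume (ball (0 : E d) 1)) := by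
        rw [Finset.sum_congr rfl fun b _ => Measure.addHaar_closedBall volume _ (by positivity)]
        simp
    _ ≤ ENNReal.ofReal (((8 * L * (ℓ + 1) + 3) * (R / s)) ^ ℓ) *
          (ENNReal.ofReal ((2 * s) ^ d) * volume (ball (0 : E d) 1)) := by
        gcongr
        rw [← ENNReal.ofReal_natCast]
        exact ENNReal.ofReal_le_ofReal hcard
    _ = _ := by
        rw [← mul_assoc, ← ENNReal.ofReal_mul (by positivity)]
        congr 2
        obtain ⟨k, rfl⟩ := Nat.exists_eq_add_of_le hℓ
        simp only [Nat.add_sub_cancel_left, mul_pow, div_pow, pow_add]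
        field_simp

/-- The neighbourhoods of a fracture: volume estimate. -/
lemma IsFracture.exists_volume_le {ℓ m : ℕ} (hℓ : ℓ ≤ d) (hm : 0 < m) (L : ℝ) :
    ∃ C : ℝ, 0 ≤ C ∧ ∀ Λ : Set (E d), IsFracture ℓ m L Λ → ∀ (z : E d) (R s : ℝ), 0 < s → s ≤ R →
      volume (closedBall z R ∩ {y | infDist y Λ < s}) ≤
        ENNReal.ofReal (C * R ^ ℓ * s ^ (d - ℓ)) := by
  -- For `ℓ = 0` the cube is a single point and `L` is unconstrained, possibly negative; enlarging
  -- it is harmless.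
  set L' := max L 1
  set V := (volume (ball (0 : E d) 1)).toReal
  have hV : volume (ball (0 : E d) 1) = ENNReal.ofReal V :=
    (ENNReal.ofReal_toReal measure_ball_lt_top.ne).symm
  have hL'1 : 1 ≤ L' := le_max_right _ _
  have hV0 : 0 ≤ V := ENNReal.toReal_nonneg
  refine ⟨m * ((8 * L' * (ℓ + 1) + 3) ^ ℓ * 2 ^ d * V), by positivity, ?_⟩
  rintro Λ ⟨φ, ρ, hρ, hφ, rfl⟩ z R s hs hsR
  set Q : Set (E ℓ) := {s | ∀ j, s j ∈ Icc (0 : ℝ) 1}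
  have hne : (⋃ i, φ i '' Q).Nonempty := by
    refine ⟨φ ⟨0, hm⟩ 0, mem_iUnion.2 ⟨⟨0, hm⟩, 0, fun j => ?_, rfl⟩⟩
    simp
  have hR : 0 < R := hs.trans_le hsR
  calc volume (closedBall z R ∩ {y | infDist y (⋃ i, φ i '' Q) < s})
      ≤ volume (⋃ i : Fin m, closedBall z R ∩ {y | ∃ p ∈ Q, dist y (φ i p) < s}) := by
        refine measure_mono ?_
        rintro y ⟨hy, hys⟩
        obtain ⟨q, hq, hyq⟩ := (infDist_lt_iff hne).1 hys
        obtain ⟨i, p, hp, rfl⟩ := mem_iUnion.1 hq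
        exact mem_iUnion.2 ⟨i, hy, p, hp, hyq⟩
    _ ≤ ∑ i : Fin m, volume (closedBall z R ∩ {y | ∃ p ∈ Q, dist y (φ i p) < s}) :=
        measure_iUnion_fintype_le _ _
    _ ≤ ∑ _i : Fin m, ENNReal.ofReal ((8 * L' * (ℓ + 1) + 3) ^ ℓ * 2 ^ d * R ^ ℓ * s ^ (d - ℓ)) *
        volume (ball (0 : E d) 1) := by
        refine Finset.sum_le_sum fun i _ => ?_
        refine volume_nhds_piece_le hℓ hL'1 (hρ i) (fun p hp q hq => ⟨(hφ i p q hp hq).1,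
          (hφ i p q hp hq).2.trans ?_⟩) z hs hsR
        have := (hρ i).le
        gcongr
        exact le_max_left _ _
    _ = _ := by
        rw [hV, ← ENNReal.ofReal_mul (by positivity)]
        simp only [Finset.sum_const, Finset.card_univ, Fintype.card_fin, nsmul_eq_mul]
        rw [← ENNReal.ofReal_natCast, ← ENNReal.ofReal_mul (by positivity)]
        congr 1; ring

/-- The distance to `Λ`, as an extended nonnegative number. -/
def dL (Λ : Set (E d)) (x : E d) : ℝ≥0∞ := ENNReal.ofReal (infDist x Λ)

lemma measurable_dL (Λ : Set (E d)) : Measurable (dL Λ) :=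
  (continuous_infDist_pt Λ).measurable.ennreal_ofReal

/-- The distance to a fracture, to a negative power, is a Muckenhoupt weight of class `A₁`. -/
lemma IsFracture.exists_lintegral_le {ℓ m : ℕ} (hℓ : ℓ < d) (hm : 0 < m) (L : ℝ) {γ : ℝ}
    (hγ : 0 ≤ γ) (hγd : γ < d - ℓ) :
    ∃ A : ℝ≥0, ∀ Λ : Set (E d), IsFracture ℓ m L Λ → (∀ᵐ x, 0 < infDist x Λ) ∧
      ∀ (x : E d) (R : ℝ), 0 < R →
        ∫⁻ y in closedBall x R, dL Λ y ^ (-γ) ≤ A * ENNReal.ofReal R ^ d * dL Λ x ^ (-γ) := by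
  obtain ⟨C, hC0, hC⟩ := IsFracture.exists_volume_le hℓ.le hm L (d := d)
  -- The ratio of consecutive dyadic layers: the volume decays like `2^(-k(d-ℓ))` while the weight
  -- grows like `2^(kγ)`. It is below 1 exactly because `γ < d - ℓ`.
  set q : ℝ := (1 / 2) ^ ((d - ℓ : ℝ) - γ) with hq
  have hq0 : 0 ≤ q := by positivity
  have hq1 : q < 1 := Real.rpow_lt_one (by norm_num) (by norm_num) (by linarith)
  set B : ℝ := C * 8 ^ d * (1 - q)⁻¹ with hB
  have hB0 : 0 ≤ B := by
    have : 0 ≤ (1 - q)⁻¹ := inv_nonneg.2 (by linarith)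
    positivity
  set V := (volume (ball (0 : E d) 1)).toReal
  have hV : volume (ball (0 : E d) 1) = ENNReal.ofReal V :=
    (ENNReal.ofReal_toReal measure_ball_lt_top.ne).symm
  refine ⟨(B * 2 ^ γ + 2 ^ γ * V).toNNReal, fun Λ hΛ => ?_⟩
  -- Let `s → 0` in the volume estimate; the exponent `d - ℓ` is positive.
  have hnull : ∀ᵐ x, 0 < infDist x Λ := by
    have h1 : ∀ n : ℕ, volume (closedBall (0 : E d) (n + 1) ∩ {y | infDist y Λ ≤ 0}) = 0 := by
      intro n
      have ht : Filter.Tendsto (fun s : ℝ => ENNReal.ofReal (C * (n + 1) ^ ℓ * s ^ (d - ℓ)))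
          (nhdsWithin 0 (Ioi 0)) (nhds 0) := by
        have : Filter.Tendsto (fun s : ℝ => ENNReal.ofReal (C * (n + 1) ^ ℓ * s ^ (d - ℓ)))
            (nhds 0) (nhds (ENNReal.ofReal (C * (n + 1) ^ ℓ * (0 : ℝ) ^ (d - ℓ)))) :=
          (ENNReal.continuous_ofReal.comp (by fun_prop)).tendsto 0
        rw [zero_pow (by omega), mul_zero, ENNReal.ofReal_zero] at this
        exact this.mono_left nhdsWithin_le_nhds
      refine le_antisymm (ge_of_tendsto ht ?_) bot_le
      filter_upwards [Ioo_mem_nhdsGT (zero_lt_one (α := ℝ))] with s hs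
      refine le_trans (measure_mono ?_) (hC Λ hΛ 0 (n + 1) s hs.1
        (hs.2.le.trans (by simp)))
      exact inter_subset_inter_right _ fun y (hy : _ ≤ _) => hy.trans_lt hs.1
    rw [ae_iff]
    refine measure_mono_null ?_ (measure_iUnion_null h1)
    intro y hy
    obtain ⟨n, hn⟩ := exists_nat_ge (dist y 0)
    exact mem_iUnion.2 ⟨n, by rw [mem_closedBall]; linarith, not_lt.1 hy⟩
  refine ⟨hnull, fun x R hR => ?_⟩
  have hV0 : 0 ≤ V := ENNReal.toReal_nonneg
  -- Far from `Λ` the distance varies on the ball at most by a factor 2. Near `Λ` the value at `x`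
  -- is at least a multiple of `R^(-γ)`, and the integral has to be compared with `R^(d-γ)`.
  rcases le_or_gt (2 * R) (infDist x Λ) with hx | hx
  · have hpt : ∀ y ∈ closedBall x R, dL Λ y ^ (-γ) ≤ ENNReal.ofReal (2 ^ γ) * dL Λ x ^ (-γ) := by
      intro y hy
      have h1 : infDist x Λ ≤ infDist y Λ + dist x y := infDist_le_infDist_add_dist
      rw [mem_closedBall, dist_comm] at hy
      have h2 : 0 < infDist x Λ := by linarith
      have h3 : infDist x Λ / 2 ≤ infDist y Λ := by linarith
      have h4 : 0 < infDist y Λ := by linarith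
      rw [dL, dL, ENNReal.ofReal_rpow_of_pos h2, ENNReal.ofReal_rpow_of_pos h4,
        ← ENNReal.ofReal_mul (by positivity)]
      refine ENNReal.ofReal_le_ofReal ?_
      calc infDist y Λ ^ (-γ) ≤ (infDist x Λ / 2) ^ (-γ) :=
            Real.rpow_le_rpow_of_nonpos (by linarith) h3 (by linarith)
        _ = 2 ^ γ * infDist x Λ ^ (-γ) := by
            rw [Real.div_rpow h2.le (by norm_num), Real.rpow_neg (by norm_num : (0:ℝ) ≤ 2)]
            field_simp
    calc ∫⁻ y in closedBall x R, dL Λ y ^ (-γ)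
        ≤ ∫⁻ _y in closedBall x R, ENNReal.ofReal (2 ^ γ) * dL Λ x ^ (-γ) :=
          setLIntegral_mono' measurableSet_closedBall hpt
      _ = ENNReal.ofReal (2 ^ γ * V) * ENNReal.ofReal R ^ d * dL Λ x ^ (-γ) := by
          rw [setLIntegral_const, Measure.addHaar_closedBall volume x hR.le, hV,
            ENNReal.ofReal_mul (by positivity), ← ENNReal.ofReal_pow hR.le]
          simp only [finrank_euclideanSpace, Fintype.card_fin]
          ring
      _ ≤ _ := by
          gcongr
          rw [ENNReal.ofReal]
          gcongr
          have : 0 ≤ B * 2 ^ γ := by positivity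
          linarith
  -- Extended powers also cover a point `x` at distance 0 from `Λ` without a case distinction.
  · have hxR : ENNReal.ofReal (R ^ (-γ)) ≤ ENNReal.ofReal (2 ^ γ) * dL Λ x ^ (-γ) := by
      have h1 : ENNReal.ofReal (2 * R) ^ (-γ) ≤ dL Λ x ^ (-γ) := by
        rw [ENNReal.rpow_neg, ENNReal.rpow_neg, ENNReal.inv_le_inv]
        exact ENNReal.rpow_le_rpow (ENNReal.ofReal_le_ofReal hx.le) hγ
      calc ENNReal.ofReal (R ^ (-γ)) = ENNReal.ofReal (2 ^ γ) * ENNReal.ofReal (2 * R) ^ (-γ) := by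
            rw [ENNReal.ofReal_rpow_of_pos (by positivity), ← ENNReal.ofReal_mul (by positivity)]
            congr 1
            rw [Real.mul_rpow (by norm_num) hR.le, ← mul_assoc, ← Real.rpow_add (by norm_num)]
            simp
        _ ≤ _ := by gcongr
    -- On the ball `d_Λ ≤ 3R`, so almost every `y` has an `n` with `2R·2^(-n) < d_Λ(y) ≤ 4R·2^(-n)`.
    -- Then `y ∈ u n`, and `v n` bounds the weight at `y`.
    set u : ℕ → Set (E d) := fun k => closedBall x R ∩ {y | infDist y Λ < 8 * R * (1 / 2) ^ k}
    set v : ℕ → ℝ := fun k => (2 * R * (1 / 2) ^ k) ^ (-γ)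
    have hu : ∀ k, MeasurableSet (u k) := fun k => measurableSet_closedBall.inter
      (measurableSet_lt (continuous_infDist_pt Λ).measurable measurable_const)
    have hpt : ∀ᵐ y, y ∈ closedBall x R → dL Λ y ^ (-γ) ≤
        ∑' k, (u k).indicator (fun _ => ENNReal.ofReal (v k)) y := by
      filter_upwards [hnull] with y hy0 hy
      have h1 : infDist y Λ ≤ infDist x Λ + dist y x := infDist_le_infDist_add_dist
      have h2 : infDist y Λ / (4 * R) ≤ 1 := by
        rw [div_le_one (by positivity)]
        rw [mem_closedBall] at hy
        linarith
      obtain ⟨n, hn1, hn2⟩ := exists_nat_pow_near_of_lt_one (y := (1 / 2 : ℝ))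
        (x := infDist y Λ / (4 * R)) (by positivity) h2 (by norm_num) (by norm_num)
      rw [lt_div_iff₀ (by positivity), pow_succ] at hn1
      rw [div_le_iff₀ (by positivity)] at hn2
      have hp : (0 : ℝ) < (1 / 2) ^ n := by positivity
      have hyn : y ∈ u n := ⟨hy, by
        rw [mem_ofPred_eq]
        nlinarith [mul_pos hp hR]⟩
      refine le_trans ?_ (ENNReal.le_tsum n)
      rw [indicator_of_mem hyn, dL, ENNReal.ofReal_rpow_of_pos hy0]
      refine ENNReal.ofReal_le_ofReal (Real.rpow_le_rpow_of_nonpos (by positivity) ?_ (by linarith))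
      linarith
    have hterm : ∀ k, ENNReal.ofReal (v k) * volume (u k) ≤
        ENNReal.ofReal (C * 8 ^ d * R ^ d * R ^ (-γ)) * ENNReal.ofReal q ^ k := by
      intro k
      have hp : (0 : ℝ) < (1 / 2) ^ k := by positivity
      have h1 : volume (u k) ≤ ENNReal.ofReal (C * (8 * R) ^ ℓ * (8 * R * (1 / 2) ^ k) ^ (d - ℓ)) := by
        refine le_trans (measure_mono ?_) (hC Λ hΛ x (8 * R) _ (by positivity) ?_)
        · exact inter_subset_inter_left _ (closedBall_subset_closedBall (by linarith))
        · exact mul_le_of_le_one_right (by positivity) (pow_le_one₀ (by norm_num) (by norm_num))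
      calc _ ≤ ENNReal.ofReal (v k) *
            ENNReal.ofReal (C * (8 * R) ^ ℓ * (8 * R * (1 / 2) ^ k) ^ (d - ℓ)) := by gcongr
        _ ≤ _ := by
          rw [← ENNReal.ofReal_mul (by positivity), ← ENNReal.ofReal_pow hq0,
            ← ENNReal.ofReal_mul (by positivity)]
          refine ENNReal.ofReal_le_ofReal ?_
          have e1 : v k ≤ R ^ (-γ) * ((1 / 2) ^ k) ^ (-γ) := by
            rw [← Real.mul_rpow hR.le hp.le]
            refine Real.rpow_le_rpow_of_nonpos (by positivity) ?_ (by linarith)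
            nlinarith [mul_pos hp hR]
          have e2 : q ^ k = ((1 / 2 : ℝ) ^ k) ^ (-γ) * ((1 / 2) ^ k) ^ (d - ℓ) := by
            rw [hq, ← Real.rpow_natCast, ← Real.rpow_natCast _ (d - ℓ), ← Real.rpow_natCast _ k,
              ← Real.rpow_mul (by norm_num), ← Real.rpow_mul (by norm_num),
              ← Real.rpow_mul (by norm_num), ← Real.rpow_add (by norm_num),
              Nat.cast_sub hℓ.le]
            congr 1; ring
          obtain ⟨j, hj⟩ := Nat.exists_eq_add_of_le hℓ.le
          calc v k * (C * (8 * R) ^ ℓ * (8 * R * (1 / 2) ^ k) ^ (d - ℓ))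
              ≤ (R ^ (-γ) * ((1 / 2) ^ k) ^ (-γ)) *
                (C * (8 * R) ^ ℓ * (8 * R * (1 / 2) ^ k) ^ (d - ℓ)) := by gcongr
            _ = _ := by
              rw [e2]
              have : d - ℓ = j := by omega
              rw [this]
              conv_rhs => rw [hj]
              simp only [mul_pow, pow_add]
              ring
    calc ∫⁻ y in closedBall x R, dL Λ y ^ (-γ)
        ≤ ∫⁻ y in closedBall x R, ∑' k, (u k).indicator (fun _ => ENNReal.ofReal (v k)) y :=
          setLIntegral_mono_ae' measurableSet_closedBall hpt
      _ ≤ ∫⁻ y, ∑' k, (u k).indicator (fun _ => ENNReal.ofReal (v k)) y :=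
          setLIntegral_le_lintegral _ _
      _ = ∑' k, ENNReal.ofReal (v k) * volume (u k) := by
          rw [lintegral_tsum fun k => (measurable_const.indicator (hu k)).aemeasurable]
          exact tsum_congr fun k => lintegral_indicator_const (hu k) _
      _ ≤ ∑' k, ENNReal.ofReal (C * 8 ^ d * R ^ d * R ^ (-γ)) * ENNReal.ofReal q ^ k :=
          ENNReal.tsum_le_tsum hterm
      _ = ENNReal.ofReal (B * R ^ d * R ^ (-γ)) := by
          rw [ENNReal.tsum_mul_left, ENNReal.tsum_geometric,
            ← ENNReal.ofReal_one, ← ENNReal.ofReal_sub _ hq0,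
            ← ENNReal.ofReal_inv_of_pos (by linarith), ← ENNReal.ofReal_mul (by positivity)]
          congr 1
          rw [hB]; ring
      _ = ENNReal.ofReal B * ENNReal.ofReal R ^ d * ENNReal.ofReal (R ^ (-γ)) := by
          rw [← ENNReal.ofReal_pow hR.le, ← ENNReal.ofReal_mul hB0,
            ← ENNReal.ofReal_mul (by positivity)]
      _ ≤ ENNReal.ofReal B * ENNReal.ofReal R ^ d *
          (ENNReal.ofReal (2 ^ γ) * dL Λ x ^ (-γ)) := by gcongr
      _ = ENNReal.ofReal (B * 2 ^ γ) * ENNReal.ofReal R ^ d * dL Λ x ^ (-γ) := by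
          rw [ENNReal.ofReal_mul hB0]; ring
      _ ≤ _ := by
          gcongr
          rw [ENNReal.ofReal]
          gcongr
          have : 0 ≤ 2 ^ γ * V := by positivity
          linarith

/-- Tonelli's theorem: lying within distance `s` is a symmetric relation. -/
lemma lintegral_ball_swap {w g : E d → ℝ≥0∞} (hw : Measurable w) (hg : Measurable g) (s : ℝ) :
    ∫⁻ x, w x * ∫⁻ y in closedBall x s, g y = ∫⁻ y, g y * ∫⁻ x in closedBall y s, w x := by
  have hS : MeasurableSet {p : E d × E d | dist p.2 p.1 ≤ s} :=
    measurableSet_le (by fun_prop) (by fun_prop)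
  have h1 : ∀ x, w x * ∫⁻ y in closedBall x s, g y =
      ∫⁻ y, {p : E d × E d | dist p.2 p.1 ≤ s}.indicator (fun p => w p.1 * g p.2) (x, y) := by
    intro x
    rw [← lintegral_const_mul _ hg, ← lintegral_indicator measurableSet_closedBall]
    rfl
  have h2 : ∀ y, g y * ∫⁻ x in closedBall y s, w x =
      ∫⁻ x, {p : E d × E d | dist p.2 p.1 ≤ s}.indicator (fun p => w p.1 * g p.2) (x, y) := by
    intro y
    rw [← lintegral_const_mul _ hw, ← lintegral_indicator measurableSet_closedBall]
    congr 1 with x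
    simp only [indicator, mem_closedBall, mem_ofPred_eq, dist_comm y x, mul_comm]
  simp_rw [h1, h2]
  refine lintegral_lintegral_swap ?_
  have : Measurable fun p : E d × E d => w p.1 * g p.2 := by fun_prop
  exact (this.indicator hS).aemeasurable

/-- Muckenhoupt `A₁` weights have bounded averages. -/
lemma avgBounded_withDensity {A : ℝ≥0} {ρ : E d → ℝ≥0∞} (hρ : Measurable ρ)
    (h : ∀ (x : E d) (R : ℝ), 0 < R →
      ∫⁻ y in closedBall x R, ρ y ≤ A * ENNReal.ofReal R ^ d * ρ x) :
    AvgBounded (A * (volume (ball (0 : E d) 1)).toNNReal) (volume.withDensity ρ) := by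
  intro s hs g hg
  have hV : ((volume (ball (0 : E d) 1)).toNNReal : ℝ≥0∞) = volume (ball (0 : E d) 1) :=
    ENNReal.coe_toNNReal measure_ball_lt_top.ne
  have hvol : ∀ x : E d, volume (closedBall x s) =
      ENNReal.ofReal s ^ d * volume (ball (0 : E d) 1) := by
    intro x
    rw [Measure.addHaar_closedBall volume x hs.le, ENNReal.ofReal_pow hs.le]
    simp
  have hm : Measurable fun x => (∫⁻ y in closedBall x s, g y) ^ 2 :=
    (measurable_lintegral_closedBall (g := fun _ => g) (by fun_prop) measurable_id
      measurable_const).pow_const 2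
  rw [lintegral_withDensity_eq_lintegral_mul _ hρ hm,
    lintegral_withDensity_eq_lintegral_mul _ hρ (by fun_prop)]
  -- Unweighted Cauchy–Schwarz; after the exchange of integrals the A₁ bound is applied to the ball
  -- average of `ρ` around `y`.
  calc ∫⁻ x, ρ x * (∫⁻ y in closedBall x s, g y) ^ 2
      ≤ ∫⁻ x, ENNReal.ofReal s ^ d * volume (ball (0 : E d) 1) *
          (ρ x * ∫⁻ y in closedBall x s, g y ^ 2) := by
        refine lintegral_mono fun x => ?_
        calc ρ x * (∫⁻ y in closedBall x s, g y) ^ 2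
            ≤ ρ x * ((volume.restrict (closedBall x s)) univ *
              ∫⁻ y in closedBall x s, g y ^ 2) := by
              gcongr
              exact sq_lintegral_le _ hg.aemeasurable
          _ = _ := by rw [Measure.restrict_apply_univ, hvol]; ring
    _ = ENNReal.ofReal s ^ d * volume (ball (0 : E d) 1) *
          ∫⁻ y, g y ^ 2 * ∫⁻ x in closedBall y s, ρ x := by
        rw [lintegral_const_mul' _ _ (by finiteness), lintegral_ball_swap hρ (by fun_prop)]
    _ ≤ ENNReal.ofReal s ^ d * volume (ball (0 : E d) 1) *
          ∫⁻ y, A * ENNReal.ofReal s ^ d * (ρ y * g y ^ 2) := by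
        refine mul_le_mul_right (lintegral_mono fun y => ?_) _
        calc (g y ^ 2 * ∫⁻ x in closedBall y s, ρ x)
            ≤ g y ^ 2 * (A * ENNReal.ofReal s ^ d * ρ y) := by gcongr; exact h y s hs
          _ = _ := by ring
    _ = _ := by
        rw [lintegral_const_mul' _ _ (by finiteness)]
        simp only [Pi.mul_apply, ENNReal.coe_mul, hV]
        ring

/-- Inverses of Muckenhoupt `A₁` weights have bounded averages. -/
lemma avgBounded_withDensity_inv {A : ℝ≥0} {ρ : E d → ℝ≥0∞} (hρ : Measurable ρ)
    (hfin : ∀ᵐ x, ρ x ≠ ⊤) (hpos : ∀ x, ρ x ≠ 0)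
    (h : ∀ (x : E d) (R : ℝ), 0 < R →
      ∫⁻ y in closedBall x R, ρ y ≤ A * ENNReal.ofReal R ^ d * ρ x) :
    AvgBounded (A * (volume (ball (0 : E d) 1)).toNNReal)
      (volume.withDensity fun x => (ρ x)⁻¹) := by
  intro s hs g hg
  have hV : ((volume (ball (0 : E d) 1)).toNNReal : ℝ≥0∞) = volume (ball (0 : E d) 1) :=
    ENNReal.coe_toNNReal measure_ball_lt_top.ne
  have hvol : ∀ x : E d, volume (closedBall x s) =
      ENNReal.ofReal s ^ d * volume (ball (0 : E d) 1) := by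
    intro x
    rw [Measure.addHaar_closedBall volume x hs.le, ENNReal.ofReal_pow hs.le]
    simp
  have hm : Measurable fun x => (∫⁻ y in closedBall x s, g y) ^ 2 :=
    (measurable_lintegral_closedBall (g := fun _ => g) (by fun_prop) measurable_id
      measurable_const).pow_const 2
  -- Cauchy–Schwarz with `g = ρ^(1/2) · ρ^(-1/2) g`: the A₁ bound of the first factor produces `ρ
  -- x`, which cancels the weight `(ρ x)⁻¹`.
  set σ : E d → ℝ≥0∞ := fun x => ρ x ^ (1 / 2 : ℝ)
  have hσ : Measurable σ := hρ.pow_const _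
  have hσ2 : ∀ x, σ x ^ 2 = ρ x := fun x => by
    simp only [σ]
    rw [← ENNReal.rpow_natCast, ← ENNReal.rpow_mul]
    simp
  have hi : Measurable fun x => (ρ x)⁻¹ := hρ.inv
  rw [lintegral_withDensity_eq_lintegral_mul _ hi hm,
    lintegral_withDensity_eq_lintegral_mul _ hi (by fun_prop)]
  have hCS : ∀ x, (∫⁻ y in closedBall x s, g y) ^ 2 ≤
      (A * ENNReal.ofReal s ^ d * ρ x) * ∫⁻ y in closedBall x s, (ρ y)⁻¹ * g y ^ 2 := by
    intro x
    have h1 : ∫⁻ y in closedBall x s, g y = ∫⁻ y in closedBall x s, σ y * ((σ y)⁻¹ * g y) := by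
      refine lintegral_congr_ae (ae_restrict_of_ae ?_)
      filter_upwards [hfin] with y hy
      have : σ y ≠ ⊤ := fun h' => hy (by rw [← hσ2, h']; simp)
      have h0 : σ y ≠ 0 := fun h' => hpos y (by rw [← hσ2, h']; simp)
      rw [← mul_assoc, ENNReal.mul_inv_cancel h0 this, one_mul]
    rw [h1]
    calc _ ≤ (∫⁻ y in closedBall x s, σ y ^ 2) * ∫⁻ y in closedBall x s, ((σ y)⁻¹ * g y) ^ 2 :=
          sq_lintegral_mul_le _ hσ.aemeasurable (hσ.inv.mul hg).aemeasurable
      _ ≤ _ := by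
          simp only [mul_pow, ← ENNReal.inv_pow, hσ2]
          gcongr
          exact h x s hs
  calc ∫⁻ x, (ρ x)⁻¹ * (∫⁻ y in closedBall x s, g y) ^ 2
      ≤ ∫⁻ x, A * ENNReal.ofReal s ^ d *
          (1 * ∫⁻ y in closedBall x s, (ρ y)⁻¹ * g y ^ 2) := by
        refine lintegral_mono fun x => ?_
        calc _ ≤ (ρ x)⁻¹ * ((A * ENNReal.ofReal s ^ d * ρ x) *
              ∫⁻ y in closedBall x s, (ρ y)⁻¹ * g y ^ 2) := by
              gcongr; exact hCS x
          _ = A * ENNReal.ofReal s ^ d * (((ρ x)⁻¹ * ρ x) *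
              ∫⁻ y in closedBall x s, (ρ y)⁻¹ * g y ^ 2) := by ring
          _ ≤ _ := by gcongr; exact ENNReal.inv_mul_le_one _
    _ = A * ENNReal.ofReal s ^ d *
          ∫⁻ y, ((ρ y)⁻¹ * g y ^ 2) * ∫⁻ x in closedBall y s, 1 := by
        rw [lintegral_const_mul' _ _ (by finiteness), lintegral_ball_swap measurable_const
          (g := fun y => (ρ y)⁻¹ * g y ^ 2) (by fun_prop)]
    _ = _ := by
        simp only [lintegral_one, Measure.restrict_apply_univ, hvol]
        rw [lintegral_mul_const' _ _ (by finiteness)]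
        simp only [Pi.mul_apply, ENNReal.coe_mul, hV]
        ring

/-- The powers of the distance to a fracture have bounded averages. -/
lemma IsFracture.exists_avgBounded {ℓ m : ℕ} (hℓ : ℓ < d) (hm : 0 < m) (L : ℝ) {β : ℝ}
    (hβ : β ∈ Set.Ioo (-(((d : ℝ) - ℓ) / 2)) (((d : ℝ) - ℓ) / 2)) :
    ∃ A : ℝ≥0, ∀ Λ : Set (E d), IsFracture ℓ m L Λ →
      AvgBounded A (wMeas Λ β) ∧ volume ≪ wMeas Λ β ∧ IsLocallyFiniteMeasure (wMeas Λ β) := by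
  have hd : (0 : ℝ) < d - ℓ := by
    have : (ℓ : ℝ) < d := by exact_mod_cast hℓ
    linarith
  -- The range of `β` is exactly `2|β| < d - ℓ`.
  obtain ⟨A, hA⟩ := IsFracture.exists_lintegral_le (d := d) hℓ hm L (γ := 2 * |β|) (by positivity)
    (by
      have := abs_lt.2 hβ
      linarith)
  refine ⟨A * (volume (ball (0 : E d) 1)).toNNReal, fun Λ hΛ => ?_⟩
  obtain ⟨hpos, hint⟩ := hA Λ hΛ
  have hm : Measurable fun x => ENNReal.ofReal (infDist x Λ ^ (2 * β)) :=
    ((continuous_infDist_pt Λ).measurable.pow_const _).ennreal_ofReal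
  have hac : volume ≪ wMeas Λ β := by
    refine withDensity_absolutelyContinuous' hm.aemeasurable ?_
    filter_upwards [hpos] with x hx
    simp only [ne_eq, ENNReal.ofReal_eq_zero, not_le]
    positivity
  rcases le_or_gt β 0 with hβ0 | hβ0
  -- For `β < 0` the densities differ where the distance vanishes: the real power of 0 is 0, the
  -- extended one is infinite. That set is null.
  · have : wMeas Λ β = volume.withDensity fun x => dL Λ x ^ (-(2 * |β|)) := by
      refine withDensity_congr_ae ?_
      filter_upwards [hpos] with x hx
      rw [dL, ENNReal.ofReal_rpow_of_pos hx, abs_of_nonpos hβ0]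
      congr 2; ring
    refine ⟨?_, hac, ?_⟩
    · rw [this]
      exact avgBounded_withDensity ((measurable_dL Λ).pow_const _) hint
    · obtain ⟨x, hx⟩ := hpos.exists
      refine ⟨fun y => ⟨closedBall y 1, closedBall_mem_nhds y one_pos, ?_⟩⟩
      rw [this, withDensity_apply _ measurableSet_closedBall]
      calc _ ≤ ∫⁻ z in closedBall x (dist y x + 1), dL Λ z ^ (-(2 * |β|)) :=
            lintegral_mono_set (closedBall_subset_closedBall' (by linarith))
        _ ≤ _ := hint x _ (by positivity)
        _ < ⊤ := by
            rw [dL, ENNReal.ofReal_rpow_of_pos hx]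
            finiteness
  · have : wMeas Λ β = volume.withDensity fun x => (dL Λ x ^ (-(2 * |β|)))⁻¹ := by
      refine withDensity_congr_ae ?_
      filter_upwards [hpos] with x hx
      rw [dL, ← ENNReal.rpow_neg, ENNReal.ofReal_rpow_of_pos hx, abs_of_pos hβ0]
      congr 2; ring
    refine ⟨?_, hac, IsLocallyFiniteMeasure.withDensity_ofReal
      ((continuous_infDist_pt Λ).rpow_const fun _ => Or.inr (by positivity))⟩
    rw [this]
    refine avgBounded_withDensity_inv ((measurable_dL Λ).pow_const _) ?_ ?_ hint
    · filter_upwards [hpos] with x hx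
      rw [dL, ENNReal.ofReal_rpow_of_pos hx]
      finiteness
    · intro x
      rw [dL, ENNReal.rpow_neg, ENNReal.inv_ne_zero]
      exact ENNReal.rpow_ne_top_of_nonneg (by positivity) ENNReal.ofReal_ne_top

/-! ### Barycentric coordinates -/

/-- The vertices of a nondegenerate simplex of full dimension. -/
def IsSimplex (t : Finset (E d)) : Prop :=
  AffineIndependent ℝ ((↑) : t → E d) ∧ t.card = d + 1

/-- The vertices of a simplex, as an affine basis. -/
def IsSimplex.basis {t : Finset (E d)} (ht : IsSimplex t) : AffineBasis t ℝ (E d) where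
  toFun := (↑)
  ind' := ht.1
  tot' := ht.1.affineSpan_eq_top_iff_card_eq_finrank_add_one.2 (by simp [ht.2])

@[simp]
lemma IsSimplex.basis_apply {t : Finset (E d)} (ht : IsSimplex t) (p : t) :
    ht.basis p = (p : E d) := rfl

open Classical in
/-- The barycentric coordinate of a simplex `t` that corresponds to the vertex `p`. -/
def bary (t : Finset (E d)) (p : E d) : E d →ᵃ[ℝ] ℝ :=
  if h : IsSimplex t ∧ p ∈ t then h.1.basis.coord ⟨p, h.2⟩ else 0

section Simplex

variable {t : Finset (E d)}

lemma bary_of_mem (ht : IsSimplex t) (p : t) : bary t p = ht.basis.coord p := by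
  rw [bary, dif_pos ⟨ht, p.2⟩]

/-- With this default value, `bary t v` agrees with the nodal function of `v` on each element `t`,
whether or not `v` is one of its vertices. -/
lemma bary_of_notMem {p : E d} (hp : p ∉ t) : bary t p = 0 := by
  rw [bary, dif_neg fun h => hp h.2]

lemma bary_self (ht : IsSimplex t) {p : E d} (hp : p ∈ t) : bary t p p = 1 := by
  have := bary_of_mem ht ⟨p, hp⟩
  simp only at this
  rw [this]
  exact ht.basis.coord_apply_eq ⟨p, hp⟩

lemma bary_ne (ht : IsSimplex t) {p q : E d} (hq : q ∈ t) (hpq : p ≠ q) : bary t p q = 0 := by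
  by_cases hp : p ∈ t
  · have := bary_of_mem ht ⟨p, hp⟩
    simp only at this
    rw [this]
    exact ht.basis.coord_apply_ne (j := ⟨q, hq⟩) (fun h => hpq (congrArg Subtype.val h))
  · simp [bary_of_notMem hp]

lemma sum_bary (ht : IsSimplex t) (x : E d) : ∑ p ∈ t, bary t p x = 1 := by
  rw [← Finset.sum_coe_sort]
  simp_rw [bary_of_mem ht]
  exact ht.basis.sum_coord_apply_eq_one x

lemma sum_bary_smul (ht : IsSimplex t) (x : E d) : ∑ p ∈ t, bary t p x • p = x := by
  rw [← Finset.sum_coe_sort t fun p => bary t p x • p]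
  simp_rw [bary_of_mem ht]
  exact ht.basis.linear_combination_coord_eq_self x

lemma affine_eq_sum (ht : IsSimplex t) (f : E d →ᵃ[ℝ] ℝ) (x : E d) :
    f x = ∑ p ∈ t, bary t p x * f p := by
  have h1 : ∀ y, f y = f.linear y + f 0 := fun y => by
    have := congrFun f.decomp y
    simpa using this
  conv_lhs => rw [← sum_bary_smul ht x, h1]
  rw [map_sum]
  have h2 : ∀ p ∈ t, bary t p x * f p = bary t p x * f.linear p + bary t p x * f 0 := fun p _ => by
    rw [← mul_add, ← h1]
  rw [Finset.sum_congr rfl h2, Finset.sum_add_distrib, ← Finset.sum_mul, sum_bary ht]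
  simp

lemma mem_convexHull_iff (ht : IsSimplex t) {x : E d} :
    x ∈ convexHull ℝ (t : Set (E d)) ↔ ∀ p ∈ t, 0 ≤ bary t p x := by
  have h1 : (t : Set (E d)) = range ht.basis := by
    ext y
    simp
  rw [h1, ht.basis.convexHull_eq_nonneg_coord]
  simp only [mem_ofPred_eq]
  constructor
  · intro h p hp
    have := h ⟨p, hp⟩
    rwa [← bary_of_mem ht] at this
  · intro h p
    rw [← bary_of_mem ht]
    exact h p p.2

lemma mem_interior_iff (ht : IsSimplex t) {x : E d} :
    x ∈ interior (convexHull ℝ (t : Set (E d))) ↔ ∀ p ∈ t, 0 < bary t p x := by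
  have h1 : (t : Set (E d)) = range ht.basis := by
    ext y
    simp
  rw [h1, ht.basis.interior_convexHull]
  simp only [mem_ofPred_eq]
  constructor
  · intro h p hp
    have := h ⟨p, hp⟩
    rwa [← bary_of_mem ht] at this
  · intro h p
    rw [← bary_of_mem ht]
    exact h p p.2

lemma bary_le_one (ht : IsSimplex t) {x : E d} (hx : x ∈ convexHull ℝ (t : Set (E d))) (p : E d) :
    bary t p x ≤ 1 := by
  by_cases hp : p ∈ t
  · rw [← sum_bary ht x]
    exact Finset.single_le_sum (f := fun q => bary t q x)
      (fun q hq => (mem_convexHull_iff ht).1 hx q hq) hp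
  · simp [bary_of_notMem hp]

lemma bary_nonneg (ht : IsSimplex t) {x : E d} (hx : x ∈ convexHull ℝ (t : Set (E d))) (p : E d) :
    0 ≤ bary t p x := by
  by_cases hp : p ∈ t
  · exact (mem_convexHull_iff ht).1 hx p hp
  · simp [bary_of_notMem hp]

lemma bary_eq_zero_of_mem_face (ht : IsSimplex t) {s : Finset (E d)} (hst : s ⊆ t) {x p : E d}
    (hx : x ∈ convexHull ℝ (s : Set (E d))) (hp : p ∉ s) : bary t p x = 0 := by
  have h1 : convexHull ℝ (s : Set (E d)) ⊆ bary t p ⁻¹' {0} := by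
    refine convexHull_min ?_ ((convex_singleton 0).affine_preimage (bary t p))
    intro q hq
    exact bary_ne ht (hst hq) fun h => hp (h ▸ hq)
  exact h1 hx

lemma mem_face_iff (ht : IsSimplex t) {s : Finset (E d)} (hst : s ⊆ t) {x : E d} :
    x ∈ convexHull ℝ (s : Set (E d)) ↔ (∀ p ∈ s, 0 ≤ bary t p x) ∧ ∀ p ∈ t, p ∉ s → bary t p x = 0 := by
  constructor
  · intro h
    exact ⟨fun p hp => bary_nonneg ht (convexHull_mono (by exact_mod_cast hst) h) p,
      fun p _ hps => bary_eq_zero_of_mem_face ht hst h hps⟩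
  · rintro ⟨h1, h2⟩
    have h3 : ∑ p ∈ s, bary t p x = 1 := by
      rw [← sum_bary ht x]
      exact Finset.sum_subset hst fun p hp hps => h2 p hp hps
    have h4 : ∑ p ∈ s, bary t p x • p = x := by
      conv_rhs => rw [← sum_bary_smul ht x]
      exact Finset.sum_subset hst fun p hp hps => by rw [h2 p hp hps, zero_smul]
    rw [← h4]
    exact (convex_convexHull ℝ _).sum_mem h1 h3 fun p hp => subset_convexHull ℝ _ hp

lemma continuous_affine (f : E d →ᵃ[ℝ] ℝ) : Continuous f :=
  AffineMap.continuous_of_finiteDimensional f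

/-- Compare the values of `f` at the two ends of the diameter in direction `v`. -/
lemma abs_linear_le {f : E d →ᵃ[ℝ] ℝ} {c : E d} {r D : ℝ} (hr : 0 < r)
    (h : ∀ x ∈ closedBall c r, ∀ y ∈ closedBall c r, |f x - f y| ≤ D) (v : E d) :
    |f.linear v| ≤ D / (2 * r) * ‖v‖ := by
  rcases eq_or_ne v 0 with rfl | hv
  · simp
  have hv' : 0 < ‖v‖ := norm_pos_iff.2 hv
  have h1 := h (c + (r / ‖v‖) • v) (by simp [norm_smul, hv'.ne', abs_of_pos hr])
    (c - (r / ‖v‖) • v) (by simp [norm_smul, hv'.ne', abs_of_pos hr])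
  have h2 : f (c + (r / ‖v‖) • v) - f (c - (r / ‖v‖) • v) = 2 * r / ‖v‖ * f.linear v := by
    rw [f.decomp]
    simp only [Pi.add_apply, map_add, map_sub, map_smul, smul_eq_mul]
    ring
  rw [h2, abs_mul, abs_of_pos (by positivity)] at h1
  rw [div_mul_eq_mul_div, le_div_iff₀ (by positivity)]
  rw [div_mul_eq_mul_div, div_le_iff₀ hv'] at h1
  linarith

/-- On the inscribed ball the coordinate stays between 0 and 1, and an affine function has the same
slope everywhere. -/
lemma abs_bary_sub_le (ht : IsSimplex t) {c : E d} {r : ℝ} (hr : 0 < r)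
    (h : closedBall c r ⊆ convexHull ℝ (t : Set (E d))) (p x y : E d) :
    |bary t p x - bary t p y| ≤ dist x y / (2 * r) := by
  have h1 := abs_linear_le (f := bary t p) (c := c) (D := 1) hr (fun x hx y hy => by
    have h1 := bary_nonneg ht (h hx) p
    have h2 := bary_nonneg ht (h hy) p
    have h3 := bary_le_one ht (h hx) p
    have h4 := bary_le_one ht (h hy) p
    rw [abs_le]; constructor <;> linarith) (x - y)
  have h2 : bary t p x - bary t p y = (bary t p).linear (x - y) := by
    rw [map_sub]
    conv_lhs => rw [(bary t p).decomp]
    simp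
  rw [h2, dist_eq_norm]
  exact h1.trans (le_of_eq (by ring))

lemma isClosed_convexHull (t : Finset (E d)) : IsClosed (convexHull ℝ (t : Set (E d))) :=
  t.finite_toSet.isClosed_convexHull ℝ

lemma isCompact_convexHull (t : Finset (E d)) : IsCompact (convexHull ℝ (t : Set (E d))) :=
  t.finite_toSet.isCompact_convexHull ℝ

lemma measurableSet_convexHull (t : Finset (E d)) :
    MeasurableSet (convexHull ℝ (t : Set (E d))) := (isClosed_convexHull t).measurableSet

lemma volume_frontier_convexHull (t : Finset (E d)) :
    volume (frontier (convexHull ℝ (t : Set (E d)))) = 0 :=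
  (convex_convexHull ℝ _).addHaar_frontier volume

lemma interior_convexHull_nonempty (ht : IsSimplex t) :
    (interior (convexHull ℝ (t : Set (E d)))).Nonempty := by
  rw [interior_convexHull_nonempty_iff_affineSpan_eq_top]
  have h1 : (t : Set (E d)) = range ht.basis := by
    ext y
    simp
  rw [h1]
  exact ht.basis.tot

lemma closure_interior_convexHull (ht : IsSimplex t) :
    closure (interior (convexHull ℝ (t : Set (E d)))) = convexHull ℝ (t : Set (E d)) := by
  rw [(convex_convexHull ℝ _).closure_interior_eq_closure_of_nonempty_interior
    (interior_convexHull_nonempty ht), (isClosed_convexHull t).closure_eq]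

/-- Supplies the exceptional sets of the general position arguments below. -/
lemma volume_affineSpan_eq_zero {s : Finset (E d)} (hs : s.card ≤ d) :
    volume (affineSpan ℝ (s : Set (E d)) : Set (E d)) = 0 := by
  refine Measure.addHaar_affineSubspace volume _ fun h => ?_
  rcases s.eq_empty_or_nonempty with rfl | hne
  · simp only [Finset.coe_empty, AffineSubspace.span_empty] at h
    have := congrArg (fun A : AffineSubspace ℝ (E d) => (A : Set (E d)).Nonempty) h
    simp at this
  · have h1 : vectorSpan ℝ (s : Set (E d)) = ⊤ := by
      rw [← direction_affineSpan, h, AffineSubspace.direction_top]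
    obtain ⟨n, hn⟩ : ∃ n, s.card = n + 1 := Nat.exists_eq_add_of_lt hne.card_pos |>.imp (by simp)
    have h2 := finrank_vectorSpan_image_finset_le ℝ (id : E d → E d) s hn
    rw [Finset.image_id] at h2
    rw [h1, finrank_top, finrank_euclideanSpace, Fintype.card_fin] at h2
    omega

end Simplex

/-! ### Elements and patches of a mesh -/

/-- The domain lies on one side of its boundary: moving down from a boundary point leads strictly
below the graph, to points with a neighbourhood that misses `Ω`. As the elements only determine
`closure Ω`, this is how membership in `Ω` is recovered from the mesh. -/
lemma IsLipschitzDomain.interior_closure {Ω : Set (E d)} (hΩ : IsLipschitzDomain Ω) :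
    interior (closure Ω) = Ω := by
  refine Subset.antisymm (fun x hx => ?_) hΩ.isOpen.subset_interior_closure
  by_contra hxΩ
  have hxf : x ∈ frontier Ω := by
    rw [hΩ.isOpen.frontier_eq]
    exact ⟨interior_subset hx, hxΩ⟩
  obtain ⟨n, γ, M, r, hn, hr, hγ, hinv, hloc⟩ := hΩ.lipschitz x hxf
  have hx1 : inner ℝ n x ≤ γ x := by
    by_contra h
    exact hxΩ ((hloc x (mem_ball_self hr)).2 (not_le.1 h))
  have ht : Filter.Tendsto (fun τ : ℝ => x + (-τ) • n) (nhdsWithin 0 (Ioi 0)) (nhds x) := by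
    have : Filter.Tendsto (fun τ : ℝ => x + (-τ) • n) (nhds 0) (nhds (x + (-(0 : ℝ)) • n)) :=
      Continuous.tendsto (by fun_prop) 0
    simp only [neg_zero, zero_smul, add_zero] at this
    exact this.mono_left nhdsWithin_le_nhds
  have h1 : ∀ᶠ τ in nhdsWithin (0 : ℝ) (Ioi 0),
      x + (-τ) • n ∈ interior (closure Ω) ∩ ball x r :=
    ht (Filter.inter_mem (isOpen_interior.mem_nhds hx) (ball_mem_nhds x hr))
  obtain ⟨τ, ⟨hτ1, hτ2⟩, hτ0⟩ := (h1.and self_mem_nhdsWithin).exists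
  have hτ0 : 0 < τ := hτ0
  set y := x + (-τ) • n with hy
  set U : Set (E d) := {z | inner ℝ n z < γ z} ∩ ball x r
  have hU : IsOpen U := (isOpen_lt (by fun_prop) hγ.continuous).inter isOpen_ball
  have hyU : y ∈ U := by
    refine ⟨?_, hτ2⟩
    change inner ℝ n y < γ y
    rw [hy, hinv, inner_add_right, inner_smul_right, real_inner_self_eq_norm_sq, hn]
    linarith
  obtain ⟨z, hzU, hzΩ⟩ := mem_closure_iff.1 (interior_subset hτ1) U hU hyU
  have := (hloc z hzU.2).1 hzΩ
  exact lt_asymm this hzU.1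

section Mesh

variable {Ω : Set (E d)} {κ H : ℝ} {K : Geometry.SimplicialComplex ℝ (E d)}

lemma isSimplex_of_mem {t : Finset (E d)} (ht : t ∈ elements K) : IsSimplex t :=
  ⟨K.indep ht.1, ht.2⟩

lemma convexHull_inter {s t : Finset (E d)} (hs : s ∈ elements K) (ht : t ∈ elements K) :
    convexHull ℝ (s : Set (E d)) ∩ convexHull ℝ (t : Set (E d)) =
      convexHull ℝ ((s ∩ t : Finset (E d)) : Set (E d)) := by
  rw [K.convexHull_inter_convexHull hs.1 ht.1, Finset.coe_inter]

lemma inter_nonempty_of_mem {s t : Finset (E d)} (hs : s ∈ elements K) (ht : t ∈ elements K)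
    {x : E d} (hxs : x ∈ convexHull ℝ (s : Set (E d))) (hxt : x ∈ convexHull ℝ (t : Set (E d))) :
    (s ∩ t).Nonempty := by
  have h : x ∈ convexHull ℝ ((s ∩ t : Finset (E d)) : Set (E d)) := by
    rw [← convexHull_inter hs ht]; exact ⟨hxs, hxt⟩
  exact_mod_cast convexHull_nonempty_iff.1 ⟨x, h⟩

lemma mem_of_vertex_mem {t : Finset (E d)} (ht : t ∈ elements K) {v : E d} (hv : v ∈ K.vertices)
    (h : v ∈ convexHull ℝ (t : Set (E d))) : v ∈ t :=
  (K.vertex_mem_convexHull_iff hv ht.1).1 h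

lemma vertex_of_mem {t : Finset (E d)} (ht : t ∈ elements K) {v : E d} (hv : v ∈ t) :
    v ∈ K.vertices := by
  rw [Geometry.SimplicialComplex.vertices_eq]
  exact mem_biUnion ht.1 hv

/-- If an element meets the interior of another one, they coincide. -/
lemma eq_of_mem_interior {s t : Finset (E d)} (hs : s ∈ elements K) (ht : t ∈ elements K) {x : E d}
    (hxs : x ∈ interior (convexHull ℝ (s : Set (E d)))) (hxt : x ∈ convexHull ℝ (t : Set (E d))) :
    s = t := by
  have h : x ∈ convexHull ℝ ((s ∩ t : Finset (E d)) : Set (E d)) := by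
    rw [← convexHull_inter hs ht]; exact ⟨interior_subset hxs, hxt⟩
  have hst : s ⊆ t := by
    intro p hp
    by_contra hpt
    have h1 := bary_eq_zero_of_mem_face (isSimplex_of_mem hs) Finset.inter_subset_left h
      (p := p) (by simp [hpt])
    have h2 := (mem_interior_iff (isSimplex_of_mem hs)).1 hxs p hp
    linarith
  exact Finset.eq_of_subset_of_card_le hst (by rw [hs.2, ht.2])

namespace IsMesh

variable (hK : IsMesh Ω κ H K)
include hK

lemma elements_finite : (elements K).Finite := hK.finite.subset fun _ h => h.1

lemma vertices_finite : K.vertices.Finite := by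
  rw [Geometry.SimplicialComplex.vertices_eq]
  exact hK.finite.biUnion fun s _ => s.finite_toSet

lemma convexHull_subset {t : Finset (E d)} (ht : t ∈ elements K) :
    convexHull ℝ (t : Set (E d)) ⊆ closure Ω := by
  rw [← hK.space_eq]
  exact K.convexHull_subset_space ht.1

lemma exists_mem_of_mem_closure {x : E d} (hx : x ∈ closure Ω) :
    ∃ t ∈ elements K, x ∈ convexHull ℝ (t : Set (E d)) := by
  rw [← hK.space_eq, Geometry.SimplicialComplex.mem_space_iff] at hx
  obtain ⟨s, hs, hxs⟩ := hx
  obtain ⟨t, ht, hst⟩ := hK.pure s hs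
  exact ⟨t, ht, convexHull_mono (by exact_mod_cast hst) hxs⟩

lemma exists_mem_of_vertex {v : E d} (hv : v ∈ K.vertices) : ∃ t ∈ elements K, v ∈ t := by
  obtain ⟨t, ht, hst⟩ := hK.pure _ hv
  exact ⟨t, ht, by simpa using hst⟩

lemma vertex_mem_closure {v : E d} (hv : v ∈ K.vertices) : v ∈ closure Ω := by
  rw [← hK.space_eq]
  exact K.vertices_subset_space hv

lemma interior_subset_domain (hΩ : IsLipschitzDomain Ω) {t : Finset (E d)} (ht : t ∈ elements K) :
    interior (convexHull ℝ (t : Set (E d))) ⊆ Ω := by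
  conv_rhs => rw [← hΩ.interior_closure]
  exact interior_mono (hK.convexHull_subset ht)

/-- Quasi-uniformity: elements contain balls of a radius proportional to `H`. -/
lemma exists_ball (hd : 0 < d) {t : Finset (E d)} (ht : t ∈ elements K) :
    0 < H ∧ 2 ≤ κ ∧ ∃ c, closedBall c (H / κ ^ 2) ⊆ convexHull ℝ (t : Set (E d)) := by
  obtain ⟨c, r, hr, hball, hdiam⟩ := hK.shapeRegular t ht
  obtain ⟨h1, h2⟩ := hK.quasiUniform t ht
  have : Nonempty (Fin d) := ⟨⟨0, hd⟩⟩
  have : Nontrivial (E d) := inferInstance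
  have h3 : 2 * r ≤ diam (convexHull ℝ (t : Set (E d))) := by
    rw [← diam_closedBall_eq c hr.le]
    exact diam_mono hball (isCompact_convexHull t).isBounded
  -- The inscribed ball has diameter `2r`, while the element has diameter at most `κr`.
  have hκ : 2 ≤ κ := by
    by_contra h
    have := mul_lt_mul_of_pos_right (not_le.1 h) hr
    linarith
  -- `H ≤ κ diam T ≤ κ² r`.
  refine ⟨by linarith, hκ, c, (closedBall_subset_closedBall ?_).trans hball⟩
  rw [div_le_iff₀ (by positivity)]
  nlinarith

lemma dist_le {t : Finset (E d)} (ht : t ∈ elements K) {x y : E d}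
    (hx : x ∈ convexHull ℝ (t : Set (E d))) (hy : y ∈ convexHull ℝ (t : Set (E d))) :
    dist x y ≤ H :=
  (dist_le_diam_of_mem (isCompact_convexHull t).isBounded hx hy).trans (hK.quasiUniform t ht).1

end IsMesh

/-- The elements of the extended patches. -/
def patchElts (K : Geometry.SimplicialComplex ℝ (E d)) (v : E d) : ℕ → Set (Finset (E d))
  | 0 => {t | t ∈ elements K ∧ v ∈ t}
  | k + 1 => {t | t ∈ elements K ∧ ∃ s ∈ patchElts K v k, (t ∩ s).Nonempty}

lemma patchElts_subset (v : E d) (k : ℕ) : patchElts K v k ⊆ elements K := by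
  cases k <;> exact fun t ht => ht.1

lemma patchElts_subset_succ (v : E d) (k : ℕ) : patchElts K v k ⊆ patchElts K v (k + 1) := by
  intro t ht
  have hte := patchElts_subset v k ht
  refine ⟨hte, t, ht, ?_⟩
  rw [Finset.inter_self, ← Finset.card_pos, hte.2]
  omega

lemma IsMesh.closure_iUnion (hK : IsMesh Ω κ H K) {S : Set (Finset (E d))} (hS : S ⊆ elements K)
    {D : Set (E d)} (h1 : D ⊆ ⋃ t ∈ S, convexHull ℝ (t : Set (E d)))
    (h2 : ∀ t ∈ S, interior (convexHull ℝ (t : Set (E d))) ⊆ D) :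
    closure D = ⋃ t ∈ S, convexHull ℝ (t : Set (E d)) := by
  refine Subset.antisymm ?_ (iUnion₂_subset fun t ht => ?_)
  · refine closure_minimal h1 ?_
    exact (hK.elements_finite.subset hS).isClosed_biUnion fun t _ => isClosed_convexHull t
  · rw [← closure_interior_convexHull (isSimplex_of_mem (hS ht))]
    exact closure_mono (h2 t ht)

/-- The two inclusions pin down the closure of the patch as the union of its elements. For the
induction: an element meets this closure iff it shares a vertex with one of those elements, because
intersections of elements are common faces. -/
lemma patch_aux (hΩ : IsLipschitzDomain Ω) (hK : IsMesh Ω κ H K) (v : E d) (k : ℕ) :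
    patch Ω K v k ⊆ ⋃ t ∈ patchElts K v k, convexHull ℝ (t : Set (E d)) ∧
    ∀ t ∈ patchElts K v k, interior (convexHull ℝ (t : Set (E d))) ⊆ patch Ω K v k := by
  induction k with
  | zero =>
    refine ⟨inter_subset_left, fun t ht => subset_inter ?_ (hK.interior_subset_domain hΩ ht.1)⟩
    exact interior_subset.trans (subset_biUnion_of_mem (u := fun t : Finset (E d) =>
      convexHull ℝ (t : Set (E d))) ht)
  | succ k ih =>
    have hcl := hK.closure_iUnion (patchElts_subset v k) ih.1 ih.2
    have hS : {t | t ∈ elements K ∧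
        (convexHull ℝ (t : Set (E d)) ∩ closure (patch Ω K v k)).Nonempty} =
        patchElts K v (k + 1) := by
      ext t
      rw [hcl]
      refine and_congr_right fun ht => ⟨?_, ?_⟩
      · rintro ⟨x, hxt, hx⟩
        obtain ⟨s, hs, hxs⟩ := mem_iUnion₂.1 hx
        exact ⟨s, hs, inter_nonempty_of_mem ht (patchElts_subset v k hs) hxt hxs⟩
      · rintro ⟨s, hs, p, hp⟩
        rw [Finset.mem_inter] at hp
        exact ⟨p, subset_convexHull ℝ _ hp.1, mem_biUnion hs (subset_convexHull ℝ _ hp.2)⟩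
    rw [patch, hS]
    refine ⟨inter_subset_left.trans interior_subset, fun t ht => subset_inter ?_
      (hK.interior_subset_domain hΩ ht.1)⟩
    exact interior_mono (subset_biUnion_of_mem (u := fun t : Finset (E d) =>
      convexHull ℝ (t : Set (E d))) ht)

lemma patch_subset (hΩ : IsLipschitzDomain Ω) (hK : IsMesh Ω κ H K) (v : E d) (k : ℕ) :
    patch Ω K v k ⊆ ⋃ t ∈ patchElts K v k, convexHull ℝ (t : Set (E d)) := (patch_aux hΩ hK v k).1

lemma patch_subset_domain (v : E d) (k : ℕ) : patch Ω K v k ⊆ Ω := by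
  cases k <;> exact inter_subset_right

lemma interior_subset_patch (hΩ : IsLipschitzDomain Ω) (hK : IsMesh Ω κ H K) {v : E d} {k : ℕ}
    {t : Finset (E d)} (ht : t ∈ patchElts K v k) :
    interior (convexHull ℝ (t : Set (E d))) ⊆ patch Ω K v k := (patch_aux hΩ hK v k).2 t ht

lemma closure_patch (hΩ : IsLipschitzDomain Ω) (hK : IsMesh Ω κ H K) (v : E d) (k : ℕ) :
    closure (patch Ω K v k) = ⋃ t ∈ patchElts K v k, convexHull ℝ (t : Set (E d)) :=
  hK.closure_iUnion (patchElts_subset v k) (patch_subset hΩ hK v k)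
    fun _ ht => interior_subset_patch hΩ hK ht

lemma mem_patchElts_of_subset (hΩ : IsLipschitzDomain Ω) (hK : IsMesh Ω κ H K) {v : E d} {k : ℕ}
    {t : Finset (E d)} (ht : t ∈ elements K)
    (h : convexHull ℝ (t : Set (E d)) ⊆ closure (patch Ω K v k)) : t ∈ patchElts K v k := by
  obtain ⟨x, hx⟩ := interior_convexHull_nonempty (isSimplex_of_mem ht)
  have h1 := h (interior_subset hx)
  rw [closure_patch hΩ hK] at h1
  obtain ⟨s, hs, hxs⟩ := mem_iUnion₂.1 h1
  rwa [eq_of_mem_interior ht (patchElts_subset v k hs) hx hxs]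

/-! ### Points in the relative interior of a face -/

/-- `x` lies in the relative interior of the face `f`, a face of the element `t`. -/
def InFace (t f : Finset (E d)) (x : E d) : Prop :=
  (∀ p ∈ f, 0 < bary t p x) ∧ ∀ p ∈ t, p ∉ f → bary t p x = 0

lemma InFace.mem {t f : Finset (E d)} (ht : IsSimplex t) (hft : f ⊆ t) {x : E d}
    (h : InFace t f x) : x ∈ convexHull ℝ (f : Set (E d)) :=
  (mem_face_iff ht hft).2 ⟨fun p hp => (h.1 p hp).le, h.2⟩

/-- Barycentric coordinates of two elements coincide on their common face. -/
lemma bary_eq_of_mem {s t : Finset (E d)} (hs : s ∈ elements K) (ht : t ∈ elements K) {x : E d}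
    (hxs : x ∈ convexHull ℝ (s : Set (E d))) (hxt : x ∈ convexHull ℝ (t : Set (E d))) (p : E d) :
    bary s p x = bary t p x := by
  have hx : x ∈ convexHull ℝ ((s ∩ t : Finset (E d)) : Set (E d)) := by
    rw [← convexHull_inter hs ht]; exact ⟨hxs, hxt⟩
  have h1 : convexHull ℝ ((s ∩ t : Finset (E d)) : Set (E d)) ⊆
      (bary s p - bary t p : E d →ᵃ[ℝ] ℝ) ⁻¹' {0} := by
    refine convexHull_min ?_ ((convex_singleton 0).affine_preimage _)
    intro q hq
    rw [Finset.mem_coe, Finset.mem_inter] at hq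
    simp only [mem_preimage, mem_singleton_iff, AffineMap.coe_sub, Pi.sub_apply]
    by_cases hpq : p = q
    · subst hpq
      rw [bary_self (isSimplex_of_mem hs) hq.1, bary_self (isSimplex_of_mem ht) hq.2, sub_self]
    · rw [bary_ne (isSimplex_of_mem hs) hq.1 hpq, bary_ne (isSimplex_of_mem ht) hq.2 hpq, sub_self]
  have := h1 hx
  simp only [mem_preimage, mem_singleton_iff, AffineMap.coe_sub, Pi.sub_apply] at this
  linarith

/-- The relative interior of a face lies in the domain if one of its points does. -/
lemma InFace.mem_domain (hΩ : IsLipschitzDomain Ω) (hK : IsMesh Ω κ H K) {t f : Finset (E d)}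
    (ht : t ∈ elements K) (hft : f ⊆ t) {x y : E d} (hx : InFace t f x) (hy : InFace t f y)
    (hyΩ : y ∈ Ω) : x ∈ Ω := by
  have hts := isSimplex_of_mem ht
  have hyt : y ∈ convexHull ℝ (t : Set (E d)) :=
    convexHull_mono (by exact_mod_cast hft) (hy.mem hts hft)
  have hxt : x ∈ convexHull ℝ (f : Set (E d)) := hx.mem hts hft
  -- The coordinates of `y` for the vertices in `f` are positive, and they do not depend on the
  -- element that contains `y`.
  have hfs : ∀ s ∈ elements K, y ∈ convexHull ℝ (s : Set (E d)) → f ⊆ s := by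
    intro s hs hys p hp
    by_contra hps
    have h1 := hy.1 p hp
    rw [bary_eq_of_mem ht hs hyt hys, bary_of_notMem hps] at h1
    simp at h1
  -- The mesh looks alike around `x` and `y`: for small `h` the point `y + h` lies in an element `s`
  -- that contains `f`, and so does `x + h`. Its coordinates for `f` are positive by continuity; the
  -- others vanish at `x` and `y`, hence agree at `x + h` and `y + h`.
  have hev : ∀ᶠ h in nhds (0 : E d), x + h ∈ closure Ω := by
    have e1 : ∀ᶠ h in nhds (0 : E d), y + h ∈ Ω := by
      have : Filter.Tendsto (fun h : E d => y + h) (nhds 0) (nhds (y + 0)) :=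
        Continuous.tendsto (by fun_prop) 0
      rw [add_zero] at this
      exact this (hΩ.isOpen.mem_nhds hyΩ)
    have e2 : ∀ᶠ h in nhds (0 : E d), ∀ s ∈ elements K, y + h ∈ convexHull ℝ (s : Set (E d)) →
        y ∈ convexHull ℝ (s : Set (E d)) := by
      refine (Filter.eventually_all_finite hK.elements_finite).2 fun s _ => ?_
      by_cases hys : y ∈ convexHull ℝ (s : Set (E d))
      · exact Filter.Eventually.of_forall fun _ _ => hys
      · have : Filter.Tendsto (fun h : E d => y + h) (nhds 0) (nhds (y + 0)) :=
          Continuous.tendsto (by fun_prop) 0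
        rw [add_zero] at this
        filter_upwards [this ((isClosed_convexHull s).isOpen_compl.mem_nhds hys)] with h hh hh'
        exact (hh hh').elim
    have e3 : ∀ᶠ h in nhds (0 : E d), ∀ s ∈ elements K, f ⊆ s → ∀ p ∈ (f : Set (E d)),
        0 < bary s p (x + h) := by
      refine (Filter.eventually_all_finite hK.elements_finite).2 fun s hs => ?_
      by_cases hfs : f ⊆ s
      · refine Filter.Eventually.mono ((Filter.eventually_all_finite f.finite_toSet).2
          fun p hp => ?_) fun h hh _ => hh
        have h1 : Filter.Tendsto (fun h : E d => bary s p (x + h)) (nhds 0)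
            (nhds (bary s p (x + 0))) :=
          ((continuous_affine (bary s p)).comp (by fun_prop)).tendsto 0
        have h2 : 0 < bary s p (x + 0) := by
          rw [add_zero, ← bary_eq_of_mem ht hs (convexHull_mono (by exact_mod_cast hft) hxt)
            (convexHull_mono (by exact_mod_cast hfs) hxt)]
          exact hx.1 p hp
        exact h1 (lt_mem_nhds h2)
      · exact Filter.Eventually.of_forall fun _ h => (hfs h).elim
    filter_upwards [e1, e2, e3] with h h1 h2 h3
    obtain ⟨s, hs, hys⟩ := hK.exists_mem_of_mem_closure (subset_closure h1)
    have hys' := h2 s hs hys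
    have hfs' := hfs s hs hys'
    refine hK.convexHull_subset hs ((mem_convexHull_iff (isSimplex_of_mem hs)).2 fun p hp => ?_)
    by_cases hpf : p ∈ f
    · exact (h3 s hs hfs' p hpf).le
    · have g1 : bary s p x = 0 := bary_eq_zero_of_mem_face (isSimplex_of_mem hs) hfs' hxt hpf
      have g2 : bary s p y = 0 :=
        bary_eq_zero_of_mem_face (isSimplex_of_mem hs) hfs' (hy.mem hts hft) hpf
      have g3 : bary s p (x + h) = bary s p (y + h) := by
        have h1 := congrFun (bary s p).decomp x
        have h2 := congrFun (bary s p).decomp y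
        have h3 := congrFun (bary s p).decomp (x + h)
        have h4 := congrFun (bary s p).decomp (y + h)
        simp only [Pi.add_apply, map_add] at h1 h2 h3 h4
        linarith
      rw [g3]
      exact bary_nonneg (isSimplex_of_mem hs) hys p
  rw [← hΩ.interior_closure, mem_interior_iff_mem_nhds]
  have : Filter.Tendsto (fun z : E d => z - x) (nhds x) (nhds (x - x)) :=
    Continuous.tendsto (by fun_prop) x
  rw [sub_self] at this
  filter_upwards [this hev] with z hz
  have hz : x + (z - x) ∈ closure Ω := hz
  rwa [add_sub_cancel] at hz

end Mesh

/-! ### Nodal basis functions -/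

section Mesh

variable {Ω : Set (E d)} {κ H : ℝ} {K : Geometry.SimplicialComplex ℝ (E d)}

lemma SH_eq_sum {f : E d → ℝ} (hf : f ∈ SH Ω K) {t : Finset (E d)}
    (ht : t ∈ elements K) {x : E d} (hx : x ∈ convexHull ℝ (t : Set (E d))) :
    f x = ∑ p ∈ t, bary t p x * f p := by
  obtain ⟨A, hA⟩ := hf.2.2 t ht
  rw [hA x hx, affine_eq_sum (isSimplex_of_mem ht) A]
  exact Finset.sum_congr rfl fun p hp => by rw [hA p (subset_convexHull ℝ _ hp)]

lemma SH_ext (hK : IsMesh Ω κ H K) {f g : E d → ℝ} (hf : f ∈ SH Ω K) (hg : g ∈ SH Ω K)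
    (h : ∀ v ∈ K.vertices, f v = g v) : f = g := by
  ext x
  by_cases hx : x ∈ closure Ω
  · obtain ⟨t, ht, hxt⟩ := hK.exists_mem_of_mem_closure hx
    rw [SH_eq_sum hf ht hxt, SH_eq_sum hg ht hxt]
    exact Finset.sum_congr rfl fun p hp => by rw [h p (vertex_of_mem ht hp)]
  · rw [hf.2.1 x hx, hg.2.1 x hx]

/-- Glue the barycentric coordinates of `v`. Conformity (`bary_eq_of_mem`) makes the choice of the
element immaterial, and a finite closed cover gives continuity. -/
lemma exists_hat (hK : IsMesh Ω κ H K) {v : E d} :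
    ∃ f ∈ SH Ω K, ∀ w ∈ K.vertices, f w = Set.indicator {v} 1 w := by
  classical
  have hex : ∀ x, ∃ t, x ∈ closure Ω → t ∈ elements K ∧ x ∈ convexHull ℝ (t : Set (E d)) := by
    intro x
    by_cases hx : x ∈ closure Ω
    · obtain ⟨t, ht⟩ := hK.exists_mem_of_mem_closure hx
      exact ⟨t, fun _ => ht⟩
    · exact ⟨∅, fun h => (hx h).elim⟩
  choose T hT using hex
  set f : E d → ℝ := (closure Ω).indicator fun x => bary (T x) v x with hf
  have heq : ∀ t ∈ elements K, ∀ x ∈ convexHull ℝ (t : Set (E d)), f x = bary t v x := by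
    intro t ht x hx
    have hxΩ := hK.convexHull_subset ht hx
    rw [hf, indicator_of_mem hxΩ]
    exact bary_eq_of_mem (hT x hxΩ).1 ht (hT x hxΩ).2 hx v
  refine ⟨f, ⟨?_, fun x hx => indicator_of_notMem hx _, fun t ht => ⟨bary t v, heq t ht⟩⟩, ?_⟩
  · have : Finite (elements K) := hK.elements_finite
    have h1 := (locallyFinite_of_finite fun t : elements K =>
      convexHull ℝ ((t : Finset (E d)) : Set (E d))).continuousOn_iUnion (g := f)
      (fun t => isClosed_convexHull _)
      (fun t => (continuous_affine (bary (t : Finset (E d)) v)).continuousOn.congr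
        fun x hx => heq t t.2 x hx)
    refine h1.mono fun x hx => ?_
    obtain ⟨t, ht, hxt⟩ := hK.exists_mem_of_mem_closure hx
    exact mem_iUnion.2 ⟨⟨t, ht⟩, hxt⟩
  · intro w hw
    obtain ⟨t, ht, hwt⟩ := hK.exists_mem_of_vertex hw
    rw [heq t ht w (subset_convexHull ℝ _ hwt)]
    by_cases hvw : v = w
    · subst hvw
      simp [bary_self (isSimplex_of_mem ht) hwt]
    · rw [bary_ne (isSimplex_of_mem ht) hwt hvw, indicator_of_notMem]
      simpa [eq_comm] using hvw

lemma hat_spec (hK : IsMesh Ω κ H K) (v : E d) :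
    hat Ω K v ∈ SH Ω K ∧ ∀ w ∈ K.vertices, hat Ω K v w = Set.indicator {v} 1 w := by
  classical
  have h : ∃ f ∈ SH Ω K, ∀ w ∈ K.vertices, f w = if w = v then 1 else 0 := by
    obtain ⟨f, hf, hfv⟩ := exists_hat hK (v := v)
    refine ⟨f, hf, fun w hw => ?_⟩
    rw [hfv w hw, indicator_apply]
    simp
  rw [hat, dif_pos h]
  refine ⟨h.choose_spec.1, fun w hw => ?_⟩
  have := h.choose_spec.2 w hw
  rw [this, indicator_apply]
  simp

lemma hat_eq_bary (hK : IsMesh Ω κ H K) (v : E d) {t : Finset (E d)} (ht : t ∈ elements K)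
    {x : E d} (hx : x ∈ convexHull ℝ (t : Set (E d))) : hat Ω K v x = bary t v x := by
  obtain ⟨h1, h2⟩ := hat_spec hK v
  rw [SH_eq_sum h1 ht hx, affine_eq_sum (isSimplex_of_mem ht) (bary t v)]
  refine Finset.sum_congr rfl fun p hp => ?_
  rw [h2 p (vertex_of_mem ht hp)]
  by_cases hvp : v = p
  · subst hvp
    simp [bary_self (isSimplex_of_mem ht) hp]
  · rw [bary_ne (isSimplex_of_mem ht) hp hvp, indicator_of_notMem]
    simpa [eq_comm] using hvp

lemma exists_inFace {t : Finset (E d)} (ht : IsSimplex t) {x : E d}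
    (hx : x ∈ convexHull ℝ (t : Set (E d))) : ∃ f ⊆ t, InFace t f x := by
  classical
  refine ⟨t.filter fun p => 0 < bary t p x, Finset.filter_subset _ _,
    fun p hp => (Finset.mem_filter.1 hp).2, fun p hp hpf => ?_⟩
  exact le_antisymm (not_lt.1 fun h => hpf (Finset.mem_filter.2 ⟨hp, h⟩)) (bary_nonneg ht hx p)

/-- If a face meets the domain, then so does its relative interior. -/
lemma InFace.mem_domain_of_mem (hΩ : IsLipschitzDomain Ω) (hK : IsMesh Ω κ H K)
    {t f : Finset (E d)} (ht : t ∈ elements K) (hft : f ⊆ t) {x z : E d} (hx : InFace t f x)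
    (hz : z ∈ convexHull ℝ (f : Set (E d))) (hzΩ : z ∈ Ω) : x ∈ Ω := by
  have hts := isSimplex_of_mem ht
  have hline : ∀ (a : E d) (ε : ℝ), bary t a (AffineMap.lineMap z x ε) =
      (1 - ε) * bary t a z + ε * bary t a x := by
    intro a ε
    rw [AffineMap.apply_lineMap, AffineMap.lineMap_apply]
    simp only [vsub_eq_sub, smul_eq_mul, vadd_eq_add]
    ring
  have hzf : ∀ ε ∈ Ioo (0 : ℝ) 1, InFace t f (AffineMap.lineMap z x ε) := by
    intro ε hε
    obtain ⟨hz1, hz2⟩ := (mem_face_iff hts hft).1 hz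
    constructor
    · intro a ha
      rw [hline]
      have h2 := mul_pos hε.1 (hx.1 a ha)
      have h3 := mul_nonneg (sub_nonneg.2 hε.2.le) (hz1 a ha)
      linarith
    · intro a ha haf
      rw [hline, hx.2 a ha haf, hz2 a ha haf]
      simp
  have ht1 : Filter.Tendsto (fun ε : ℝ => AffineMap.lineMap z x ε) (nhdsWithin 0 (Ioi 0)) (nhds z) := by
    have : Filter.Tendsto (fun ε : ℝ => (AffineMap.lineMap z x ε : E d)) (nhds 0)
        (nhds (AffineMap.lineMap z x (0 : ℝ))) := AffineMap.lineMap_continuous.tendsto 0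
    rw [AffineMap.lineMap_apply_zero] at this
    exact this.mono_left nhdsWithin_le_nhds
  obtain ⟨ε, hεΩ, hε⟩ := ((ht1.eventually (hΩ.isOpen.mem_nhds hzΩ)).and
    (Ioo_mem_nhdsGT (zero_lt_one (α := ℝ)))).exists
  exact InFace.mem_domain hΩ hK ht hft hx (hzf ε hε) hεΩ

/-- Where the function is nonzero, the face with `x` in its relative interior has the vertex `v ∈
Ω`; then `x` itself lies in `Ω`, not on the boundary. -/
lemma hat_mem_VH (hΩ : IsLipschitzDomain Ω) (hK : IsMesh Ω κ H K) {v : E d}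
    (hv : v ∈ Ω) : hat Ω K v ∈ VH Ω K := by
  classical
  refine ⟨(hat_spec hK v).1, fun x hx => ?_⟩
  obtain ⟨t, ht, hxt⟩ := hK.exists_mem_of_mem_closure hx.1
  have hts := isSimplex_of_mem ht
  rw [hat_eq_bary hK v ht hxt]
  by_contra h0
  have hpos : 0 < bary t v x := lt_of_le_of_ne (bary_nonneg hts hxt v) (Ne.symm h0)
  have hvt : v ∈ t := by
    by_contra h
    simp [bary_of_notMem h] at hpos
  obtain ⟨f, hft, hxf⟩ := exists_inFace hts hxt
  have hvf : v ∈ f := by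
    by_contra h
    exact hpos.ne' (hxf.2 v hvt h)
  rw [hΩ.isOpen.frontier_eq] at hx
  exact hx.2 (hxf.mem_domain_of_mem hΩ hK ht hft (subset_convexHull ℝ _ hvf) hv)

/-! ### Connectivity of patches through faces -/

lemma exists_mem_notMem_of_null {U N : Set (E d)} (hU : IsOpen U) (hne : U.Nonempty)
    (hN : volume N = 0) : ∃ x ∈ U, x ∉ N := by
  by_contra! h
  exact (hU.measure_pos volume hne).ne' (measure_mono_null h hN)

lemma IsMesh.exists_radius (hK : IsMesh Ω κ H K) (p : E d) :
    ∃ ρ > 0, ∀ t ∈ elements K, (convexHull ℝ (t : Set (E d)) ∩ ball p ρ).Nonempty →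
      p ∈ convexHull ℝ (t : Set (E d)) := by
  have h : ∀ᶠ y in nhds p, ∀ t ∈ elements K, y ∈ convexHull ℝ (t : Set (E d)) →
      p ∈ convexHull ℝ (t : Set (E d)) := by
    refine (Filter.eventually_all_finite hK.elements_finite).2 fun t _ => ?_
    by_cases hp : p ∈ convexHull ℝ (t : Set (E d))
    · exact Filter.Eventually.of_forall fun _ _ => hp
    · filter_upwards [(isClosed_convexHull t).isOpen_compl.mem_nhds hp] with y hy hy'
      exact (hy hy').elim
  obtain ⟨ρ, hρ, hb⟩ := Metric.eventually_nhds_iff_ball.1 h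
  exact ⟨ρ, hρ, fun t ht ⟨y, hyt, hy⟩ => hb y hy t ht hyt⟩

/-- Locally, the domain contains paths that consist of three segments. -/
lemma IsLipschitzDomain.exists_paths (hΩ : IsLipschitzDomain Ω) {w : E d} (hw : w ∈ closure Ω)
    {ρ : ℝ} (hρ : 0 < ρ) : ∃ δ > 0, ∃ h : E d,
      (∀ x ∈ Ω ∩ ball w δ, segment ℝ x (x + h) ⊆ Ω ∩ ball w ρ) ∧
      ∀ x ∈ Ω ∩ ball w δ, ∀ y ∈ Ω ∩ ball w δ, segment ℝ (x + h) (y + h) ⊆ Ω ∩ ball w ρ := by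
  by_cases hwΩ : w ∈ Ω
  · obtain ⟨δ, hδ, hb⟩ := Metric.isOpen_iff.1 hΩ.isOpen w hwΩ
    refine ⟨min δ ρ, lt_min hδ hρ, 0, fun x hx => ?_, fun x hx y hy => ?_⟩
    · simp only [add_zero, segment_same, singleton_subset_iff]
      exact ⟨hx.1, ball_subset_ball (min_le_right _ _) hx.2⟩
    · rw [add_zero, add_zero]
      have h1 := (convex_ball w (min δ ρ)).segment_subset hx.2 hy.2
      exact fun z hz => ⟨hb (ball_subset_ball (min_le_left _ _) (h1 hz)),
        ball_subset_ball (min_le_right _ _) (h1 hz)⟩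
  · have hwf : w ∈ frontier Ω := by
      rw [hΩ.isOpen.frontier_eq]; exact ⟨hw, hwΩ⟩
    obtain ⟨n, γ, M, r, hn, hr, hγ, hinv, hloc⟩ := hΩ.lipschitz w hwf
    have hwγ : γ w ≤ inner ℝ n w := by
      by_contra! hlt
      have hU : IsOpen ({z | inner ℝ n z < γ z} ∩ ball w r) :=
        (isOpen_lt (by fun_prop) hγ.continuous).inter isOpen_ball
      obtain ⟨z, hzU, hzΩ⟩ := mem_closure_iff.1 hw _ hU ⟨hlt, mem_ball_self hr⟩
      exact lt_asymm ((hloc z hzU.2).1 hzΩ) hzU.1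
    -- A vertical lift by `(M + 2)δ` clears the graph over the whole `δ`-ball: there `γ` exceeds `γ
    -- w` by at most `Mδ`, and the height is less than `δ` below that of `w`. Everything stays
    -- within `(M + 4)δ` of `w`.
    set δ : ℝ := min ρ r / (M + 4) with hδdef
    have hM : (0 : ℝ) ≤ M := M.2
    have hδ : 0 < δ := by
      have := lt_min hρ hr
      positivity
    have hδ4 : (M + 4) * δ = min ρ r := by
      rw [hδdef]; field_simp
    have hmem : ∀ z₀ ∈ ball w δ, ∀ s : ℝ, 0 ≤ s → s ≤ (M + 2) * δ → γ z₀ < inner ℝ n z₀ + s →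
        z₀ + s • n ∈ Ω ∩ ball w ρ := by
      intro z₀ hz₀ s hs0 hs hlt
      have h1 : dist (z₀ + s • n) w < min ρ r := by
        rw [mem_ball] at hz₀
        calc dist (z₀ + s • n) w ≤ dist (z₀ + s • n) z₀ + dist z₀ w := dist_triangle _ _ _
          _ < s + δ := by
            rw [dist_self_add_left, norm_smul, hn, Real.norm_of_nonneg hs0]
            linarith
          _ ≤ min ρ r := by rw [← hδ4]; nlinarith
      refine ⟨(hloc _ (h1.trans_le (min_le_right _ _))).2 ?_, h1.trans_le (min_le_left _ _)⟩
      rw [hinv, inner_add_right, inner_smul_right, real_inner_self_eq_norm_sq, hn]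
      linarith
    refine ⟨δ, hδ, ((M + 2) * δ) • n, fun x hx => ?_, fun x hx y hy => ?_⟩
    · rw [segment_eq_image']
      rintro _ ⟨τ, hτ, rfl⟩
      simp only [add_sub_cancel_left, smul_smul]
      have h0 : 0 ≤ τ * ((M + 2) * δ) := mul_nonneg hτ.1 (by positivity)
      refine hmem x hx.2 _ h0 (mul_le_of_le_one_left (by positivity) hτ.2) ?_
      have hxr : x ∈ ball w r := by
        refine ball_subset_ball ?_ hx.2
        have := min_le_right ρ r
        nlinarith
      linarith [(hloc x hxr).1 hx.1]
    · have htr : segment ℝ (x + ((M + 2) * δ) • n) (y + ((M + 2) * δ) • n) =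
          (fun z => z + ((M + 2) * δ) • n) '' segment ℝ x y := by
        simpa only [add_comm] using (segment_translate_image ℝ (((M + 2) * δ) • n) x y).symm
      rw [htr]
      rintro _ ⟨z, hz, rfl⟩
      have hzw : z ∈ ball w δ := (convex_ball w δ).segment_subset hx.2 hy.2 hz
      refine hmem z hzw _ (by positivity) le_rfl ?_
      have h1 : γ z ≤ γ w + M * dist z w := by
        have := hγ.dist_le_mul z w
        rw [Real.dist_eq] at this
        linarith [le_abs_self (γ z - γ w)]
      have h2 : inner ℝ n w - inner ℝ n z ≤ dist z w := by
        rw [← inner_sub_right]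
        calc inner ℝ n (w - z) ≤ ‖n‖ * ‖w - z‖ := real_inner_le_norm _ _
          _ = dist z w := by rw [hn, one_mul, dist_comm, dist_eq_norm]
      rw [mem_ball] at hzw
      nlinarith [mul_le_mul_of_nonneg_left hzw.le hM]

lemma volume_biUnion_affineSpan {F : Set (Finset (E d))} (hF : F.Finite)
    (h : ∀ S ∈ F, S.card ≤ d) :
    volume (⋃ S ∈ F, (affineSpan ℝ (S : Set (E d)) : Set (E d))) = 0 :=
  (measure_biUnion_null_iff hF.countable).2 fun S hS => volume_affineSpan_eq_zero (h S hS)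

open Classical in
/-- The star of a node is connected through faces. -/
lemma star_connected (hΩ : IsLipschitzDomain Ω) (hK : IsMesh Ω κ H K) {w : E d}
    (hw : w ∈ K.vertices) {C : Set (Finset (E d))}
    (hC : ∀ s ∈ elements K, ∀ t ∈ elements K, w ∈ s → w ∈ t → (s ∩ t).card = d → s ∈ C → t ∈ C)
    {T T' : Finset (E d)} (hT : T ∈ elements K) (hT' : T' ∈ elements K) (hwT : w ∈ T)
    (hwT' : w ∈ T') (hTC : T ∈ C) : T' ∈ C := by
  by_contra hT'C
  obtain ⟨ρ, hρ, hρK⟩ := hK.exists_radius w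
  obtain ⟨δ, hδ, h, hp1, hp2⟩ := hΩ.exists_paths (hK.vertex_mem_closure hw) hρ
  -- The faces at `w` of codimension at least two in which two elements meet. Together with one more
  -- point each still spans a null set, to be avoided by the endpoints of the path.
  set Bad : Set (Finset (E d)) :=
    {S | S ∈ image2 (fun s t => s ∩ t) (elements K) (elements K) ∧ w ∈ S ∧ S.card < d} with hBad
  have hBadfin : Bad.Finite := (hK.elements_finite.image2 _ hK.elements_finite).subset
    fun S hS => hS.1
  have hcard : ∀ S ∈ Bad, ∀ z : E d, (insert z S).card ≤ d := fun S hS z =>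
    (Finset.card_insert_le _ _).trans hS.2.2
  have hnull : ∀ z : E d, volume (⋃ S ∈ Bad,
      (affineSpan ℝ ((insert z S : Finset (E d)) : Set (E d)) : Set (E d))) = 0 := by
    intro z
    have := volume_biUnion_affineSpan (hBadfin.image (insert z))
      (by rintro _ ⟨S, hS, rfl⟩; exact hcard S hS z)
    rwa [biUnion_image] at this
  have hopen : ∀ s ∈ elements K, w ∈ s → IsOpen (interior (convexHull ℝ (s : Set (E d))) ∩ ball w δ) ∧
      (interior (convexHull ℝ (s : Set (E d))) ∩ ball w δ).Nonempty := by
    intro s hs hws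
    refine ⟨isOpen_interior.inter isOpen_ball, ?_⟩
    have : w ∈ closure (interior (convexHull ℝ (s : Set (E d)))) := by
      rw [closure_interior_convexHull (isSimplex_of_mem hs)]
      exact subset_convexHull ℝ _ hws
    rw [inter_comm]
    exact mem_closure_iff.1 this _ isOpen_ball (mem_ball_self hδ)
  -- The vertical segments are avoided by keeping `x` and `y` off the spans with `w + h`, the
  -- horizontal one by keeping `y + h` off the spans with `x + h`.
  obtain ⟨x, hxU, hxN⟩ := exists_mem_notMem_of_null (hopen T hT hwT).1 (hopen T hT hwT).2 (hnull (w + h))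
  obtain ⟨y, hyU, hyN⟩ := exists_mem_notMem_of_null (hopen T' hT' hwT').1 (hopen T' hT' hwT').2
    (measure_union_null (hnull (w + h)) (by
      have := hnull (x + h)
      rwa [← measure_preimage_add_right volume h] at this))
  rw [mem_union, not_or] at hyN
  obtain ⟨hyN, hyN'⟩ := hyN
  have hxΩ : x ∈ Ω ∩ ball w δ := ⟨hK.interior_subset_domain hΩ hT hxU.1, hxU.2⟩
  have hyΩ : y ∈ Ω ∩ ball w δ := ⟨hK.interior_subset_domain hΩ hT' hyU.1, hyU.2⟩
  set Γ := (segment ℝ x (x + h) ∪ segment ℝ (x + h) (y + h)) ∪ segment ℝ y (y + h) with hΓ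
  have hΓc : IsPreconnected Γ := by
    refine IsPreconnected.union (y + h) (Or.inr (right_mem_segment _ _ _)) (right_mem_segment _ _ _)
      (IsPreconnected.union (x + h) (right_mem_segment _ _ _) (left_mem_segment _ _ _) ?_ ?_) ?_
    all_goals exact (convex_segment _ _).isPreconnected
  have hΓΩ : Γ ⊆ Ω ∩ ball w ρ := union_subset (union_subset (hp1 x hxΩ) (hp2 x hxΩ y hyΩ)) (hp1 y hyΩ)
  set X := ⋃ s ∈ {s | s ∈ elements K ∧ w ∈ s ∧ s ∈ C}, convexHull ℝ (s : Set (E d)) with hX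
  set Y := ⋃ s ∈ {s | s ∈ elements K ∧ w ∈ s ∧ s ∉ C}, convexHull ℝ (s : Set (E d)) with hY
  have hXc : IsClosed X := (hK.elements_finite.subset fun s hs => hs.1).isClosed_biUnion
    fun s _ => isClosed_convexHull s
  have hYc : IsClosed Y := (hK.elements_finite.subset fun s hs => hs.1).isClosed_biUnion
    fun s _ => isClosed_convexHull s
  have hcov : Γ ⊆ X ∪ Y := by
    intro z hz
    obtain ⟨hzΩ, hzρ⟩ := hΓΩ hz
    obtain ⟨s, hs, hzs⟩ := hK.exists_mem_of_mem_closure (subset_closure hzΩ)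
    have hws := mem_of_vertex_mem hs hw (hρK s hs ⟨z, hzs, hzρ⟩)
    by_cases hsC : s ∈ C
    · exact Or.inl (mem_biUnion (show s ∈ {s | s ∈ elements K ∧ w ∈ s ∧ s ∈ C} from
        ⟨hs, hws, hsC⟩) hzs)
    · exact Or.inr (mem_biUnion (show s ∈ {s | s ∈ elements K ∧ w ∈ s ∧ s ∉ C} from
        ⟨hs, hws, hsC⟩) hzs)
  -- The connected path must meet an element in `C` and one outside `C` at a common point `p`. These
  -- two share fewer than `d` vertices, so `p` lies on a bad face.
  obtain ⟨p, hpΓ, hpX, hpY⟩ := isPreconnected_closed_iff.1 hΓc X Y hXc hYc hcov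
    ⟨x, Or.inl (Or.inl (left_mem_segment _ _ _)),
      mem_biUnion (show T ∈ {s | s ∈ elements K ∧ w ∈ s ∧ s ∈ C} from ⟨hT, hwT, hTC⟩)
        (interior_subset hxU.1)⟩
    ⟨y, Or.inr (left_mem_segment _ _ _),
      mem_biUnion (show T' ∈ {s | s ∈ elements K ∧ w ∈ s ∧ s ∉ C} from ⟨hT', hwT', hT'C⟩)
        (interior_subset hyU.1)⟩
  obtain ⟨s, ⟨hs, hws, hsC⟩, hps⟩ := mem_iUnion₂.1 hpX
  obtain ⟨t, ⟨ht, hwt, htC⟩, hpt⟩ := mem_iUnion₂.1 hpY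
  have hst : s ∩ t ∈ Bad := by
    refine ⟨mem_image2_of_mem hs ht, Finset.mem_inter.2 ⟨hws, hwt⟩, ?_⟩
    have h1 : (s ∩ t).card ≠ d := fun hc => htC (hC s hs t ht hws hwt hc hsC)
    have h2 : (s ∩ t).card < d + 1 := by
      rw [← hs.2]
      refine Finset.card_lt_card ⟨Finset.inter_subset_left, fun hss => ?_⟩
      have : s = t := Finset.eq_of_subset_of_card_le
        (fun a ha => (Finset.mem_inter.1 (hss ha)).2) (by rw [hs.2, ht.2])
      exact htC (this ▸ hsC)
    omega
  have hpS : p ∈ affineSpan ℝ ((s ∩ t : Finset (E d)) : Set (E d)) := by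
    apply convexHull_subset_affineSpan
    rw [← convexHull_inter hs ht]
    exact ⟨hps, hpt⟩
  have hins : ∀ z : E d, p ∈ affineSpan ℝ ((insert z (s ∩ t) : Finset (E d)) : Set (E d)) ∧
      z ∈ affineSpan ℝ ((insert z (s ∩ t) : Finset (E d)) : Set (E d)) ∧
      w ∈ affineSpan ℝ ((insert z (s ∩ t) : Finset (E d)) : Set (E d)) := by
    intro z
    refine ⟨affineSpan_mono ℝ (by simp) hpS, subset_affineSpan ℝ _ (by simp),
      subset_affineSpan ℝ _ ?_⟩
    simp [hws, hwt]
  -- The direction `h` joins `w` to `w + h`, both in the span, so `z = p - τh` lies in the span as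
  -- well.
  have hvert : ∀ z, p ∈ segment ℝ z (z + h) → z ∈ ⋃ S ∈ Bad,
      (affineSpan ℝ ((insert (w + h) S : Finset (E d)) : Set (E d)) : Set (E d)) := by
    intro z hz
    rw [segment_eq_image'] at hz
    obtain ⟨τ, -, hτ⟩ := hz
    refine mem_biUnion hst ?_
    have := AffineSubspace.smul_vsub_vadd_mem _ (-τ) (hins (w + h)).2.1 (hins (w + h)).2.2
      (hins (w + h)).1
    have e : -τ • (w + h -ᵥ w) +ᵥ p = z := by
      simp only [← hτ, vsub_eq_sub, vadd_eq_add, add_sub_cancel_left, neg_smul]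
      abel
    rw [e] at this
    exact this
  rcases hpΓ with (hp | hp) | hp
  · exact hxN (hvert x hp)
  · rw [segment_eq_image'] at hp
    obtain ⟨τ, -, hτ⟩ := hp
    rcases eq_or_ne τ 0 with rfl | hτ0
    · refine hxN (hvert x ?_)
      rw [← hτ]
      simpa using right_mem_segment ℝ x (x + h)
    -- For `τ ≠ 0` the point `y + h` is on the line through `x + h` and `p`. The case `τ = 0` is `p
    -- = x + h`, an end of the first segment.
    · refine hyN' (mem_biUnion hst ?_)
      have := AffineSubspace.smul_vsub_vadd_mem _ (τ⁻¹) (hins (x + h)).1 (hins (x + h)).2.1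
        (hins (x + h)).2.1
      have e : τ⁻¹ • (p -ᵥ (x + h)) +ᵥ (x + h) = y + h := by
        simp only [← hτ, vsub_eq_sub, vadd_eq_add, add_sub_cancel_left, smul_smul,
          inv_mul_cancel₀ hτ0, one_smul]
        abel
      rw [e] at this
      exact this
  · exact hyN (hvert y hp)

open Classical in
/-- Each point of the boundary lies in an element with a face on the boundary. -/
lemma exists_boundary_face (hΩ : IsLipschitzDomain Ω) (hK : IsMesh Ω κ H K) {p : E d}
    (hp : p ∈ frontier Ω) : ∃ t ∈ elements K, p ∈ convexHull ℝ (t : Set (E d)) ∧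
      ∃ f ⊆ t, f.card = d ∧ convexHull ℝ (f : Set (E d)) ⊆ frontier Ω := by
  obtain ⟨ρ, hρ, hρK⟩ := hK.exists_radius p
  set Bad : Set (Finset (E d)) := {S | (∃ t ∈ elements K, S ⊆ t) ∧ S.card < d} with hBad
  have hBadfin : Bad.Finite := by
    refine (hK.elements_finite.biUnion fun t _ => t.powerset.finite_toSet).subset ?_
    rintro S ⟨⟨t, ht, hSt⟩, -⟩
    exact mem_biUnion ht (by simpa using hSt)
  obtain ⟨x, ⟨hxΩ, hxρ⟩, hxN⟩ := exists_mem_notMem_of_null (hΩ.isOpen.inter isOpen_ball)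
    (by
      rw [inter_comm]
      exact mem_closure_iff.1 hp.1 _ isOpen_ball (mem_ball_self hρ) : (Ω ∩ ball p ρ).Nonempty)
    (volume_biUnion_affineSpan hBadfin fun S hS => hS.2.le)
  have hout : ((closure Ω)ᶜ ∩ ball p ρ).Nonempty := by
    by_contra hemp
    rw [not_nonempty_iff_eq_empty] at hemp
    have h1 : ball p ρ ⊆ closure Ω := by
      intro z hz
      by_contra hzc
      exact (eq_empty_iff_forall_notMem.1 hemp) z ⟨hzc, hz⟩
    have h2 : p ∈ Ω := by
      rw [← hΩ.interior_closure]
      exact interior_mono h1 (by rw [isOpen_ball.interior_eq]; exact mem_ball_self hρ)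
    rw [hΩ.isOpen.frontier_eq] at hp
    exact hp.2 h2
  obtain ⟨y, ⟨hyΩ, hyρ⟩, hyN⟩ := exists_mem_notMem_of_null
    (isClosed_closure.isOpen_compl.inter isOpen_ball) hout
    (by
      have := volume_biUnion_affineSpan (hBadfin.image (insert x))
        (by rintro _ ⟨S, hS, rfl⟩; exact (Finset.card_insert_le _ _).trans hS.2)
      rwa [biUnion_image] at this)
  -- The segment runs from inside `Ω` to outside its closure. By the choice of `x` and `y` it misses
  -- every face with fewer than `d` vertices.
  obtain ⟨q, hq, hqf⟩ : (segment ℝ x y ∩ frontier Ω).Nonempty := by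
    by_contra hemp
    rw [not_nonempty_iff_eq_empty] at hemp
    have hpre := (convex_segment x y).isPreconnected
    obtain ⟨z, -, hz1, hz2⟩ := hpre Ω (closure Ω)ᶜ hΩ.isOpen isClosed_closure.isOpen_compl
      (fun z hz => by
        by_contra hzc
        simp only [mem_union, mem_compl_iff, not_or, not_not] at hzc
        refine (eq_empty_iff_forall_notMem.1 hemp) z ⟨hz, ?_⟩
        rw [hΩ.isOpen.frontier_eq]
        exact ⟨hzc.2, hzc.1⟩)
      ⟨x, left_mem_segment _ _ _, hxΩ⟩ ⟨y, right_mem_segment _ _ _, hyΩ⟩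
    exact hz2 (subset_closure hz1)
  have hqρ : q ∈ ball p ρ := (convex_ball p ρ).segment_subset hxρ hyρ hq
  obtain ⟨t, ht, hqt⟩ := hK.exists_mem_of_mem_closure hqf.1
  have hts := isSimplex_of_mem ht
  refine ⟨t, ht, hρK t ht ⟨q, hqt, hqρ⟩, ?_⟩
  obtain ⟨f, hft, hqin⟩ := exists_inFace hts hqt
  have hqΩ : q ∉ Ω := by
    rw [hΩ.isOpen.frontier_eq] at hqf
    exact hqf.2
  have hcard1 : f.card ≤ d := by
    by_contra! hlt
    have hft' : f = t := Finset.eq_of_subset_of_card_le hft (by rw [ht.2]; omega)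
    refine hqΩ (hK.interior_subset_domain hΩ ht ((mem_interior_iff hts).2 fun a ha => ?_))
    exact hqin.1 a (hft' ▸ ha)
  have hcard2 : d ≤ f.card := by
    by_contra! hlt
    have hfBad : f ∈ Bad := ⟨⟨t, ht, hft⟩, hlt⟩
    have hqf' : q ∈ affineSpan ℝ (f : Set (E d)) :=
      convexHull_subset_affineSpan _ (hqin.mem hts hft)
    rw [segment_eq_image'] at hq
    obtain ⟨τ, -, hτ⟩ := hq
    rcases eq_or_ne τ 0 with rfl | hτ0
    · simp only [zero_smul, add_zero] at hτ
      rw [← hτ] at hqf'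
      exact hxN (mem_biUnion hfBad hqf')
    · refine hyN (mem_biUnion hfBad ?_)
      have h1 : q ∈ affineSpan ℝ ((insert x f : Finset (E d)) : Set (E d)) :=
        affineSpan_mono ℝ (by simp) hqf'
      have h2 : x ∈ affineSpan ℝ ((insert x f : Finset (E d)) : Set (E d)) :=
        subset_affineSpan ℝ _ (by simp)
      have := AffineSubspace.smul_vsub_vadd_mem _ (τ⁻¹) h1 h2 h2
      have e : τ⁻¹ • (q -ᵥ x) +ᵥ x = y := by
        simp only [← hτ, vsub_eq_sub, vadd_eq_add, add_sub_cancel_left, smul_smul,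
          inv_mul_cancel₀ hτ0, one_smul]
        abel
      rw [e] at this
      exact this
  -- If the face met `Ω`, its relative interior, and with it `q`, would lie in `Ω`.
  refine ⟨f, hft, le_antisymm hcard1 hcard2, fun z hz => ?_⟩
  have hzcl : z ∈ closure Ω :=
    hK.convexHull_subset ht (convexHull_mono (by exact_mod_cast hft) hz)
  rw [hΩ.isOpen.frontier_eq]
  exact ⟨hzcl, fun hzΩ => hqΩ (hqin.mem_domain_of_mem hΩ hK ht hft hz hzΩ)⟩

end Mesh

/-! ### Weighted Poincaré inequalities on pairs of sets -/

lemma enorm_gradient (φ : E d → ℝ) (x : E d) : ‖gradient φ x‖ₑ = ‖fderiv ℝ φ x‖ₑ := by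
  rw [gradient, LinearIsometryEquiv.enorm_map]

lemma continuous_gradient {φ : E d → ℝ} (hφ : ContDiff ℝ 1 φ) : Continuous (gradient φ) :=
  (InnerProductSpace.toDual ℝ (E d)).symm.continuous.comp (hφ.continuous_fderiv one_ne_zero)

lemma measurable_enorm_gradient {φ : E d → ℝ} (hφ : ContDiff ℝ 1 φ) :
    Measurable fun x => ‖gradient φ x‖ₑ := (continuous_gradient hφ).enorm.measurable

/-- The fundamental theorem of calculus along the segment. Stopping at `τ` serves the Friedrichs
inequality, where the segment leaves the element after the zero of `φ`; the indicator of `Z` makes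
the integral over all of `(0,1]` harmless. -/
lemma enorm_sub_le_segment {φ : E d → ℝ} (hφ : ContDiff ℝ 1 φ) {x y : E d} {R τ : ℝ}
    {Z : Set (E d)} (hR : dist x y ≤ R) (hτ : τ ∈ Icc (0 : ℝ) 1)
    (hZ : ∀ t ∈ Ioc 0 τ, x + t • (y - x) ∈ Z) :
    ‖φ (x + τ • (y - x)) - φ x‖ₑ ≤ ENNReal.ofReal R *
      ∫⁻ t in Ioc (0 : ℝ) 1, Z.indicator (fun z => ‖gradient φ z‖ₑ) (x + t • (y - x)) := by
  have hdiff : ∀ t : ℝ, HasDerivAt (fun t : ℝ => φ (x + t • (y - x)))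
      (fderiv ℝ φ (x + t • (y - x)) (y - x)) t := by
    intro t
    have h1 : HasDerivAt (fun t : ℝ => x + t • (y - x)) (y - x) t := by
      simpa using ((hasDerivAt_id t).smul_const (y - x)).const_add x
    exact ((hφ.differentiable one_ne_zero _).hasFDerivAt).comp_hasDerivAt t h1
  have hcont : Continuous fun t : ℝ => fderiv ℝ φ (x + t • (y - x)) (y - x) :=
    ((hφ.continuous_fderiv one_ne_zero).comp (by fun_prop)).clm_apply continuous_const
  have hint := intervalIntegral.integral_eq_sub_of_hasDerivAt (a := 0) (b := τ)
    (fun t _ => hdiff t) (hcont.intervalIntegrable _ _)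
  simp only [zero_smul, add_zero] at hint
  rw [← hint, intervalIntegral.integral_of_le hτ.1]
  calc _ ≤ ∫⁻ t in Ioc 0 τ, ‖fderiv ℝ φ (x + t • (y - x)) (y - x)‖ₑ :=
        enorm_integral_le_lintegral_enorm _
    _ ≤ ∫⁻ t in Ioc 0 τ, ENNReal.ofReal R *
          Z.indicator (fun z => ‖gradient φ z‖ₑ) (x + t • (y - x)) := by
        refine setLIntegral_mono' measurableSet_Ioc fun t ht => ?_
        rw [indicator_of_mem (hZ t ht), enorm_gradient, mul_comm]
        refine (ContinuousLinearMap.le_opENorm _ _).trans ?_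
        gcongr
        rw [← ofReal_norm, ← dist_eq_norm, dist_comm]
        exact ENNReal.ofReal_le_ofReal hR
    _ ≤ ∫⁻ t in Ioc (0 : ℝ) 1, ENNReal.ofReal R *
          Z.indicator (fun z => ‖gradient φ z‖ₑ) (x + t • (y - x)) :=
        lintegral_mono_set (Ioc_subset_Ioc_right hτ.2)
    _ = _ := lintegral_const_mul' _ _ ENNReal.ofReal_ne_top

lemma lintegral_indicator_sq {μ : Measure (E d)} {Z : Set (E d)} (hZ : MeasurableSet Z)
    (g : E d → ℝ≥0∞) :
    ∫⁻ x, Z.indicator g x ^ 2 ∂μ = ∫⁻ x in Z, g x ^ 2 ∂μ := by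
  rw [← lintegral_indicator hZ]
  congr 1 with x
  by_cases hx : x ∈ Z <;> simp [hx]

section Pairs

variable {A : ℝ≥0} {μ : Measure (E d)} [SFinite μ] {φ : E d → ℝ} {X Y Z : Set (E d)} {R : ℝ}

/-- Transfer of `L²` bounds from `Y` to `X`, if the segments between them lie in `Z`. -/
lemma AvgBounded.transfer (hμ : AvgBounded A μ) (hφ : ContDiff ℝ 1 φ) (hR : 0 < R)
    (hX : MeasurableSet X) (hY : MeasurableSet Y) (hZ : MeasurableSet Z)
    (hXY : ∀ x ∈ X, ∀ y ∈ Y, dist x y ≤ R ∧ ∀ t ∈ Ioc (0 : ℝ) 1, x + t • (y - x) ∈ Z) (c : ℝ) :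
    volume Y ^ 2 * ∫⁻ x in X, ‖φ x - c‖ₑ ^ 2 ∂μ ≤ 2 * (A * ENNReal.ofReal R ^ (2 * d)) *
      (∫⁻ x in Y, ‖φ x - c‖ₑ ^ 2 ∂μ + ENNReal.ofReal R ^ 2 *
        ∫⁻ x in Z, ‖gradient φ x‖ₑ ^ 2 ∂μ) := by
  have hm : Measurable fun x => ‖φ x - c‖ₑ := (hφ.continuous.sub continuous_const).enorm.measurable
  have h := hμ.lintegral_sq_le hR hX hY
    (fun x hx y hy => by rw [mem_closedBall, dist_comm]; exact (hXY x hx y hy).1)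
    ((measurable_enorm_gradient hφ).indicator hZ) hm hm fun x hx => by
      calc volume Y * ‖φ x - c‖ₑ = ∫⁻ _y in Y, ‖φ x - c‖ₑ := by
            rw [setLIntegral_const, mul_comm]
        _ ≤ _ := by
            refine setLIntegral_mono' hY fun y hy => ?_
            obtain ⟨h1, h2⟩ := hXY x hx y hy
            have h3 := enorm_sub_le_segment hφ h1 (right_mem_Icc.2 zero_le_one) h2
            rw [one_smul, add_sub_cancel] at h3
            calc ‖φ x - c‖ₑ = ‖(φ y - c) - (φ y - φ x)‖ₑ := by congr 1; ring
              _ ≤ ‖φ y - c‖ₑ + ‖φ y - φ x‖ₑ := enorm_sub_le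
              _ ≤ _ := by gcongr
  rwa [lintegral_indicator_sq hZ] at h

/-- The constant is the unweighted mean over `Y`, so that `φ x - c` is the Lebesgue average of `φ x
- φ y` and no term on `Y` remains. -/
lemma AvgBounded.average (hμ : AvgBounded A μ) (hφ : ContDiff ℝ 1 φ) (hR : 0 < R)
    (hX : MeasurableSet X) (hY : MeasurableSet Y) (hZ : MeasurableSet Z)
    (hXY : ∀ x ∈ X, ∀ y ∈ Y, dist x y ≤ R ∧ ∀ t ∈ Ioc (0 : ℝ) 1, x + t • (y - x) ∈ Z)
    (hYc : IsCompact Y) (hY0 : volume Y ≠ 0) :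
    ∃ c : ℝ, volume Y ^ 2 * ∫⁻ x in X, ‖φ x - c‖ₑ ^ 2 ∂μ ≤ 2 * (A * ENNReal.ofReal R ^ (2 * d)) *
      (ENNReal.ofReal R ^ 2 * ∫⁻ x in Z, ‖gradient φ x‖ₑ ^ 2 ∂μ) := by
  refine ⟨⨍ y in Y, φ y, ?_⟩
  have hint : IntegrableOn φ Y volume := hφ.continuous.continuousOn.integrableOn_compact hYc
  have hYt : volume Y ≠ ⊤ := hYc.measure_lt_top.ne
  have hm : Measurable fun x => ‖φ x - ⨍ y in Y, φ y‖ₑ :=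
    (hφ.continuous.sub continuous_const).enorm.measurable
  have h := hμ.lintegral_sq_le (k := 0) hR hX hY
    (fun x hx y hy => by rw [mem_closedBall, dist_comm]; exact (hXY x hx y hy).1)
    ((measurable_enorm_gradient hφ).indicator hZ) measurable_const hm fun x hx => by
      have hv : volume Y = ‖(volume.real Y : ℝ)‖ₑ := by
        rw [Real.enorm_eq_ofReal measureReal_nonneg, ofReal_measureReal hYt]
      have h1 : (volume.real Y) * (φ x - ⨍ y in Y, φ y) = ∫ y in Y, (φ x - φ y) := by
        have hne : volume.real Y ≠ 0 := (measureReal_ne_zero_iff hYt).2 hY0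
        rw [setAverage_eq, integral_sub (f := fun _ => φ x) (integrableOn_const hYt) hint, setIntegral_const,
          smul_eq_mul, smul_eq_mul, mul_sub, mul_inv_cancel_left₀ hne]
      calc volume Y * ‖φ x - ⨍ y in Y, φ y‖ₑ = ‖∫ y in Y, (φ x - φ y)‖ₑ := by
            rw [← h1, enorm_mul, ← hv]
        _ ≤ ∫⁻ y in Y, ‖φ x - φ y‖ₑ := enorm_integral_le_lintegral_enorm _
        _ ≤ _ := by
            refine setLIntegral_mono' hY fun y hy => ?_
            obtain ⟨h1, h2⟩ := hXY x hx y hy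
            have h3 := enorm_sub_le_segment hφ h1 (right_mem_Icc.2 zero_le_one) h2
            rw [one_smul, add_sub_cancel] at h3
            rw [Pi.zero_apply, zero_add, enorm_sub_rev]
            exact h3
  simpa [lintegral_indicator_sq hZ] using h

/-- Only directions are taken from `Y`: each segment meets a zero of `φ` on its way, and the
gradient matters only before it. Thus `Y` may lie beyond the zero set, outside `Z`. -/
lemma AvgBounded.boundary (hμ : AvgBounded A μ) (hφ : ContDiff ℝ 1 φ) (hR : 0 < R)
    (hX : MeasurableSet X) (hY : MeasurableSet Y) (hZ : MeasurableSet Z)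
    (hXY : ∀ x ∈ X, ∀ y ∈ Y, dist x y ≤ R ∧ ∃ τ ∈ Icc (0 : ℝ) 1, φ (x + τ • (y - x)) = 0 ∧
      ∀ t ∈ Ioc (0 : ℝ) τ, x + t • (y - x) ∈ Z) :
    volume Y ^ 2 * ∫⁻ x in X, ‖φ x‖ₑ ^ 2 ∂μ ≤ 2 * (A * ENNReal.ofReal R ^ (2 * d)) *
      (ENNReal.ofReal R ^ 2 * ∫⁻ x in Z, ‖gradient φ x‖ₑ ^ 2 ∂μ) := by
  have h := hμ.lintegral_sq_le (k := 0) hR hX hY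
    (fun x hx y hy => by rw [mem_closedBall, dist_comm]; exact (hXY x hx y hy).1)
    ((measurable_enorm_gradient hφ).indicator hZ) measurable_const hφ.continuous.enorm.measurable
    fun x hx => by
      calc volume Y * ‖φ x‖ₑ = ∫⁻ _y in Y, ‖φ x‖ₑ := by
            rw [setLIntegral_const, mul_comm]
        _ ≤ _ := by
            refine setLIntegral_mono' hY fun y hy => ?_
            obtain ⟨h1, τ, hτ, h0, h2⟩ := hXY x hx y hy
            have h3 := enorm_sub_le_segment hφ h1 hτ h2
            rw [h0, zero_sub, enorm_neg] at h3
            rw [Pi.zero_apply, zero_add]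
            exact h3
  simpa [lintegral_indicator_sq hZ] using h

end Pairs

/-! ### Balls around the barycenter of a face -/

section Mesh

variable {Ω : Set (E d)} {κ H : ℝ} {K : Geometry.SimplicialComplex ℝ (E d)}

/-- The barycenter of a face. -/
def faceCenter (f : Finset (E d)) : E d := ∑ p ∈ f, (f.card : ℝ)⁻¹ • p

lemma affine_faceCenter {f : Finset (E d)} (hf : 0 < f.card) (g : E d →ᵃ[ℝ] ℝ) :
    g (faceCenter f) = (f.card : ℝ)⁻¹ * ∑ p ∈ f, g p := by
  have h1 : ∀ y, g y = g.linear y + g 0 := fun y => by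
    have := congrFun g.decomp y
    simpa using this
  have h2 : ∑ p ∈ f, g p = ∑ p ∈ f, g.linear p + f.card * g 0 := by
    rw [Finset.sum_congr rfl fun p _ => h1 p, Finset.sum_add_distrib]
    simp
  have h3 : (f.card : ℝ) ≠ 0 := Nat.cast_ne_zero.2 hf.ne'
  rw [h1, faceCenter, map_sum, h2, mul_add, inv_mul_cancel_left₀ h3, Finset.mul_sum]
  simp

/-- The radius of the balls around the barycenters of the faces. -/
def faceRadius (d : ℕ) (κ H : ℝ) : ℝ := H / κ ^ 2 / d

/-- The coordinate is `1/d` at the barycenter and, by its slope bound, changes by at most `1/(2d)`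
within `faceRadius`. -/
lemma bary_faceCenter_pos (hK : IsMesh Ω κ H K) (hd : 0 < d) {t f : Finset (E d)}
    (ht : t ∈ elements K) (hft : f ⊆ t) (hf : f.card = d) {z : E d}
    (hz : z ∈ closedBall (faceCenter f) (faceRadius d κ H)) {p : E d} (hp : p ∈ f) :
    0 < bary t p z := by
  classical
  obtain ⟨hH, hκ, c, hc⟩ := hK.exists_ball hd ht
  have hts := isSimplex_of_mem ht
  have h1 : bary t p (faceCenter f) = (d : ℝ)⁻¹ := by
    rw [affine_faceCenter (by omega), hf, Finset.sum_eq_single_of_mem p hp fun q hq hqp =>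
      bary_ne hts (hft hq) hqp.symm, bary_self hts (hft hp), mul_one]
  have hr : 0 < H / κ ^ 2 := by positivity
  have h2 := abs_bary_sub_le hts hr hc p (faceCenter f) z
  rw [mem_closedBall, dist_comm, faceRadius] at hz
  have hd' : (0 : ℝ) < d := by exact_mod_cast hd
  have h3 : dist (faceCenter f) z / (2 * (H / κ ^ 2)) ≤ (d : ℝ)⁻¹ / 2 := by
    rw [div_le_iff₀ (by positivity)]
    refine hz.trans (le_of_eq ?_)
    field_simp
  have h4 := (abs_le.1 (h2.trans h3)).2
  rw [h1] at h4
  have : 0 < (d : ℝ)⁻¹ := by positivity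
  linarith

lemma exists_opposite {t f : Finset (E d)} (ht : t ∈ elements K) (hft : f ⊆ t)
    (hf : f.card = d) : ∃ o, o ∈ t ∧ o ∉ f ∧ ∀ p ∈ t, p ∉ f → p = o := by
  classical
  have h : (t \ f).card = 1 := by
    rw [Finset.card_sdiff_of_subset hft, ht.2, hf]; omega
  obtain ⟨o, ho⟩ := Finset.card_eq_one.1 h
  have h1 : ∀ p, p ∈ t \ f ↔ p = o := fun p => by rw [ho, Finset.mem_singleton]
  simp only [Finset.mem_sdiff] at h1
  exact ⟨o, ((h1 o).2 rfl).1, ((h1 o).2 rfl).2, fun p hp hpf => (h1 p).1 ⟨hp, hpf⟩⟩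

/-- Near the barycenter of a face the simplex is a half-space, since the coordinates of the face are
positive there. -/
lemma mem_convexHull_iff_opposite (hK : IsMesh Ω κ H K) (hd : 0 < d) {t f : Finset (E d)}
    (ht : t ∈ elements K) (hft : f ⊆ t) (hf : f.card = d) {o : E d} (hot : o ∈ t)
    (ho : ∀ p ∈ t, p ∉ f → p = o) {z : E d}
    (hz : z ∈ closedBall (faceCenter f) (faceRadius d κ H)) :
    z ∈ convexHull ℝ (t : Set (E d)) ↔ 0 ≤ bary t o z := by
  rw [mem_convexHull_iff (isSimplex_of_mem ht)]
  refine ⟨fun h => h o hot, fun h p hp => ?_⟩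
  by_cases hpf : p ∈ f
  · exact (bary_faceCenter_pos hK hd ht hft hf hz hpf).le
  · rwa [ho p hp hpf]

lemma bary_opposite_faceCenter {t f : Finset (E d)} (ht : t ∈ elements K) (hft : f ⊆ t)
    (hf : 0 < f.card) {o : E d} (hof : o ∉ f) : bary t o (faceCenter f) = 0 := by
  rw [affine_faceCenter hf, Finset.sum_eq_zero, mul_zero]
  intro q hq
  exact bary_ne (isSimplex_of_mem ht) (hft hq) fun h => hof (h ▸ hq)

lemma affine_reflect (g : E d →ᵃ[ℝ] ℝ) (b z : E d) : g (b + b - z) = 2 * g b - g z := by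
  have h1 : ∀ y, g y = g.linear y + g 0 := fun y => by
    have := congrFun g.decomp y
    simpa using this
  rw [h1 (b + b - z), h1 b, h1 z, map_sub, map_add]
  ring

/-- Two distinct elements with a common face lie on opposite sides of it, so near its barycenter
they fill both half-spaces. -/
lemma faceBall_subset (hK : IsMesh Ω κ H K) (hd : 0 < d) {s t f : Finset (E d)}
    (hs : s ∈ elements K) (ht : t ∈ elements K) (hfs : f ⊆ s) (hft : f ⊆ t) (hf : f.card = d)
    (hst : s ≠ t) : closedBall (faceCenter f) (faceRadius d κ H) ⊆
      convexHull ℝ (s : Set (E d)) ∪ convexHull ℝ (t : Set (E d)) := by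
  classical
  intro z hz
  have hss := isSimplex_of_mem hs
  have hts := isSimplex_of_mem ht
  obtain ⟨o, hot, hof, ho⟩ := exists_opposite ht hft hf
  obtain ⟨o', hos, hof', ho'⟩ := exists_opposite hs hfs hf
  by_cases hzt : z ∈ convexHull ℝ (t : Set (E d))
  · exact Or.inr hzt
  left
  rw [mem_convexHull_iff_opposite hK hd ht hft hf hot ho hz, not_le] at hzt
  rw [mem_convexHull_iff_opposite hK hd hs hfs hf hos ho' hz]
  -- Both opposite coordinates vanish on the hyperplane of the face, hence are proportional.
  have hprop : ∀ x, bary s o' x = bary t o x * bary s o' o := by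
    intro x
    rw [affine_eq_sum hts (bary s o') x]
    refine Finset.sum_eq_single_of_mem o hot fun p hp hpo => ?_
    have hpf : p ∈ f := by
      by_contra h
      exact hpo (ho p hp h)
    rw [bary_ne hss (hfs hpf) (by rintro rfl; exact hof' hpf), mul_zero]
  have hneg : bary s o' o ≤ 0 := by
    by_contra! hpos
    -- If both elements were on the same side, the mirror image of `z` would be interior to `t` and
    -- also lie in `s`.
    set z' := faceCenter f + faceCenter f - z
    have hz' : z' ∈ closedBall (faceCenter f) (faceRadius d κ H) := by
      rw [mem_closedBall, dist_eq_norm] at hz ⊢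
      rw [← norm_neg]
      have e : -(z' - faceCenter f) = z - faceCenter f := by
        change -(faceCenter f + faceCenter f - z - faceCenter f) = z - faceCenter f
        abel
      rwa [e]
    have h1 : bary t o z' = - bary t o z := by
      rw [affine_reflect, bary_opposite_faceCenter ht hft (by omega) hof]; ring
    have h2 : 0 < bary t o z' := by linarith
    have h3 : z' ∈ interior (convexHull ℝ (t : Set (E d))) := by
      refine (mem_interior_iff hts).2 fun p hp => ?_
      by_cases hpf : p ∈ f
      · exact bary_faceCenter_pos hK hd ht hft hf hz' hpf
      · rwa [ho p hp hpf]
    have h4 : z' ∈ convexHull ℝ (s : Set (E d)) := by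
      rw [mem_convexHull_iff_opposite hK hd hs hfs hf hos ho' hz', hprop]
      positivity
    exact hst (eq_of_mem_interior ht hs h3 h4).symm
  rw [hprop]
  exact mul_nonneg_of_nonpos_of_nonpos hzt.le hneg

/-- Point reflection in the centre exchanges the two halves. -/
lemma volume_halfBall {g : E d →ᵃ[ℝ] ℝ} {b : E d} (hb : g b = 0) (r : ℝ) :
    volume (closedBall b r) ≤ 2 * volume (closedBall b r ∩ {z | 0 ≤ g z}) ∧
    volume (closedBall b r) ≤ 2 * volume (closedBall b r ∩ {z | g z ≤ 0}) := by
  have hmp : MeasurePreserving (fun z : E d => b + b - z) volume volume :=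
    Measure.measurePreserving_sub_left volume (b + b)
  have hms : MeasurableSet (closedBall b r ∩ {z | g z ≤ 0}) :=
    measurableSet_closedBall.inter (measurableSet_le (continuous_affine g).measurable measurable_const)
  have hpre : (fun z : E d => b + b - z) ⁻¹' (closedBall b r ∩ {z | g z ≤ 0}) =
      closedBall b r ∩ {z | 0 ≤ g z} := by
    ext z
    have h1 : dist (b + b - z) b = dist z b := by
      rw [dist_eq_norm, dist_eq_norm, ← norm_neg]
      congr 1; abel
    simp only [mem_preimage, mem_inter_iff, mem_closedBall, h1, mem_ofPred_eq, affine_reflect, hb]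
    constructor <;> rintro ⟨h2, h3⟩ <;> exact ⟨h2, by linarith⟩
  have heq : volume (closedBall b r ∩ {z | 0 ≤ g z}) = volume (closedBall b r ∩ {z | g z ≤ 0}) := by
    rw [← hpre, hmp.measure_preimage hms.nullMeasurableSet]
  have hcov : closedBall b r ⊆ (closedBall b r ∩ {z | 0 ≤ g z}) ∪ (closedBall b r ∩ {z | g z ≤ 0}) := by
    intro z hz
    rcases le_total 0 (g z) with h | h
    · exact Or.inl ⟨hz, h⟩
    · exact Or.inr ⟨hz, h⟩
  have h := (measure_mono hcov).trans (measure_union_le (μ := volume) _ _)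
  constructor
  · rwa [← heq, ← two_mul] at h
  · rwa [heq, ← two_mul] at h

/-- The intersection of an element with the ball around the barycenter of a face is large. -/
lemma volume_faceBall_inter (hK : IsMesh Ω κ H K) (hd : 0 < d) {t f : Finset (E d)}
    (ht : t ∈ elements K) (hft : f ⊆ t) (hf : f.card = d) :
    volume (closedBall (faceCenter f) (faceRadius d κ H)) ≤
      2 * volume (closedBall (faceCenter f) (faceRadius d κ H) ∩ convexHull ℝ (t : Set (E d))) := by
  obtain ⟨o, hot, hof, ho⟩ := exists_opposite ht hft hf
  have h := (volume_halfBall (bary_opposite_faceCenter ht hft (by omega) hof)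
    (faceRadius d κ H)).1
  have e : closedBall (faceCenter f) (faceRadius d κ H) ∩ convexHull ℝ (t : Set (E d)) =
      closedBall (faceCenter f) (faceRadius d κ H) ∩ {z | 0 ≤ bary t o z} := by
    ext z
    exact and_congr_right fun hz => mem_convexHull_iff_opposite hK hd ht hft hf hot ho hz
  rwa [e]

end Mesh

/-! ### Weighted Poincaré inequalities on patches -/

/-- The set of members bounded with exponent `n + 1` either grows at the next step or is closed
under adjacency, hence everything. Stating connectivity through closed sets avoids paths, and the
exponent never exceeds the cardinality. -/
lemma chain_bound {α : Type*} (S : Finset α) {adj : α → α → Prop} {F : α → ℝ≥0∞} {k M : ℝ≥0∞}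
    (hk : 1 ≤ k) (hstep : ∀ s ∈ S, ∀ t ∈ S, adj s t → F t ≤ k * (F s + M)) {t₀ : α} (ht₀ : t₀ ∈ S)
    (h₀ : F t₀ ≤ k * M)
    (hconn : ∀ C : Set α, (∀ s ∈ S, ∀ t ∈ S, adj s t → s ∈ C → t ∈ C) → t₀ ∈ C → ∀ t ∈ S, t ∈ C) :
    ∀ t ∈ S, F t ≤ (2 * k) ^ S.card * M := by
  classical
  have hk1 : 1 ≤ 2 * k := by
    calc (1 : ℝ≥0∞) ≤ 2 * 1 := by norm_num
      _ ≤ 2 * k := by gcongr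
  set B : ℕ → Finset α := fun n => S.filter fun t => F t ≤ (2 * k) ^ (n + 1) * M with hB
  have hmono : ∀ n, B n ⊆ B (n + 1) := fun n t ht => by
    simp only [hB, Finset.mem_filter] at ht ⊢
    refine ⟨ht.1, ht.2.trans ?_⟩
    gcongr
    omega
  have ht₀B : ∀ n, t₀ ∈ B n := fun n => by
    simp only [hB, Finset.mem_filter]
    refine ⟨ht₀, h₀.trans ?_⟩
    gcongr
    calc k ≤ 2 * k := le_mul_of_one_le_left' (by norm_num)
      _ ≤ _ := le_self_pow₀ hk1 (by omega)
  have hadj : ∀ n, ∀ s ∈ B n, ∀ t ∈ S, adj s t → t ∈ B (n + 1) := by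
    intro n s hs t ht hst
    simp only [hB, Finset.mem_filter] at hs ⊢
    refine ⟨ht, (hstep s hs.1 t ht hst).trans ?_⟩
    calc k * (F s + M) ≤ k * ((2 * k) ^ (n + 1) * M + 1 * M) := by
          rw [one_mul]; gcongr; exact hs.2
      _ ≤ k * ((2 * k) ^ (n + 1) * M + (2 * k) ^ (n + 1) * M) := by
          gcongr; exact one_le_pow₀ hk1
      _ = _ := by ring
  have hgrow : ∀ n, B n = S ∨ n + 1 ≤ (B n).card := by
    intro n
    induction n with
    | zero => exact Or.inr (Finset.card_pos.2 ⟨t₀, ht₀B 0⟩)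
    | succ n ih =>
      rcases eq_or_ne (B n) (B (n + 1)) with he | hne
      · left
        rw [← he]
        refine Finset.Subset.antisymm (Finset.filter_subset _ _) fun t ht => ?_
        refine hconn (B n : Set α) (fun s _ t ht hst hs => ?_) (ht₀B n) t ht
        rw [he]
        exact hadj n s hs t ht hst
      · rcases ih with h | h
        · left
          exact Finset.Subset.antisymm (Finset.filter_subset _ _) (h ▸ hmono n)
        · right
          have := Finset.card_lt_card (Finset.ssubset_iff_subset_ne.2 ⟨hmono n, hne⟩)
          omega
  have hpos : 0 < S.card := Finset.card_pos.2 ⟨t₀, ht₀⟩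
  have hS : B (S.card - 1) = S := by
    rcases hgrow (S.card - 1) with h | h
    · exact h
    · exact Finset.eq_of_subset_of_card_le (Finset.filter_subset _ _) (by omega)
  intro t ht
  rw [← hS] at ht
  have := (Finset.mem_filter.1 ht).2
  rwa [Nat.sub_add_cancel hpos] at this

section Mesh

variable {Ω : Set (E d)} {κ H : ℝ} {K : Geometry.SimplicialComplex ℝ (E d)}

open Classical in
/-- Patches are connected through faces. -/
lemma patchElts_connected (hΩ : IsLipschitzDomain Ω) (hK : IsMesh Ω κ H K) {v : E d}
    (hv : v ∈ K.vertices) (k : ℕ) {C : Set (Finset (E d))}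
    (hC : ∀ s ∈ patchElts K v k, ∀ t ∈ patchElts K v k, (s ∩ t).card = d → s ∈ C → t ∈ C)
    {T T' : Finset (E d)} (hT : T ∈ patchElts K v k) (hT' : T' ∈ patchElts K v k) (hTC : T ∈ C) :
    T' ∈ C := by
  induction k generalizing T T' with
  | zero =>
    exact star_connected hΩ hK hv (C := C) (fun s hs t ht hws hwt => hC s ⟨hs, hws⟩ t ⟨ht, hwt⟩)
      hT.1 hT'.1 hT.2 hT'.2 hTC
  | succ k ih =>
    -- The full star of a vertex of layer `k` belongs to layer `k + 1`, so connectivity of stars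
    -- links `T` to `s` and `s'` to `T'`; the induction hypothesis links `s` to `s'`.
    have hstar : ∀ s ∈ patchElts K v k, ∀ p ∈ s, ∀ {a b}, a ∈ elements K → b ∈ elements K →
        p ∈ a → p ∈ b → a ∈ C → b ∈ C := by
      intro s hs p hp a b ha hb hpa hpb haC
      have hmem : ∀ t ∈ elements K, p ∈ t → t ∈ patchElts K v (k + 1) := fun t ht hpt =>
        ⟨ht, s, hs, p, Finset.mem_inter.2 ⟨hpt, hp⟩⟩
      exact star_connected hΩ hK (vertex_of_mem (patchElts_subset v k hs) hp) (C := C)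
        (fun s hs t ht hws hwt => hC s (hmem s hs hws) t (hmem t ht hwt)) ha hb hpa hpb haC
    obtain ⟨hTe, s, hs, p, hp⟩ := hT
    obtain ⟨hTe', s', hs', p', hp'⟩ := hT'
    rw [Finset.mem_inter] at hp hp'
    have hsC : s ∈ C := hstar s hs p hp.2 hTe (patchElts_subset v k hs) hp.1 hp.2 hTC
    have hs'C : s' ∈ C := ih (fun a ha b hb => hC a (patchElts_subset_succ v k ha) b
      (patchElts_subset_succ v k hb)) hs hs' hsC
    exact hstar s' hs' p' hp'.2 (patchElts_subset v k hs') hTe' hp'.2 hp'.1 hs'C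

lemma patchElts_subset_closedBall (hK : IsMesh Ω κ H K) {v : E d} {k : ℕ} {t : Finset (E d)}
    (ht : t ∈ patchElts K v k) : convexHull ℝ (t : Set (E d)) ⊆ closedBall v ((k + 1) * H) := by
  induction k generalizing t with
  | zero =>
    intro x hx
    rw [mem_closedBall]
    simpa using hK.dist_le ht.1 hx (subset_convexHull ℝ _ ht.2)
  | succ k ih =>
    obtain ⟨hte, s, hs, p, hp⟩ := ht
    classical
    rw [Finset.mem_inter] at hp
    intro x hx
    have h1 := hK.dist_le hte hx (subset_convexHull ℝ _ hp.1)
    have h2 := mem_closedBall.1 (ih hs (subset_convexHull ℝ _ hp.2))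
    rw [mem_closedBall]
    push_cast
    linarith [dist_triangle x p v]

/-- The number of elements of a patch is bounded. -/
lemma card_patchElts_le (hK : IsMesh Ω κ H K) (hd : 0 < d) {v : E d} {k : ℕ}
    {S : Finset (Finset (E d))} (hS : ∀ t ∈ S, t ∈ patchElts K v k) :
    (S.card : ℝ) ≤ ((k + 1) * κ ^ 2) ^ d := by
  rcases S.eq_empty_or_nonempty with rfl | ⟨t₀, ht₀⟩
  · simp only [Finset.card_empty, Nat.cast_zero]
    positivity
  obtain ⟨hH, hκ, -⟩ := hK.exists_ball hd (patchElts_subset v k (hS t₀ ht₀))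
  have hr : 0 < H / κ ^ 2 := by positivity
  -- The elements have disjoint interiors, each contains a ball of radius `H / κ²`, and all lie in
  -- one ball of radius `(k + 1)H`.
  have hvol : S.card * volume (ball (0 : E d) (H / κ ^ 2)) ≤
      volume (closedBall v ((k + 1) * H)) := by
    calc S.card * volume (ball (0 : E d) (H / κ ^ 2))
        ≤ ∑ t ∈ S, volume (interior (convexHull ℝ (t : Set (E d)))) := by
          rw [← nsmul_eq_mul]
          refine Finset.card_nsmul_le_sum _ _ _ fun t ht => ?_
          obtain ⟨-, -, c, hc⟩ := hK.exists_ball hd (patchElts_subset v k (hS t ht))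
          rw [← Measure.addHaar_ball_center volume c]
          exact measure_mono (interior_maximal (ball_subset_closedBall.trans hc) isOpen_ball)
      _ = volume (⋃ t ∈ S, interior (convexHull ℝ (t : Set (E d)))) := by
          refine (measure_biUnion_finset (fun s hs t ht hst => ?_)
            fun t _ => isOpen_interior.measurableSet).symm
          rw [Function.onFun, disjoint_left]
          intro x hxs hxt
          exact hst (eq_of_mem_interior (patchElts_subset v k (hS s hs))
            (patchElts_subset v k (hS t ht)) hxs (interior_subset hxt))
      _ ≤ _ := measure_mono (iUnion₂_subset fun t ht =>
          interior_subset.trans (patchElts_subset_closedBall hK (hS t ht)))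
  have : Nonempty (Fin d) := ⟨⟨0, hd⟩⟩
  rw [Measure.addHaar_closedBall volume v (by positivity), Measure.addHaar_ball volume 0 hr.le,
    ← mul_assoc, ENNReal.mul_le_mul_iff_left (measure_ball_pos volume 0 one_pos).ne'
    measure_ball_lt_top.ne, ← ENNReal.ofReal_natCast, ← ENNReal.ofReal_mul (by positivity),
    ENNReal.ofReal_le_ofReal_iff (by positivity)] at hvol
  simp only [finrank_euclideanSpace, Fintype.card_fin] at hvol
  rw [← le_div_iff₀ (by positivity), ← div_pow] at hvol
  have e : (k + 1) * H / (H / κ ^ 2) = (k + 1) * κ ^ 2 := by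
    field_simp
  rwa [e] at hvol

/-- Cancellation of the powers of the mesh size. -/
lemma sq_cancel {θ : ℝ} (hθ : 0 < θ) (hH : 0 < H) {V I M : ℝ≥0∞} {A : ℝ≥0}
    (hV : ENNReal.ofReal (θ * H ^ d) ≤ V)
    (h : V ^ 2 * I ≤ 2 * (A * ENNReal.ofReal H ^ (2 * d)) * M) :
    I ≤ ENNReal.ofReal (2 * A / θ ^ 2) * M := by
  have h1 : ENNReal.ofReal (θ * H ^ d) ^ 2 * I ≤ 2 * (A * ENNReal.ofReal H ^ (2 * d)) * M :=
    le_trans (by gcongr) h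
  have h2 : (2 * (A * ENNReal.ofReal H ^ (2 * d)) : ℝ≥0∞) =
      ENNReal.ofReal (θ * H ^ d) ^ 2 * ENNReal.ofReal (2 * A / θ ^ 2) := by
    have e : (θ * H ^ d) ^ 2 * (2 * A / θ ^ 2) = 2 * (A * H ^ (2 * d)) := by
      field_simp
      ring
    rw [← ENNReal.ofReal_pow (p := θ * H ^ d) (by positivity), ← ENNReal.ofReal_mul (by positivity), e,
      ENNReal.ofReal_mul (p := 2) (by norm_num),
      ENNReal.ofReal_mul (p := (A : ℝ)) A.2, ENNReal.ofReal_coe_nnreal,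
      ENNReal.ofReal_pow hH.le, ENNReal.ofReal_ofNat]
  rw [h2, mul_assoc] at h1
  refine (ENNReal.mul_le_mul_iff_right ?_ (by finiteness)).1 h1
  have : 0 < θ * H ^ d := by positivity
  exact pow_ne_zero _ (ENNReal.ofReal_pos.2 this).ne'

/-- The constant in the lower bound for the volume of balls around barycenters of faces. -/
def volConst (d : ℕ) (κ : ℝ) : ℝ := (κ ^ 2 * d)⁻¹ ^ d * (volume (ball (0 : E d) 1)).toReal / 2

lemma volConst_pos (hd : 0 < d) {κ : ℝ} (hκ : 2 ≤ κ) : 0 < volConst d κ := by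
  have h1 : 0 < (volume (ball (0 : E d) 1)).toReal :=
    ENNReal.toReal_pos (measure_ball_pos volume 0 one_pos).ne' measure_ball_lt_top.ne
  have : (0 : ℝ) < d := by exact_mod_cast hd
  rw [volConst]
  positivity

/-- The factor 2 is the half of the ball that is cut away by the hyperplane of the face. -/
lemma le_volume_closedBall (hd : 0 < d) (hκ : 2 ≤ κ) (hH : 0 < H) (b : E d) {V : ℝ≥0∞}
    (hV : volume (closedBall b (faceRadius d κ H)) ≤ 2 * V) :
    ENNReal.ofReal (volConst d κ * H ^ d) ≤ V := by
  have hd' : (0 : ℝ) < d := by exact_mod_cast hd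
  have hr : 0 ≤ faceRadius d κ H := by rw [faceRadius]; positivity
  rw [Measure.addHaar_closedBall volume b hr] at hV
  have h1 : ENNReal.ofReal (faceRadius d κ H ^ Module.finrank ℝ (E d)) *
      volume (ball (0 : E d) 1) = 2 * ENNReal.ofReal (volConst d κ * H ^ d) := by
    have h3 : faceRadius d κ H = (κ ^ 2 * d)⁻¹ * H := by
      rw [faceRadius]; field_simp
    have h4 : faceRadius d κ H ^ d * (volume (ball (0 : E d) 1)).toReal =
        2 * (volConst d κ * H ^ d) := by
      rw [volConst, h3, mul_pow]
      ring
    rw [finrank_euclideanSpace, Fintype.card_fin,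
      ← ENNReal.ofReal_toReal (measure_ball_lt_top (μ := volume) (x := (0 : E d)) (r := 1)).ne,
      ← ENNReal.ofReal_mul (by positivity), h4, ENNReal.ofReal_mul (by norm_num),
      ENNReal.ofReal_ofNat]
  rw [h1] at hV
  exact (ENNReal.mul_le_mul_iff_right (by norm_num) (by norm_num)).1 hV

lemma two_mul_faceRadius_le (hd : 0 < d) (hκ : 2 ≤ κ) (hH : 0 < H) :
    2 * faceRadius d κ H ≤ H := by
  have hd' : (1 : ℝ) ≤ d := by exact_mod_cast hd
  rw [faceRadius, div_div, mul_div_assoc', div_le_iff₀ (by positivity)]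
  have h1 : 2 ≤ κ ^ 2 * d := by
    nlinarith [mul_le_mul_of_nonneg_left hd' (sq_nonneg κ)]
  nlinarith [mul_le_mul_of_nonneg_left h1 hH.le]

lemma dist_le_of_mem_faceBall (hd : 0 < d) (hκ : 2 ≤ κ) (hH : 0 < H) {b x y : E d}
    (hx : x ∈ closedBall b (faceRadius d κ H)) (hy : y ∈ closedBall b (faceRadius d κ H)) :
    dist x y ≤ H := by
  rw [mem_closedBall] at hx hy
  have := two_mul_faceRadius_le hd hκ hH
  linarith [dist_triangle_right x y b]

lemma line_mem {D : Set (E d)} (hD : Convex ℝ D) {x y : E d} (hx : x ∈ D) (hy : y ∈ D) {t : ℝ}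
    (ht : t ∈ Ioc (0 : ℝ) 1) : x + t • (y - x) ∈ D :=
  hD.add_smul_sub_mem hx hy ⟨ht.1.le, ht.2⟩

/-- The constant in the transfer of estimates between neighbouring elements. -/
def transferConst (d : ℕ) (κ : ℝ) (A : ℝ≥0) : ℝ≥0∞ := ENNReal.ofReal (2 * A / volConst d κ ^ 2)

lemma IsMesh.setLIntegral_le_patch {μ : Measure (E d)} (hΩ : IsLipschitzDomain Ω) (hK : IsMesh Ω κ H K)
    (hμv : μ ≪ volume) {v : E d} {k : ℕ} {t : Finset (E d)} (ht : t ∈ patchElts K v k)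
    (g : E d → ℝ≥0∞) : ∫⁻ x in convexHull ℝ (t : Set (E d)), g x ∂μ ≤
      ∫⁻ x in patch Ω K v k, g x ∂μ := by
  have h1 : convexHull ℝ (t : Set (E d)) ≤ᵐ[μ] interior (convexHull ℝ (t : Set (E d))) := by
    rw [ae_le_set]
    refine hμv ?_
    rw [← volume_frontier_convexHull t, (isClosed_convexHull t).frontier_eq]
  exact (lintegral_mono' (Measure.restrict_mono' h1 le_rfl) le_rfl).trans
    (lintegral_mono_set (interior_subset_patch hΩ hK ht))

lemma IsMesh.setLIntegral_patch_le {μ : Measure (E d)} (hΩ : IsLipschitzDomain Ω) (hK : IsMesh Ω κ H K)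
    {v : E d} {k : ℕ} {S : Finset (Finset (E d))} (hS : ∀ t, t ∈ S ↔ t ∈ patchElts K v k)
    (g : E d → ℝ≥0∞) : ∫⁻ x in patch Ω K v k, g x ∂μ ≤
      ∑ t ∈ S, ∫⁻ x in convexHull ℝ (t : Set (E d)), g x ∂μ := by
  have h1 : patch Ω K v k ⊆ ⋃ t ∈ S, convexHull ℝ (t : Set (E d)) := by
    refine (patch_subset hΩ hK v k).trans (iUnion₂_subset fun t ht => ?_)
    exact subset_biUnion_of_mem (u := fun t : Finset (E d) => convexHull ℝ (t : Set (E d)))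
      ((hS t).2 ht)
  calc _ ≤ ∫⁻ x in ⋃ t ∈ S, convexHull ℝ (t : Set (E d)), g x ∂μ := lintegral_mono_set h1
    _ ≤ ∑ t ∈ S, ∫⁻ x in convexHull ℝ (t : Set (E d)), g x ∂μ := by
        rw [← S.tsum_subtype fun t : Finset (E d) => ∫⁻ x in convexHull ℝ (t : Set (E d)), g x ∂μ]
        have h2 : (⋃ t ∈ S, convexHull ℝ (t : Set (E d))) =
            ⋃ t : S, convexHull ℝ ((t : Finset (E d)) : Set (E d)) := by
          rw [iUnion_subtype]
        rw [h2]
        exact lintegral_iUnion_le _ _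

section Elements

variable {A : ℝ≥0} {μ : Measure (E d)} [SFinite μ] {φ : E d → ℝ}

/-- Transfer within an element. -/
lemma AvgBounded.transfer_element (hμ : AvgBounded A μ) (hK : IsMesh Ω κ H K) (hd : 0 < d)
    (hφ : ContDiff ℝ 1 φ) {t f : Finset (E d)} (ht : t ∈ elements K) (hft : f ⊆ t)
    (hf : f.card = d) (c : ℝ) :
    ∫⁻ x in convexHull ℝ (t : Set (E d)), ‖φ x - c‖ₑ ^ 2 ∂μ ≤ transferConst d κ A *
      (∫⁻ x in closedBall (faceCenter f) (faceRadius d κ H) ∩ convexHull ℝ (t : Set (E d)),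
          ‖φ x - c‖ₑ ^ 2 ∂μ + ENNReal.ofReal H ^ 2 *
        ∫⁻ x in convexHull ℝ (t : Set (E d)), ‖gradient φ x‖ₑ ^ 2 ∂μ) := by
  obtain ⟨hH, hκ, -⟩ := hK.exists_ball hd ht
  refine sq_cancel (volConst_pos hd hκ) hH (le_volume_closedBall hd hκ hH _
    (volume_faceBall_inter hK hd ht hft hf)) (hμ.transfer hφ hH (measurableSet_convexHull t)
    (measurableSet_closedBall.inter (measurableSet_convexHull t)) (measurableSet_convexHull t)
    (fun x hx y hy => ⟨hK.dist_le ht hx hy.2, fun τ hτ => ?_⟩) c)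
  exact line_mem (convex_convexHull ℝ _) hx hy.2 hτ

open Classical in
/-- Transfer between neighbouring elements. -/
lemma AvgBounded.transfer_neighbor (hμ : AvgBounded A μ) (hK : IsMesh Ω κ H K) (hd : 0 < d)
    (hφ : ContDiff ℝ 1 φ) {s t : Finset (E d)} (hs : s ∈ elements K) (ht : t ∈ elements K)
    (hst : (s ∩ t).card = d) (c : ℝ) :
    ∫⁻ x in convexHull ℝ (t : Set (E d)), ‖φ x - c‖ₑ ^ 2 ∂μ ≤
      (transferConst d κ A + 1) ^ 2 * (∫⁻ x in convexHull ℝ (s : Set (E d)), ‖φ x - c‖ₑ ^ 2 ∂μ +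
        2 * (ENNReal.ofReal H ^ 2 *
        ∫⁻ x in convexHull ℝ (s : Set (E d)) ∪ convexHull ℝ (t : Set (E d)),
          ‖gradient φ x‖ₑ ^ 2 ∂μ)) := by
  obtain ⟨hH, hκ, -⟩ := hK.exists_ball hd ht
  set f := s ∩ t with hf
  have hfs : f ⊆ s := Finset.inter_subset_left
  have hft : f ⊆ t := Finset.inter_subset_right
  have hne : s ≠ t := by
    rintro rfl
    rw [hf, Finset.inter_self, hs.2] at hst
    omega
  have hsub := faceBall_subset hK hd hs ht hfs hft hst hne
  set B := closedBall (faceCenter f) (faceRadius d κ H)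
  set D := ENNReal.ofReal H ^ 2 *
        ∫⁻ x in convexHull ℝ (s : Set (E d)) ∪ convexHull ℝ (t : Set (E d)),
          ‖gradient φ x‖ₑ ^ 2 ∂μ
  set k := transferConst d κ A
  -- The union of the two elements need not be convex, but the ball at their common face is convex
  -- and contained in it.
  have h1 : ∫⁻ x in B ∩ convexHull ℝ (t : Set (E d)), ‖φ x - c‖ₑ ^ 2 ∂μ ≤
      k * (∫⁻ x in B ∩ convexHull ℝ (s : Set (E d)), ‖φ x - c‖ₑ ^ 2 ∂μ + D) := by
    refine sq_cancel (volConst_pos hd hκ) hH (le_volume_closedBall hd hκ hH _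
      (volume_faceBall_inter hK hd hs hfs hst)) (hμ.transfer hφ hH
      (measurableSet_closedBall.inter (measurableSet_convexHull t))
      (measurableSet_closedBall.inter (measurableSet_convexHull s))
      ((measurableSet_convexHull s).union (measurableSet_convexHull t))
      (fun x hx y hy => ⟨dist_le_of_mem_faceBall hd hκ hH hx.1 hy.1, fun τ hτ => ?_⟩) c)
    exact hsub (line_mem (convex_closedBall _ _) hx.1 hy.1 hτ)
  have h2 := hμ.transfer_element hK hd hφ ht hft hst c
  calc _ ≤ k * (∫⁻ x in B ∩ convexHull ℝ (t : Set (E d)), ‖φ x - c‖ₑ ^ 2 ∂μ +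
        ENNReal.ofReal H ^ 2 * ∫⁻ x in convexHull ℝ (t : Set (E d)), ‖gradient φ x‖ₑ ^ 2 ∂μ) := h2
    _ ≤ k * (k * (∫⁻ x in convexHull ℝ (s : Set (E d)), ‖φ x - c‖ₑ ^ 2 ∂μ + D) + D) := by
        have h3 : ENNReal.ofReal H ^ 2 *
            ∫⁻ x in convexHull ℝ (t : Set (E d)), ‖gradient φ x‖ₑ ^ 2 ∂μ ≤ D :=
          mul_le_mul_right (lintegral_mono_set subset_union_right) _
        have h4 := lintegral_mono_set (μ := μ) (f := fun x => ‖φ x - c‖ₑ ^ 2)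
          (inter_subset_right : B ∩ convexHull ℝ (s : Set (E d)) ⊆ _)
        gcongr
        exact h1.trans (by gcongr)
    _ ≤ (k + 1) * ((k + 1) * (∫⁻ x in convexHull ℝ (s : Set (E d)), ‖φ x - c‖ₑ ^ 2 ∂μ + D) +
          (k + 1) * D) := by
        gcongr
        · exact le_self_add
        · exact le_self_add
        · exact le_mul_of_one_le_left' le_add_self
    _ = _ := by ring

/-- The Poincaré inequality on an element. -/
lemma AvgBounded.poincare_element (hμ : AvgBounded A μ) (hK : IsMesh Ω κ H K) (hd : 0 < d)
    (hφ : ContDiff ℝ 1 φ) {t : Finset (E d)} (ht : t ∈ elements K) : ∃ c : ℝ,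
    ∫⁻ x in convexHull ℝ (t : Set (E d)), ‖φ x - c‖ₑ ^ 2 ∂μ ≤ transferConst d κ A *
      (ENNReal.ofReal H ^ 2 *
        ∫⁻ x in convexHull ℝ (t : Set (E d)), ‖gradient φ x‖ₑ ^ 2 ∂μ) := by
  obtain ⟨hH, hκ, -⟩ := hK.exists_ball hd ht
  -- Any face will do; it only serves to bound the volume of the element from below.
  obtain ⟨f, hft, hf⟩ := Finset.exists_subset_card_eq (s := t) (n := d) (by rw [ht.2]; omega)
  have hV := le_volume_closedBall hd hκ hH _ (volume_faceBall_inter hK hd ht hft hf)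
  have hV' := hV.trans (measure_mono inter_subset_right)
  obtain ⟨c, hc⟩ := hμ.average hφ hH (measurableSet_convexHull t) (measurableSet_convexHull t)
    (measurableSet_convexHull t) (fun x hx y hy => ⟨hK.dist_le ht hx hy, fun τ hτ =>
      line_mem (convex_convexHull ℝ _) hx hy hτ⟩) (isCompact_convexHull t) (by
        have : 0 < volConst d κ * H ^ d := by
          have := volConst_pos hd hκ
          positivity
        exact ((ENNReal.ofReal_pos.2 this).trans_le hV').ne')
  exact ⟨c, sq_cancel (volConst_pos hd hκ) hH hV' hc⟩

/-- The Friedrichs inequality on an element with a face on the boundary. -/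
lemma AvgBounded.friedrichs_element (hμ : AvgBounded A μ) (hK : IsMesh Ω κ H K) (hd : 0 < d)
    (hφ : ContDiff ℝ 1 φ) {t f : Finset (E d)} (ht : t ∈ elements K) (hft : f ⊆ t)
    (hf : f.card = d) (h0 : ∀ x ∈ convexHull ℝ (f : Set (E d)), φ x = 0) :
    ∫⁻ x in convexHull ℝ (t : Set (E d)), ‖φ x‖ₑ ^ 2 ∂μ ≤ 2 * (transferConst d κ A + 1) ^ 2 *
      (ENNReal.ofReal H ^ 2 *
        ∫⁻ x in convexHull ℝ (t : Set (E d)), ‖gradient φ x‖ₑ ^ 2 ∂μ) := by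
  obtain ⟨hH, hκ, -⟩ := hK.exists_ball hd ht
  obtain ⟨o, hot, hof, ho⟩ := exists_opposite ht hft hf
  set B := closedBall (faceCenter f) (faceRadius d κ H) with hB
  set D := ENNReal.ofReal H ^ 2 *
        ∫⁻ x in convexHull ℝ (t : Set (E d)), ‖gradient φ x‖ₑ ^ 2 ∂μ
  set k := transferConst d κ A
  have hm : MeasurableSet {z | bary t o z ≤ 0} :=
    measurableSet_le (continuous_affine _).measurable measurable_const
  -- The target set is the half of the ball beyond the face. A segment towards it crosses the
  -- hyperplane within the ball, hence in the face, where `φ` vanishes, and stays in the element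
  -- until then.
  have h1 : ∫⁻ x in B ∩ convexHull ℝ (t : Set (E d)), ‖φ x‖ₑ ^ 2 ∂μ ≤ k * D := by
    refine sq_cancel (volConst_pos hd hκ) hH (le_volume_closedBall hd hκ hH _
      (volume_halfBall (bary_opposite_faceCenter ht hft (by omega) hof) _).2)
      (hμ.boundary hφ hH (measurableSet_closedBall.inter (measurableSet_convexHull t))
      (measurableSet_closedBall.inter hm) (measurableSet_convexHull t)
      fun x hx y hy => ⟨dist_le_of_mem_faceBall hd hκ hH hx.1 hy.1, ?_⟩)
    have hline : ∀ τ : ℝ, bary t o (x + τ • (y - x)) =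
        (1 - τ) * bary t o x + τ * bary t o y := by
      intro τ
      have h1 : x + τ • (y - x) = AffineMap.lineMap x y τ := by
        rw [AffineMap.lineMap_apply, vsub_eq_sub, vadd_eq_add, add_comm]
      rw [h1, AffineMap.apply_lineMap, AffineMap.lineMap_apply]
      simp only [vsub_eq_sub, smul_eq_mul, vadd_eq_add]
      ring
    have ha : 0 ≤ bary t o x := bary_nonneg (isSimplex_of_mem ht) hx.2 o
    have hb : bary t o y ≤ 0 := hy.2
    obtain ⟨τ, hτ, hτ0⟩ : ∃ τ ∈ Icc (0 : ℝ) 1, (1 - τ) * bary t o x + τ * bary t o y = 0 := by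
      rcases ha.eq_or_lt with ha | ha
      · exact ⟨0, by simp, by simp [← ha]⟩
      · refine ⟨bary t o x / (bary t o x - bary t o y), ⟨div_nonneg ha.le (by linarith),
          (div_le_one (by linarith)).2 (by linarith)⟩, ?_⟩
        have : bary t o x - bary t o y ≠ 0 := by linarith
        field_simp
        ring
    have hball : ∀ s ∈ Icc (0 : ℝ) 1, x + s • (y - x) ∈ B := fun s hs =>
      (convex_closedBall _ _).add_smul_sub_mem hx.1 hy.1 hs
    have hmem : ∀ s ∈ Icc (0 : ℝ) τ, x + s • (y - x) ∈ convexHull ℝ (t : Set (E d)) := by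
      intro s hs
      rw [mem_convexHull_iff_opposite hK hd ht hft hf hot ho (hball s ⟨hs.1, hs.2.trans hτ.2⟩),
        hline]
      nlinarith [hs.2, hs.1]
    refine ⟨τ, hτ, h0 _ ?_, fun s hs => hmem s ⟨hs.1.le, hs.2⟩⟩
    refine (mem_face_iff (isSimplex_of_mem ht) hft).2 ⟨fun p hp =>
      (bary_faceCenter_pos hK hd ht hft hf (hball τ hτ) hp).le, fun p hp hpf => ?_⟩
    rw [ho p hp hpf, hline, hτ0]
  have h2 := hμ.transfer_element hK hd hφ ht hft hf 0
  simp only [sub_zero] at h2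
  calc _ ≤ k * (k * D + D) := h2.trans (by gcongr)
    _ ≤ (k + 1) * ((k + 1) * D + (k + 1) * D) := by
        gcongr
        · exact le_self_add
        · exact le_self_add
        · exact le_mul_of_one_le_left' le_add_self
    _ = _ := by ring

end Elements

/-- Poincaré and Friedrichs inequalities on the patches, with uniform constants. -/
lemma AvgBounded.exists_poincare_patch (hd : 0 < d) (κ : ℝ) (A : ℝ≥0) (k : ℕ) : ∃ C : ℝ≥0,
    ∀ (Ω : Set (E d)) (H : ℝ) (K : Geometry.SimplicialComplex ℝ (E d)) (μ : Measure (E d))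
      [SFinite μ], AvgBounded A μ → μ ≪ volume → IsLipschitzDomain Ω → IsMesh Ω κ H K →
      ∀ v ∈ K.vertices, ∀ φ : E d → ℝ, ContDiff ℝ 1 φ →
      (∃ c : ℝ, ∫⁻ x in patch Ω K v k, ‖φ x - c‖ₑ ^ 2 ∂μ ≤
        C * (ENNReal.ofReal H ^ 2 * ∫⁻ x in patch Ω K v k, ‖gradient φ x‖ₑ ^ 2 ∂μ)) ∧
      ∀ t ∈ patchElts K v k, ∀ f ⊆ t, f.card = d → (∀ x ∈ convexHull ℝ (f : Set (E d)), φ x = 0) →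
        ∫⁻ x in patch Ω K v k, ‖φ x‖ₑ ^ 2 ∂μ ≤
        C * (ENNReal.ofReal H ^ 2 * ∫⁻ x in patch Ω K v k, ‖gradient φ x‖ₑ ^ 2 ∂μ) := by
  classical
  set N : ℕ := ⌈(((k : ℝ) + 1) * κ ^ 2) ^ d⌉₊
  set kk : ℝ≥0∞ := 2 * (transferConst d κ A + 1) ^ 2 with hkk
  have hkk1 : 1 ≤ kk := by
    calc (1 : ℝ≥0∞) ≤ 2 * (0 + 1) ^ 2 := by norm_num
      _ ≤ kk := by rw [hkk]; gcongr; exact bot_le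
  have hkkf : kk ≠ ⊤ := by rw [hkk, transferConst]; finiteness
  have hfin : N * ((2 * kk) ^ N * 2) ≠ ⊤ := by finiteness
  refine ⟨(N * ((2 * kk) ^ N * 2)).toNNReal, ?_⟩
  intro Ω H K μ _ hμ hμv hΩ hK v hv φ hφ
  rw [ENNReal.coe_toNNReal hfin]
  have hSfin : (patchElts K v k).Finite := hK.elements_finite.subset (patchElts_subset v k)
  set S := hSfin.toFinset
  have hS : ∀ t, t ∈ S ↔ t ∈ patchElts K v k := fun t => hSfin.mem_toFinset
  have hcard : S.card ≤ N := by
    have := card_patchElts_le hK hd (S := S) fun t ht => (hS t).1 ht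
    exact (Nat.cast_le (α := ℝ)).1 (this.trans (Nat.le_ceil _))
  set D := ENNReal.ofReal H ^ 2 * ∫⁻ x in patch Ω K v k, ‖gradient φ x‖ₑ ^ 2 ∂μ with hD
  have hDt : ∀ t ∈ patchElts K v k, ENNReal.ofReal H ^ 2 *
      ∫⁻ x in convexHull ℝ (t : Set (E d)), ‖gradient φ x‖ₑ ^ 2 ∂μ ≤ D := fun t ht =>
    mul_le_mul_right (hK.setLIntegral_le_patch hΩ hμv ht _) _
  have hmain : ∀ (c : ℝ), ∀ t₀ ∈ patchElts K v k,
      ∫⁻ x in convexHull ℝ (t₀ : Set (E d)), ‖φ x - c‖ₑ ^ 2 ∂μ ≤ kk * (2 * D) →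
      ∫⁻ x in patch Ω K v k, ‖φ x - c‖ₑ ^ 2 ∂μ ≤ N * ((2 * kk) ^ N * 2) * D := by
    intro c t₀ ht₀ h₀
    -- `M = 2 * D` because the gradient term of a step involves two elements, each contributing at
    -- most `D`.
    have hch := chain_bound S (adj := fun s t => (s ∩ t).card = d)
      (F := fun t => ∫⁻ x in convexHull ℝ (t : Set (E d)), ‖φ x - c‖ₑ ^ 2 ∂μ) (M := 2 * D) hkk1
      (fun s hs t ht hst => by
        rw [hS] at hs ht
        refine (hμ.transfer_neighbor hK hd hφ (patchElts_subset v k hs) (patchElts_subset v k ht)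
          hst c).trans ?_
        have h1 : ENNReal.ofReal H ^ 2 *
            ∫⁻ x in convexHull ℝ (s : Set (E d)) ∪ convexHull ℝ (t : Set (E d)),
              ‖gradient φ x‖ₑ ^ 2 ∂μ ≤ 2 * D := by
          calc _ ≤ ENNReal.ofReal H ^ 2 *
                (∫⁻ x in convexHull ℝ (s : Set (E d)), ‖gradient φ x‖ₑ ^ 2 ∂μ +
                ∫⁻ x in convexHull ℝ (t : Set (E d)), ‖gradient φ x‖ₑ ^ 2 ∂μ) := by
                gcongr
                exact lintegral_union_le _ _ _
            _ ≤ D + D := by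
                rw [mul_add]
                exact add_le_add (hDt s hs) (hDt t ht)
            _ = _ := (two_mul D).symm
        calc _ ≤ (transferConst d κ A + 1) ^ 2 *
              (∫⁻ x in convexHull ℝ (s : Set (E d)), ‖φ x - c‖ₑ ^ 2 ∂μ + 2 * (2 * D)) := by
              gcongr
          _ ≤ (transferConst d κ A + 1) ^ 2 *
              (2 * (∫⁻ x in convexHull ℝ (s : Set (E d)), ‖φ x - c‖ₑ ^ 2 ∂μ) + 2 * (2 * D)) := by
              gcongr
              exact le_mul_of_one_le_left' (by norm_num)
          _ = _ := by rw [hkk]; ring)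
      ((hS t₀).2 ht₀) h₀
      (fun C hC ht₀C t ht => patchElts_connected hΩ hK hv k (C := C) (fun s hs t ht =>
        hC s ((hS s).2 hs) t ((hS t).2 ht)) ht₀ ((hS t).1 ht) ht₀C)
    calc _ ≤ ∑ t ∈ S, ∫⁻ x in convexHull ℝ (t : Set (E d)), ‖φ x - c‖ₑ ^ 2 ∂μ :=
          hK.setLIntegral_patch_le hΩ hS _
      _ ≤ ∑ _t ∈ S, (2 * kk) ^ S.card * (2 * D) := Finset.sum_le_sum hch
      _ = S.card * ((2 * kk) ^ S.card * (2 * D)) := by rw [Finset.sum_const, nsmul_eq_mul]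
      _ ≤ N * ((2 * kk) ^ N * (2 * D)) := by
          gcongr
          exact hkk1.trans (le_mul_of_one_le_left' (by norm_num))
      _ = _ := by ring
  constructor
  · obtain ⟨t₀, ht₀⟩ : (patchElts K v k).Nonempty := by
      obtain ⟨t, ht, hvt⟩ := hK.exists_mem_of_vertex hv
      have : ∀ j, t ∈ patchElts K v j := fun j => by
        induction j with
        | zero => exact ⟨ht, hvt⟩
        | succ j ih => exact patchElts_subset_succ v j ih
      exact ⟨t, this k⟩
    obtain ⟨c, hc⟩ := hμ.poincare_element hK hd hφ (patchElts_subset v k ht₀)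
    refine ⟨c, hmain c t₀ ht₀ (hc.trans ?_)⟩
    calc _ ≤ transferConst d κ A * D := by gcongr; exact hDt t₀ ht₀
      _ ≤ kk * (2 * D) := by
        gcongr
        · rw [hkk]
          calc transferConst d κ A ≤ transferConst d κ A + 1 := le_self_add
            _ ≤ (transferConst d κ A + 1) ^ 2 := le_self_pow₀ le_add_self two_ne_zero
            _ ≤ _ := le_mul_of_one_le_left' (by norm_num)
        · exact le_mul_of_one_le_left' (by norm_num)
  · intro t ht f hft hf h0
    have h1 := hμ.friedrichs_element hK hd hφ (patchElts_subset v k ht) hft hf h0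
    have h2 := hmain 0 t ht (by
      simp only [sub_zero]
      refine h1.trans ?_
      calc _ ≤ kk * D := by gcongr; exact hDt t ht
        _ ≤ kk * (2 * D) := by
          gcongr
          exact le_mul_of_one_le_left' (by norm_num))
    simpa only [sub_zero] using h2

end Mesh

/-! ### The local projections -/

section Projection

variable {Ω : Set (E d)} {κ H : ℝ} {K : Geometry.SimplicialComplex ℝ (E d)}

lemma SH_add_smul {f g : E d → ℝ} (hf : f ∈ SH Ω K) (hg : g ∈ SH Ω K) (a b : ℝ) :
    a • f + b • g ∈ SH Ω K := by
  refine ⟨(hf.1.const_smul a).add (hg.1.const_smul b), fun x hx => ?_, fun t ht => ?_⟩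
  · simp [hf.2.1 x hx, hg.2.1 x hx]
  · obtain ⟨F, hF⟩ := hf.2.2 t ht
    obtain ⟨G, hG⟩ := hg.2.2 t ht
    exact ⟨a • F + b • G, fun x hx => by simp [hF x hx, hG x hx]⟩

lemma zero_mem_SH : (0 : E d → ℝ) ∈ SH Ω K :=
  ⟨continuousOn_const, fun _ _ => rfl, fun _ _ => ⟨0, fun _ _ => rfl⟩⟩

/-- The space `V_H` as a vector space. -/
def VHspace (Ω : Set (E d)) (K : Geometry.SimplicialComplex ℝ (E d)) :
    Submodule ℝ (E d → ℝ) where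
  carrier := VH Ω K
  add_mem' {f g} hf hg := ⟨by simpa using SH_add_smul hf.1 hg.1 1 1, fun x hx => by
    simp [hf.2 x hx, hg.2 x hx]⟩
  zero_mem' := ⟨zero_mem_SH, fun _ _ => rfl⟩
  smul_mem' a f hf := ⟨by simpa using SH_add_smul hf.1 hf.1 a 0, fun x hx => by
    simp [hf.2 x hx]⟩

lemma IsMesh.finiteDimensional (hK : IsMesh Ω κ H K) : FiniteDimensional ℝ (VHspace Ω K) := by
  have : Finite K.vertices := hK.vertices_finite
  let T : VHspace Ω K →ₗ[ℝ] (K.vertices → ℝ) :=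
    { toFun := fun f v => f.1 v
      map_add' := fun _ _ => rfl
      map_smul' := fun _ _ => rfl }
  refine FiniteDimensional.of_injective T fun f g h => Subtype.ext ?_
  exact SH_ext hK f.2.1 g.2.1 fun v hv => congrFun h ⟨v, hv⟩

lemma SH_eq_indicator {f : E d → ℝ} (hf : f ∈ SH Ω K) : f = (closure Ω).indicator f := by
  ext x
  by_cases hx : x ∈ closure Ω
  · rw [indicator_of_mem hx]
  · rw [indicator_of_notMem hx, hf.2.1 x hx]

lemma SH_measurable {f : E d → ℝ} (hf : f ∈ SH Ω K) : Measurable f := by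
  rw [SH_eq_indicator hf]
  classical
  rw [← piecewise_eq_indicator]
  exact hf.1.measurable_piecewise continuousOn_const isClosed_closure.measurableSet

lemma SH_memLp (hΩ : IsLipschitzDomain Ω) {μ : Measure (E d)} [IsLocallyFiniteMeasure μ]
    {f : E d → ℝ} (hf : f ∈ SH Ω K) {D : Set (E d)} (hD : D ⊆ closure Ω) :
    MemLp f 2 (μ.restrict D) := by
  have hc : IsCompact (closure Ω) := hΩ.isBounded.isCompact_closure
  obtain ⟨M, hM⟩ := hc.exists_bound_of_continuousOn hf.1
  have : IsFiniteMeasure (μ.restrict (closure Ω)) := ⟨by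
    rw [Measure.restrict_apply_univ]; exact hc.measure_lt_top⟩
  have h1 : MemLp f 2 (μ.restrict (closure Ω)) :=
    MemLp.of_bound (SH_measurable hf).aestronglyMeasurable M
      ((ae_restrict_iff' isClosed_closure.measurableSet).2 (ae_of_all _ hM))
  exact h1.mono_measure (Measure.restrict_mono hD le_rfl)

variable {Λ : Set (E d)} {β : ℝ} [IsLocallyFiniteMeasure (wMeas Λ β)]

lemma patch_subset_closure {v : E d} {k : ℕ} : patch Ω K v k ⊆ closure Ω :=
  (patch_subset_domain v k).trans subset_closure

/-- The image of `V_H` in `L²` of the patch is finite-dimensional, so the orthogonal projection onto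
it exists; any preimage represents it. The map is not injective, as functions of `V_H` may vanish on
the patch. -/
lemma exists_isLocalProj (hΩ : IsLipschitzDomain Ω) (hK : IsMesh Ω κ H K) {v : E d} {u : E d → ℝ}
    (hu : MemLp u 2 ((wMeas Λ β).restrict (patch Ω K v 0))) :
    ∃ p, IsLocalProj Ω K Λ β v u p := by
  set ν := (wMeas Λ β).restrict (patch Ω K v 0)
  have hL : ∀ w : VHspace Ω K, MemLp w.1 2 ν := fun w => SH_memLp hΩ w.2.1 patch_subset_closure
  let T : VHspace Ω K →ₗ[ℝ] Lp ℝ 2 ν :=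
    { toFun := fun w => (hL w).toLp
      map_add' := fun w z => MemLp.toLp_add (hL w) (hL z)
      map_smul' := fun a w => MemLp.toLp_const_smul a (hL w) }
  have := hK.finiteDimensional
  have hfd : FiniteDimensional ℝ (LinearMap.range T) := inferInstance
  obtain ⟨p, hp⟩ := (LinearMap.mem_range).1 ((LinearMap.range T).starProjection_apply_mem (hu.toLp u))
  refine ⟨p.1, p.2, fun w hw => ?_⟩
  have h1 : inner ℝ (hu.toLp u - T p) (T ⟨w, hw⟩) = 0 := by
    rw [hp]
    exact Submodule.starProjection_inner_eq_zero _ _ ⟨_, rfl⟩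
  rw [inner_sub_left, sub_eq_zero, L2.inner_def, L2.inner_def] at h1
  have h2 : ∫ x, u x * w x ∂ν = ∫ x, inner ℝ (hu.toLp u x) (T ⟨w, hw⟩ x) ∂ν := by
    refine integral_congr_ae ?_
    filter_upwards [hu.coeFn_toLp, (hL ⟨w, hw⟩).coeFn_toLp] with x hx hx'
    rw [hx, show (T ⟨w, hw⟩ : E d → ℝ) x = w x from hx']
    simp [mul_comm]
  have h3 : ∫ x, p.1 x * w x ∂ν = ∫ x, inner ℝ (T p x) (T ⟨w, hw⟩ x) ∂ν := by
    refine integral_congr_ae ?_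
    filter_upwards [(hL p).coeFn_toLp, (hL ⟨w, hw⟩).coeFn_toLp] with x hx hx'
    rw [show (T p : E d → ℝ) x = p.1 x from hx, show (T ⟨w, hw⟩ : E d → ℝ) x = w x from hx']
    simp [mul_comm]
  rw [h2, h3, h1]

lemma localProj_spec (hΩ : IsLipschitzDomain Ω) (hK : IsMesh Ω κ H K) {v : E d} {u : E d → ℝ}
    (hu : MemLp u 2 ((wMeas Λ β).restrict (patch Ω K v 0))) :
    IsLocalProj Ω K Λ β v u (localProj Ω K Λ β v u) := by
  have h := exists_isLocalProj hΩ hK hu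
  rw [localProj, dif_pos h]
  exact h.choose_spec

lemma lintegral_enorm_sq {ν : Measure (E d)} {f : E d → ℝ} (hf : MemLp f 2 ν) :
    ∫⁻ x, ‖f x‖ₑ ^ 2 ∂ν = ENNReal.ofReal (∫ x, f x * f x ∂ν) := by
  rw [ofReal_integral_eq_lintegral_ofReal]
  · refine lintegral_congr fun x => ?_
    rw [← Real.enorm_of_nonneg (mul_self_nonneg _), enorm_mul, sq]
  · exact hf.integrable_mul hf
  · exact ae_of_all _ fun x => mul_self_nonneg _

/-- The local projections are contractions. -/
lemma IsLocalProj.lintegral_le (hΩ : IsLipschitzDomain Ω) {v : E d} {u p : E d → ℝ}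
    (hu : MemLp u 2 ((wMeas Λ β).restrict (patch Ω K v 0))) (hp : IsLocalProj Ω K Λ β v u p) :
    ∫⁻ x in patch Ω K v 0, ‖p x‖ₑ ^ 2 ∂(wMeas Λ β) ≤
      ∫⁻ x in patch Ω K v 0, ‖u x‖ₑ ^ 2 ∂(wMeas Λ β) := by
  have hpL : MemLp p 2 ((wMeas Λ β).restrict (patch Ω K v 0)) :=
    SH_memLp hΩ hp.1.1 patch_subset_closure
  rw [lintegral_enorm_sq hpL, lintegral_enorm_sq hu]
  refine ENNReal.ofReal_le_ofReal ?_
  have h0 : 0 ≤ ∫ x in patch Ω K v 0, (u x - p x) * (u x - p x) ∂(wMeas Λ β) :=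
    integral_nonneg fun x => mul_self_nonneg _
  have h1 : ∀ x, (u x - p x) * (u x - p x) = u x * u x - 2 * (u x * p x) + p x * p x := fun x => by
    ring
  have h2 : Integrable (fun x => u x * p x) ((wMeas Λ β).restrict (patch Ω K v 0)) :=
    hu.integrable_mul hpL
  have h3 : Integrable (fun x => u x * u x) ((wMeas Λ β).restrict (patch Ω K v 0)) :=
    hu.integrable_mul hu
  have h4 : Integrable (fun x => p x * p x) ((wMeas Λ β).restrict (patch Ω K v 0)) :=
    hpL.integrable_mul hpL
  simp only [h1] at h0
  rw [integral_add (f := fun x => u x * u x - 2 * (u x * p x)) (h3.sub (h2.const_mul 2)) h4,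
    integral_sub h3 (h2.const_mul 2), integral_const_mul, ← hp.2 p hp.1] at h0
  linarith

lemma IsLocalProj.add_smul (hΩ : IsLipschitzDomain Ω) {v : E d} {u w p q : E d → ℝ}
    (hu : MemLp u 2 ((wMeas Λ β).restrict (patch Ω K v 0)))
    (hw : MemLp w 2 ((wMeas Λ β).restrict (patch Ω K v 0))) (hp : IsLocalProj Ω K Λ β v u p)
    (hq : IsLocalProj Ω K Λ β v w q) (a b : ℝ) :
    IsLocalProj Ω K Λ β v (a • u + b • w) (a • p + b • q) := by
  refine ⟨(VHspace Ω K).add_mem ((VHspace Ω K).smul_mem a hp.1) ((VHspace Ω K).smul_mem b hq.1),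
    fun z hz => ?_⟩
  have hz' : MemLp z 2 ((wMeas Λ β).restrict (patch Ω K v 0)) :=
    SH_memLp hΩ hz.1 patch_subset_closure
  have key : ∀ f g : E d → ℝ, MemLp f 2 ((wMeas Λ β).restrict (patch Ω K v 0)) →
      MemLp g 2 ((wMeas Λ β).restrict (patch Ω K v 0)) →
      ∫ x in patch Ω K v 0, (a • f + b • g) x * z x ∂(wMeas Λ β) =
        a * (∫ x in patch Ω K v 0, f x * z x ∂(wMeas Λ β)) +
        b * ∫ x in patch Ω K v 0, g x * z x ∂(wMeas Λ β) := by
    intro f g hf hg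
    have h1 : Integrable (fun x => a * (f x * z x)) ((wMeas Λ β).restrict (patch Ω K v 0)) :=
      (hf.integrable_mul hz').const_mul a
    have h2 : Integrable (fun x => b * (g x * z x)) ((wMeas Λ β).restrict (patch Ω K v 0)) :=
      (hg.integrable_mul hz').const_mul b
    rw [← integral_const_mul, ← integral_const_mul, ← integral_add h1 h2]
    refine integral_congr_ae (ae_of_all _ fun x => ?_)
    simp only [Pi.add_apply, Pi.smul_apply, smul_eq_mul]
    ring
  rw [key p q (SH_memLp hΩ hp.1.1 patch_subset_closure) (SH_memLp hΩ hq.1.1 patch_subset_closure),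
    key u w hu hw, hp.2 z hz, hq.2 z hz]

end Projection

/-! ### Inverse estimates -/

section Mesh

variable {Ω : Set (E d)} {κ H : ℝ} {K : Geometry.SimplicialComplex ℝ (E d)}

lemma SH_abs_le {f : E d → ℝ} (hf : f ∈ SH Ω K) {t : Finset (E d)} (ht : t ∈ elements K) {M : ℝ}
    (hM : ∀ p ∈ t, |f p| ≤ M) {x : E d} (hx : x ∈ convexHull ℝ (t : Set (E d))) : |f x| ≤ M := by
  have hs := isSimplex_of_mem ht
  rw [SH_eq_sum hf ht hx]
  calc |∑ p ∈ t, bary t p x * f p| ≤ ∑ p ∈ t, |bary t p x * f p| :=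
        Finset.abs_sum_le_sum_abs _ _
    _ ≤ ∑ p ∈ t, bary t p x * M := by
        refine Finset.sum_le_sum fun p hp => ?_
        rw [abs_mul, abs_of_nonneg (bary_nonneg hs hx p)]
        exact mul_le_mul_of_nonneg_left (hM p hp) (bary_nonneg hs hx p)
    _ = M := by rw [← Finset.sum_mul, sum_bary hs, one_mul]

/-- The vertex of largest modulus has weight at least 3/4, the others together at most 1/4. -/
lemma SH_half_le_abs {f : E d → ℝ} (hf : f ∈ SH Ω K) {t : Finset (E d)} (ht : t ∈ elements K)
    {q : E d} (hq : q ∈ t) (hM : ∀ p ∈ t, |f p| ≤ |f q|) {x : E d}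
    (hx : x ∈ convexHull ℝ (t : Set (E d))) (hb : 3 / 4 ≤ bary t q x) : |f q| / 2 ≤ |f x| := by
  classical
  have hs := isSimplex_of_mem ht
  have h1 : |∑ p ∈ t.erase q, bary t p x * f p| ≤ (1 - bary t q x) * |f q| := by
    have h2 : ∑ p ∈ t.erase q, bary t p x = 1 - bary t q x := by
      rw [← sum_bary hs x, ← Finset.add_sum_erase t _ hq]
      ring
    rw [← h2, Finset.sum_mul]
    refine (Finset.abs_sum_le_sum_abs _ _).trans (Finset.sum_le_sum fun p hp => ?_)
    rw [abs_mul, abs_of_nonneg (bary_nonneg hs hx p)]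
    exact mul_le_mul_of_nonneg_left (hM p (Finset.mem_of_mem_erase hp)) (bary_nonneg hs hx p)
  rw [SH_eq_sum hf ht hx, ← Finset.add_sum_erase t _ hq]
  have h3 : |bary t q x * f q| = bary t q x * |f q| := by
    rw [abs_mul, abs_of_nonneg (bary_nonneg hs hx q)]
  have h4 := abs_sub_abs_le_abs_sub (bary t q x * f q) (-∑ p ∈ t.erase q, bary t p x * f p)
  rw [abs_neg, sub_neg_eq_add] at h4
  nlinarith [abs_nonneg (f q)]

/-- The constant in the inverse estimates. -/
def invConst (d : ℕ) (κ : ℝ) (A : ℝ≥0) : ℝ≥0∞ :=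
  4 * ENNReal.ofReal (2 * A / ((4 * κ ^ 2)⁻¹ ^ d * (volume (ball (0 : E d) 1)).toReal) ^ 2)

lemma invConst_ne_top (d : ℕ) (κ : ℝ) (A : ℝ≥0) : invConst d κ A ≠ ⊤ := by
  rw [invConst]
  finiteness

/-- The nodal values are bounded by the weighted `L²` norm. -/
lemma AvgBounded.inverse {A : ℝ≥0} {μ : Measure (E d)} (hμ : AvgBounded A μ)
    (hK : IsMesh Ω κ H K) (hd : 0 < d) {f : E d → ℝ} (hf : f ∈ SH Ω K) {t : Finset (E d)}
    (ht : t ∈ elements K) {v : E d} (hv : v ∈ t) :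
    ‖f v‖ₑ ^ 2 * μ (convexHull ℝ (t : Set (E d))) ≤
      invConst d κ A * ∫⁻ x in convexHull ℝ (t : Set (E d)), ‖f x‖ₑ ^ 2 ∂μ := by
  have hs := isSimplex_of_mem ht
  obtain ⟨hH, hκ, c, hc⟩ := hK.exists_ball hd ht
  obtain ⟨q, hq, hM⟩ := t.exists_max_image (fun p => |f p|) ⟨v, hv⟩
  have hqt : q ∈ convexHull ℝ (t : Set (E d)) := subset_convexHull ℝ _ hq
  set Y := convexHull ℝ (t : Set (E d)) ∩ {x | 3 / 4 ≤ bary t q x} with hY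
  have hYm : MeasurableSet Y := (measurableSet_convexHull t).inter
    (measurableSet_le measurable_const (continuous_affine _).measurable)
  -- The homothety with centre `q` and ratio 1/4 maps the element into `Y`, and the inscribed ball
  -- onto this ball.
  have hball : closedBall (q + (1 / 4 : ℝ) • (c - q)) (H / κ ^ 2 / 4) ⊆ Y := by
    intro y hy
    set z := q + (4 : ℝ) • (y - q) with hz
    have hzt : z ∈ convexHull ℝ (t : Set (E d)) := by
      refine hc ?_
      rw [mem_closedBall, dist_eq_norm] at hy ⊢
      have : z - c = (4 : ℝ) • (y - (q + (1 / 4 : ℝ) • (c - q))) := by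
        rw [hz]
        module
      rw [this, norm_smul, Real.norm_of_nonneg (by norm_num)]
      linarith
    have hyz : y = AffineMap.lineMap q z (1 / 4 : ℝ) := by
      rw [AffineMap.lineMap_apply, vsub_eq_sub, vadd_eq_add, hz]
      module
    constructor
    · rw [hyz, AffineMap.lineMap_apply, vsub_eq_sub, vadd_eq_add, add_comm]
      exact (convex_convexHull ℝ _).add_smul_sub_mem hqt hzt (by norm_num)
    · rw [mem_ofPred_eq, hyz, AffineMap.apply_lineMap, AffineMap.lineMap_apply, bary_self hs hq]
      simp only [vsub_eq_sub, smul_eq_mul, vadd_eq_add]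
      linarith [bary_nonneg hs hzt q]
  set V := (volume (ball (0 : E d) 1)).toReal with hV
  have hV0 : 0 < V := ENNReal.toReal_pos (measure_ball_pos volume 0 one_pos).ne'
    measure_ball_lt_top.ne
  have hvol : ENNReal.ofReal ((4 * κ ^ 2)⁻¹ ^ d * V * H ^ d) ≤ volume Y := by
    refine le_trans ?_ (measure_mono hball)
    rw [Measure.addHaar_closedBall volume _ (by positivity), finrank_euclideanSpace,
      Fintype.card_fin, ← ENNReal.ofReal_toReal (measure_ball_lt_top (μ := volume)
        (x := (0 : E d)) (r := 1)).ne, ← ENNReal.ofReal_mul (by positivity)]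
    refine ENNReal.ofReal_le_ofReal (le_of_eq ?_)
    rw [← hV, show H / κ ^ 2 / 4 = (4 * κ ^ 2)⁻¹ * H by field_simp, mul_pow]
    ring
  -- A doubling property: `Y` carries a fixed share of the measure of the element.
  have h1 : volume Y ^ 2 * μ (convexHull ℝ (t : Set (E d))) ≤
      2 * (A * ENNReal.ofReal H ^ (2 * d)) * μ Y :=
    (hμ.measure_le hH (measurableSet_convexHull t) hYm fun x hx y hy =>
      mem_closedBall.2 (hK.dist_le ht hy.1 hx)).trans
      (mul_le_mul_left (le_mul_of_one_le_left' (by norm_num)) _)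
  have h2 := sq_cancel (by positivity) hH hvol h1
  have h3 : ‖f q‖ₑ ^ 2 * μ Y ≤ 4 * ∫⁻ x in convexHull ℝ (t : Set (E d)), ‖f x‖ₑ ^ 2 ∂μ := by
    calc ‖f q‖ₑ ^ 2 * μ Y = ∫⁻ _x in Y, ‖f q‖ₑ ^ 2 ∂μ := by rw [setLIntegral_const]
      _ ≤ ∫⁻ x in Y, 4 * ‖f x‖ₑ ^ 2 ∂μ := by
          refine setLIntegral_mono' hYm fun x hx => ?_
          have h := SH_half_le_abs hf ht hq hM hx.1 hx.2
          have h5 : ‖f q‖ₑ ≤ 2 * ‖f x‖ₑ := by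
            rw [← ofReal_norm, ← ofReal_norm, ← ENNReal.ofReal_ofNat,
              ← ENNReal.ofReal_mul (by norm_num), Real.norm_eq_abs, Real.norm_eq_abs]
            exact ENNReal.ofReal_le_ofReal (by linarith)
          calc _ ≤ (2 * ‖f x‖ₑ) ^ 2 := by gcongr
            _ = _ := by ring
      _ = 4 * ∫⁻ x in Y, ‖f x‖ₑ ^ 2 ∂μ := lintegral_const_mul' _ _ (by norm_num)
      _ ≤ _ := by gcongr; exact inter_subset_left
  have h4 : ‖f v‖ₑ ≤ ‖f q‖ₑ := by
    rw [← ofReal_norm, ← ofReal_norm]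
    exact ENNReal.ofReal_le_ofReal (hM v hv)
  calc _ ≤ ‖f q‖ₑ ^ 2 * (ENNReal.ofReal (2 * A / ((4 * κ ^ 2)⁻¹ ^ d * V) ^ 2) * μ Y) := by
        gcongr
    _ = ENNReal.ofReal (2 * A / ((4 * κ ^ 2)⁻¹ ^ d * V) ^ 2) * (‖f q‖ₑ ^ 2 * μ Y) := by ring
    _ ≤ ENNReal.ofReal (2 * A / ((4 * κ ^ 2)⁻¹ ^ d * V) ^ 2) * (4 * _) := by gcongr
    _ = _ := by rw [invConst]; ring

/-- The gradient of a finite element function in the interior of an element. -/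
lemma SH_fderiv_eq {f : E d → ℝ} {t : Finset (E d)} {F : E d →ᵃ[ℝ] ℝ}
    (hF : ∀ x ∈ convexHull ℝ (t : Set (E d)), f x = F x) {x : E d}
    (hx : x ∈ interior (convexHull ℝ (t : Set (E d)))) :
    HasFDerivAt f (LinearMap.toContinuousLinearMap F.linear) x := by
  have h1 : HasFDerivAt (fun y => LinearMap.toContinuousLinearMap F.linear y + F 0)
      (LinearMap.toContinuousLinearMap F.linear) x :=
    (LinearMap.toContinuousLinearMap F.linear).hasFDerivAt.add_const _
  refine h1.congr_of_eventuallyEq ?_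
  filter_upwards [isOpen_interior.mem_nhds hx] with y hy
  rw [hF y (interior_subset hy)]
  have := congrFun F.decomp y
  simpa using this

lemma SH_enorm_gradient_le (hK : IsMesh Ω κ H K) (hd : 0 < d) {f : E d → ℝ} (hf : f ∈ SH Ω K)
    {t : Finset (E d)} (ht : t ∈ elements K) {M : ℝ} (hM : ∀ p ∈ t, |f p| ≤ M) {x : E d}
    (hx : x ∈ interior (convexHull ℝ (t : Set (E d)))) :
    ENNReal.ofReal H * ‖gradient f x‖ₑ ≤ ENNReal.ofReal (κ ^ 2) * ENNReal.ofReal M := by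
  obtain ⟨hH, hκ, c, hc⟩ := hK.exists_ball hd ht
  obtain ⟨F, hF⟩ := hf.2.2 t ht
  have hM0 : 0 ≤ M := (abs_nonneg _).trans (SH_abs_le hf ht hM (interior_subset hx))
  have h1 : ‖fderiv ℝ f x‖ ≤ 2 * M / (2 * (H / κ ^ 2)) := by
    rw [(SH_fderiv_eq hF hx).fderiv]
    refine ContinuousLinearMap.opNorm_le_bound _ (by positivity) fun v => ?_
    refine abs_linear_le (c := c) (by positivity) (fun y hy z hz => ?_) v
    rw [← hF y (hc hy), ← hF z (hc hz)]
    have h2 := abs_le.1 (SH_abs_le hf ht hM (hc hy))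
    have h3 := abs_le.1 (SH_abs_le hf ht hM (hc hz))
    rw [abs_le]
    constructor <;> linarith
  rw [enorm_gradient, ← ofReal_norm, ← ENNReal.ofReal_mul hH.le, ← ENNReal.ofReal_mul (by positivity)]
  refine ENNReal.ofReal_le_ofReal ?_
  calc H * ‖fderiv ℝ f x‖ ≤ H * (2 * M / (2 * (H / κ ^ 2))) := by gcongr
    _ = κ ^ 2 * M := by field_simp

lemma ae_interior {μ : Measure (E d)} (hμv : μ ≪ volume) (t : Finset (E d)) :
    ∀ᵐ x ∂μ, x ∈ convexHull ℝ (t : Set (E d)) → x ∈ interior (convexHull ℝ (t : Set (E d))) := by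
  have h : μ (frontier (convexHull ℝ (t : Set (E d)))) = 0 := hμv (volume_frontier_convexHull t)
  rw [(isClosed_convexHull t).frontier_eq] at h
  filter_upwards [measure_eq_zero_iff_ae_notMem.1 h] with x hx hxt
  by_contra hxi
  exact hx ⟨hxt, hxi⟩

/-- Bounds on an element by the nodal values. -/
lemma SH_lintegral_le (hK : IsMesh Ω κ H K) (hd : 0 < d) {μ : Measure (E d)} (hμv : μ ≪ volume)
    {f : E d → ℝ} (hf : f ∈ SH Ω K) {t : Finset (E d)} (ht : t ∈ elements K) {Q : ℝ≥0∞}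
    (hQ : ∀ p ∈ t, ‖f p‖ₑ ^ 2 * μ (convexHull ℝ (t : Set (E d))) ≤ Q) :
    ∫⁻ x in convexHull ℝ (t : Set (E d)), ‖f x‖ₑ ^ 2 ∂μ ≤ Q ∧
    ENNReal.ofReal H ^ 2 * ∫⁻ x in convexHull ℝ (t : Set (E d)), ‖gradient f x‖ₑ ^ 2 ∂μ ≤
      ENNReal.ofReal (κ ^ 2) ^ 2 * Q := by
  have hne : t.Nonempty := Finset.card_pos.1 (by rw [ht.2]; omega)
  obtain ⟨q, hq, hM⟩ := t.exists_max_image (fun p => |f p|) hne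
  constructor
  · refine le_trans ?_ (hQ q hq)
    rw [← setLIntegral_const]
    refine setLIntegral_mono' (measurableSet_convexHull t) fun x hx => ?_
    rw [← ofReal_norm, ← ofReal_norm]
    gcongr
    exact SH_abs_le hf ht hM hx
  · calc _ = ∫⁻ x in convexHull ℝ (t : Set (E d)), (ENNReal.ofReal H * ‖gradient f x‖ₑ) ^ 2 ∂μ := by
          rw [← lintegral_const_mul' _ _ (by finiteness)]
          simp only [mul_pow]
      _ ≤ ∫⁻ _x in convexHull ℝ (t : Set (E d)),
            (ENNReal.ofReal (κ ^ 2) * ENNReal.ofReal |f q|) ^ 2 ∂μ := by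
          refine lintegral_mono_ae ?_
          rw [ae_restrict_iff' (measurableSet_convexHull t)]
          filter_upwards [ae_interior hμv t] with x hx hxt
          exact pow_le_pow_left' (SH_enorm_gradient_le hK hd hf ht hM (hx hxt)) 2
      _ = ENNReal.ofReal (κ ^ 2) ^ 2 * (‖f q‖ₑ ^ 2 * μ (convexHull ℝ (t : Set (E d)))) := by
          rw [setLIntegral_const, ← ofReal_norm, Real.norm_eq_abs]
          ring
      _ ≤ _ := by gcongr; exact hQ q hq

/-- Inclusion of patches up to null sets. -/
lemma patch_ae_le (hΩ : IsLipschitzDomain Ω) (hK : IsMesh Ω κ H K) {μ : Measure (E d)}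
    (hμv : μ ≪ volume) {v w : E d} {j k : ℕ} (h : patchElts K v j ⊆ patchElts K w k) :
    patch Ω K v j ≤ᵐ[μ] patch Ω K w k := by
  have h1 : ∀ᵐ x ∂μ, ∀ t ∈ patchElts K w k, x ∈ convexHull ℝ (t : Set (E d)) →
      x ∈ interior (convexHull ℝ (t : Set (E d))) :=
    (ae_ball_iff (hK.elements_finite.subset (patchElts_subset w k)).countable).2
      fun t _ => ae_interior hμv t
  filter_upwards [h1] with x hx hxv
  obtain ⟨t, ht, hxt⟩ := mem_iUnion₂.1 (patch_subset hΩ hK v j hxv)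
  exact interior_subset_patch hΩ hK (h ht) (hx t (h ht) hxt)

lemma setLIntegral_patch_mono (hΩ : IsLipschitzDomain Ω) (hK : IsMesh Ω κ H K) {μ : Measure (E d)}
    (hμv : μ ≪ volume) {v w : E d} {j k : ℕ} (h : patchElts K v j ⊆ patchElts K w k)
    (g : E d → ℝ≥0∞) : ∫⁻ x in patch Ω K v j, g x ∂μ ≤ ∫⁻ x in patch Ω K w k, g x ∂μ :=
  lintegral_mono' (Measure.restrict_mono' (patch_ae_le hΩ hK hμv h) le_rfl) le_rfl

lemma patchElts_zero_subset_one {v p : E d} {t : Finset (E d)} (ht : t ∈ patchElts K v 0)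
    (hp : p ∈ t) : patchElts K p 0 ⊆ patchElts K v 1 :=
  fun s hs => ⟨hs.1, t, ht, p, by classical exact Finset.mem_inter.2 ⟨hs.2, hp⟩⟩

/-! ### The quasi-interpolation operator -/

section Interp

variable {Λ : Set (E d)} {β : ℝ} {A : ℝ≥0}

lemma quasiInterp_eq_sum (hK : IsMesh Ω κ H K) (u : E d → ℝ) :
    quasiInterp Ω K Λ β u = ∑ v ∈ (hK.vertices_finite.inter_of_left Ω).toFinset,
      localProj Ω K Λ β v u v • hat Ω K v := by
  ext x
  rw [quasiInterp, finsum_mem_eq_finite_toFinset_sum _ (hK.vertices_finite.inter_of_left Ω)]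
  simp

lemma quasiInterp_mem_VH (hΩ : IsLipschitzDomain Ω) (hK : IsMesh Ω κ H K) (u : E d → ℝ) :
    quasiInterp Ω K Λ β u ∈ VH Ω K := by
  rw [quasiInterp_eq_sum hK]
  refine (VHspace Ω K).sum_mem fun v hv => (VHspace Ω K).smul_mem _ ?_
  exact hat_mem_VH hΩ hK ((hK.vertices_finite.inter_of_left Ω).mem_toFinset.1 hv).2

lemma quasiInterp_apply (hK : IsMesh Ω κ H K) (u : E d → ℝ) {v : E d} (hv : v ∈ K.vertices)
    (hvΩ : v ∈ Ω) : quasiInterp Ω K Λ β u v = localProj Ω K Λ β v u v := by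
  rw [quasiInterp_eq_sum hK, Finset.sum_apply, Finset.sum_eq_single v]
  · simp [(hat_spec hK v).2 v hv]
  · intro w _ hwv
    simp [(hat_spec hK w).2 v hv, hwv.symm]
  · exact fun h => absurd ((hK.vertices_finite.inter_of_left Ω).mem_toFinset.2 ⟨hv, hvΩ⟩) h

lemma mem_frontier_of_vertex (hΩ : IsLipschitzDomain Ω) (hK : IsMesh Ω κ H K) {v : E d}
    (hv : v ∈ K.vertices) (hvΩ : v ∉ Ω) : v ∈ frontier Ω := by
  rw [hΩ.isOpen.frontier_eq]
  exact ⟨hK.vertex_mem_closure hv, hvΩ⟩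

lemma VH_ext (hΩ : IsLipschitzDomain Ω) (hK : IsMesh Ω κ H K) {f g : E d → ℝ} (hf : f ∈ VH Ω K)
    (hg : g ∈ VH Ω K) (h : ∀ v ∈ K.vertices, v ∈ Ω → f v = g v) : f = g :=
  SH_ext hK hf.1 hg.1 fun v hv => by
    by_cases hvΩ : v ∈ Ω
    · exact h v hv hvΩ
    · have := mem_frontier_of_vertex hΩ hK hv hvΩ
      rw [hf.2 v this, hg.2 v this]

lemma wMeas_absolutelyContinuous : wMeas Λ β ≪ volume := withDensity_absolutelyContinuous _ _

lemma wMeas_convexHull_ne_zero (hvμ : volume ≪ wMeas Λ β) {t : Finset (E d)} (ht : t ∈ elements K) :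
    wMeas Λ β (convexHull ℝ (t : Set (E d))) ≠ 0 := by
  intro h
  exact (isOpen_interior.measure_pos volume (interior_convexHull_nonempty (isSimplex_of_mem ht))).ne'
    (measure_mono_null interior_subset (hvμ h))

/-- The sum of the interior hat functions. -/
lemma exists_cutoff (hΩ : IsLipschitzDomain Ω) (hK : IsMesh Ω κ H K) {v : E d} (hv : closure (patch Ω K v 1) ⊆ Ω) :
    ∃ e ∈ VH Ω K, ∀ t ∈ patchElts K v 1, ∀ x ∈ convexHull ℝ (t : Set (E d)), e x = 1 := by
  set S := (hK.vertices_finite.inter_of_left Ω).toFinset with hS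
  have hmS : ∀ p, p ∈ S ↔ p ∈ K.vertices ∧ p ∈ Ω := fun p =>
    (hK.vertices_finite.inter_of_left Ω).mem_toFinset
  refine ⟨∑ p ∈ S, hat Ω K p, (VHspace Ω K).sum_mem fun p hp =>
    hat_mem_VH hΩ hK ((hmS p).1 hp).2, fun t ht x hx => ?_⟩
  have hte := patchElts_subset v 1 ht
  -- All vertices of the patch are interior nodes, so on the patch the sum is the full partition of
  -- unity.
  have htS : t ⊆ S := fun p hp => by
    refine (hmS p).2 ⟨vertex_of_mem hte hp, hv ?_⟩
    rw [closure_patch hΩ hK]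
    exact mem_biUnion ht (subset_convexHull ℝ _ hp)
  rw [Finset.sum_apply, ← sum_bary (isSimplex_of_mem hte) x, ← Finset.sum_subset htS]
  · exact Finset.sum_congr rfl fun p _ => hat_eq_bary hK p hte hx
  · intro p _ hpt
    rw [hat_eq_bary hK p hte hx, bary_of_notMem hpt]
    rfl

variable [IsLocallyFiniteMeasure (wMeas Λ β)] (hμ : AvgBounded A (wMeas Λ β))
  (hd : 0 < d) (hΩ : IsLipschitzDomain Ω) (hK : IsMesh Ω κ H K) (hvμ : volume ≪ wMeas Λ β)

include hμ hd hΩ hK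

/-- At an interior node: inverse estimate on `t`, contraction of the projection on `ω_p`, and `ω_p ⊆
ω_{v,1}` up to a null set. As `t` belongs to both stars, weights of different elements need not be
compared. At a boundary node the value is 0. -/
lemma quasiInterp_apply_le {u : E d → ℝ} (hu : MemLp u 2 ((wMeas Λ β).restrict Ω)) {v p : E d}
    {t : Finset (E d)} (ht : t ∈ patchElts K v 0) (hp : p ∈ t) :
    ‖quasiInterp Ω K Λ β u p‖ₑ ^ 2 * wMeas Λ β (convexHull ℝ (t : Set (E d))) ≤
      invConst d κ A * ∫⁻ x in patch Ω K v 1, ‖u x‖ₑ ^ 2 ∂(wMeas Λ β) := by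
  have hpv : p ∈ K.vertices := vertex_of_mem ht.1 hp
  by_cases hpΩ : p ∈ Ω
  · have hs : MemLp u 2 ((wMeas Λ β).restrict (patch Ω K p 0)) :=
      hu.mono_measure (Measure.restrict_mono (patch_subset_domain p 0) le_rfl)
    have hq := localProj_spec hΩ hK hs
    rw [quasiInterp_apply hK _ hpv hpΩ]
    refine (hμ.inverse hK hd hq.1.1 ht.1 hp).trans (mul_le_mul_right ?_ _)
    refine (hK.setLIntegral_le_patch hΩ (wMeas_absolutelyContinuous (Λ := Λ) (β := β))
      (v := p) (k := 0) ⟨ht.1, hp⟩ _).trans ((hq.lintegral_le hΩ hs).trans ?_)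
    exact setLIntegral_patch_mono hΩ hK wMeas_absolutelyContinuous
      (patchElts_zero_subset_one ht hp) _
  · rw [(quasiInterp_mem_VH hΩ hK u).2 p (mem_frontier_of_vertex hΩ hK hpv hpΩ)]
    simp

include hvμ

/-- The difference is a projection of 0, hence vanishes in `L²`, and the inverse estimate transfers
this to the nodal value. Linearity and the projection property of the operator rest on this
independence of the choice in `localProj`. -/
lemma IsLocalProj.apply_unique {v : E d} (hv : v ∈ K.vertices) {u p q : E d → ℝ}
    (hu : MemLp u 2 ((wMeas Λ β).restrict (patch Ω K v 0))) (hp : IsLocalProj Ω K Λ β v u p)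
    (hq : IsLocalProj Ω K Λ β v u q) : p v = q v := by
  have h := hp.add_smul hΩ hu hu hq 1 (-1)
  have h0 : MemLp ((1 : ℝ) • u + (-1 : ℝ) • u) 2 ((wMeas Λ β).restrict (patch Ω K v 0)) := by
    simp
  have h1 := h.lintegral_le hΩ h0
  obtain ⟨t, ht, hvt⟩ := hK.exists_mem_of_vertex hv
  have h2 := hμ.inverse hK hd h.1.1 ht hvt
  have h3 := hK.setLIntegral_le_patch hΩ (wMeas_absolutelyContinuous (Λ := Λ) (β := β))
    (v := v) (k := 0) ⟨ht, hvt⟩ fun x => ‖((1 : ℝ) • p + (-1 : ℝ) • q) x‖ₑ ^ 2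
  have h4 : ∫⁻ x in patch Ω K v 0, ‖((1 : ℝ) • u + (-1 : ℝ) • u) x‖ₑ ^ 2 ∂(wMeas Λ β) = 0 := by
    simp
  rw [h4] at h1
  rw [le_antisymm (h3.trans h1) bot_le, mul_zero, nonpos_iff_eq_zero, mul_eq_zero] at h2
  have h5 := h2.resolve_right (wMeas_convexHull_ne_zero hvμ ht)
  simp only [ne_eq, OfNat.ofNat_ne_zero, not_false_eq_true, pow_eq_zero_iff, enorm_eq_zero] at h5
  simp only [one_smul, neg_smul, Pi.add_apply, Pi.neg_apply] at h5
  linarith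

lemma quasiInterp_add_smul {u w : E d → ℝ} (hu : MemLp u 2 ((wMeas Λ β).restrict Ω))
    (hw : MemLp w 2 ((wMeas Λ β).restrict Ω)) (a b : ℝ) :
    quasiInterp Ω K Λ β (a • u + b • w) =
      a • quasiInterp Ω K Λ β u + b • quasiInterp Ω K Λ β w := by
  refine VH_ext hΩ hK (quasiInterp_mem_VH hΩ hK _) ((VHspace Ω K).add_mem
    ((VHspace Ω K).smul_mem a (quasiInterp_mem_VH hΩ hK u))
    ((VHspace Ω K).smul_mem b (quasiInterp_mem_VH hΩ hK w))) fun v hv hvΩ => ?_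
  have hr : ∀ {f : E d → ℝ}, MemLp f 2 ((wMeas Λ β).restrict Ω) →
      MemLp f 2 ((wMeas Λ β).restrict (patch Ω K v 0)) := fun hf =>
    hf.mono_measure (Measure.restrict_mono (patch_subset_domain v 0) le_rfl)
  rw [Pi.add_apply, Pi.smul_apply, Pi.smul_apply, quasiInterp_apply hK _ hv hvΩ,
    quasiInterp_apply hK _ hv hvΩ, quasiInterp_apply hK _ hv hvΩ]
  have hs : MemLp (a • u + b • w) 2 ((wMeas Λ β).restrict (patch Ω K v 0)) :=
    ((hr hu).const_smul a).add ((hr hw).const_smul b)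
  exact IsLocalProj.apply_unique hμ hd hΩ hK hvμ hv hs (localProj_spec hΩ hK hs)
    ((localProj_spec hΩ hK (hr hu)).add_smul hΩ (hr hu) (hr hw) (localProj_spec hΩ hK (hr hw)) a b)

lemma quasiInterp_eq_self {u : E d → ℝ} (hu : u ∈ VH Ω K) : quasiInterp Ω K Λ β u = u := by
  refine VH_ext hΩ hK (quasiInterp_mem_VH hΩ hK _) hu fun v hv hvΩ => ?_
  rw [quasiInterp_apply hK _ hv hvΩ]
  have hs : MemLp u 2 ((wMeas Λ β).restrict (patch Ω K v 0)) :=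
    SH_memLp hΩ hu.1 patch_subset_closure
  exact IsLocalProj.apply_unique hμ hd hΩ hK hvμ hv hs (localProj_spec hΩ hK hs)
    ⟨hu, fun w _ => rfl⟩

/-- Constants are not in `V_H`, but for a patch inside `Ω` some `e ∈ V_H` equals 1 on `ω_{v,1}`. The
operator reproduces `e`, so on `t` the function `I u - c` is `I (u - c e)`, to which the bound with
constant 0 applies. -/
lemma quasiInterp_element_le {u : E d → ℝ} (hu : MemLp u 2 ((wMeas Λ β).restrict Ω)) {v : E d}
    {c : ℝ} (hc : c = 0 ∨ closure (patch Ω K v 1) ⊆ Ω) {t : Finset (E d)}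
    (ht : t ∈ patchElts K v 0) :
    ∫⁻ x in convexHull ℝ (t : Set (E d)), ‖quasiInterp Ω K Λ β u x - c‖ₑ ^ 2 ∂(wMeas Λ β) ≤
      invConst d κ A * ∫⁻ x in patch Ω K v 1, ‖u x - c‖ₑ ^ 2 ∂(wMeas Λ β) ∧
    ENNReal.ofReal H ^ 2 * ∫⁻ x in convexHull ℝ (t : Set (E d)),
      ‖gradient (quasiInterp Ω K Λ β u) x‖ₑ ^ 2 ∂(wMeas Λ β) ≤
      ENNReal.ofReal (κ ^ 2) ^ 2 *
        (invConst d κ A * ∫⁻ x in patch Ω K v 1, ‖u x - c‖ₑ ^ 2 ∂(wMeas Λ β)) := by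
  rcases hc with rfl | hc
  · simp only [sub_zero]
    exact SH_lintegral_le hK hd wMeas_absolutelyContinuous (quasiInterp_mem_VH hΩ hK u).1 ht.1
      fun p hp => quasiInterp_apply_le hμ hd hΩ hK hu ht hp
  · obtain ⟨e, he, he1⟩ := exists_cutoff hΩ hK hc
    have heL : MemLp e 2 ((wMeas Λ β).restrict Ω) := SH_memLp hΩ he.1 subset_closure
    have hw : MemLp ((1 : ℝ) • u + (-c) • e) 2 ((wMeas Λ β).restrict Ω) :=
      (hu.const_smul (1 : ℝ)).add (heL.const_smul (-c))
    have hlin := quasiInterp_add_smul hμ hd hΩ hK hvμ hu heL 1 (-c)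
    rw [quasiInterp_eq_self hμ hd hΩ hK hvμ he] at hlin
    have ht1 := patchElts_subset_succ v 0 ht
    have hval : ∀ x ∈ convexHull ℝ (t : Set (E d)),
        quasiInterp Ω K Λ β ((1 : ℝ) • u + (-c) • e) x = quasiInterp Ω K Λ β u x - c := by
      intro x hx
      rw [hlin]
      simp [he1 t ht1 x hx, sub_eq_add_neg]
    have hint : ∫⁻ x in patch Ω K v 1, ‖((1 : ℝ) • u + (-c) • e) x‖ₑ ^ 2 ∂(wMeas Λ β) =
        ∫⁻ x in patch Ω K v 1, ‖u x - c‖ₑ ^ 2 ∂(wMeas Λ β) := by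
      refine setLIntegral_congr_fun (isOpen_interior.inter hΩ.isOpen).measurableSet fun x hx => ?_
      obtain ⟨s, hs, hxs⟩ := mem_iUnion₂.1 (patch_subset hΩ hK v 1 hx)
      simp [he1 s hs x hxs, sub_eq_add_neg]
    have h := SH_lintegral_le hK hd (wMeas_absolutelyContinuous (Λ := Λ) (β := β))
      (quasiInterp_mem_VH hΩ hK ((1 : ℝ) • u + (-c) • e)).1 ht.1
      fun p hp => quasiInterp_apply_le hμ hd hΩ hK hw ht hp
    rw [hint] at h
    refine ⟨(le_of_eq ?_).trans h.1, (mul_le_mul_right (le_of_eq ?_) _).trans h.2⟩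
    · exact setLIntegral_congr_fun (measurableSet_convexHull t) fun x hx => by
        simp only [hval x hx]
    · refine lintegral_congr_ae ?_
      rw [Filter.EventuallyEq, ae_restrict_iff' (measurableSet_convexHull t)]
      filter_upwards [ae_interior (wMeas_absolutelyContinuous (Λ := Λ) (β := β)) t] with x hx hxt
      have h1 : quasiInterp Ω K Λ β ((1 : ℝ) • u + (-c) • e) =ᶠ[nhds x]
          fun y => quasiInterp Ω K Λ β u y - c := by
        filter_upwards [isOpen_interior.mem_nhds (hx hxt)] with y hy
        exact hval y (interior_subset hy)
      rw [enorm_gradient, enorm_gradient, h1.fderiv_eq, fderiv_sub_const]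

end Interp

end Mesh

/-- Local stability of the quasi-interpolation, with a constant that depends only on the shape
regularity and on the weight. -/
lemma exists_quasiInterp_stable (hd : 0 < d) (κ : ℝ) (A : ℝ≥0) : ∃ C : ℝ≥0,
    ∀ (Ω : Set (E d)) (H : ℝ) (K : Geometry.SimplicialComplex ℝ (E d)) (Λ : Set (E d)) (β : ℝ)
      [IsLocallyFiniteMeasure (wMeas Λ β)], AvgBounded A (wMeas Λ β) → volume ≪ wMeas Λ β →
      IsLipschitzDomain Ω → IsMesh Ω κ H K → ∀ v ∈ K.vertices, ∀ u : E d → ℝ,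
      MemLp u 2 ((wMeas Λ β).restrict Ω) → ∀ c : ℝ, (c = 0 ∨ closure (patch Ω K v 1) ⊆ Ω) →
      ∫⁻ x in patch Ω K v 0, ‖quasiInterp Ω K Λ β u x - c‖ₑ ^ 2 ∂(wMeas Λ β) ≤
        C * ∫⁻ x in patch Ω K v 1, ‖u x - c‖ₑ ^ 2 ∂(wMeas Λ β) ∧
      ENNReal.ofReal H ^ 2 * ∫⁻ x in patch Ω K v 0,
        ‖gradient (quasiInterp Ω K Λ β u) x‖ₑ ^ 2 ∂(wMeas Λ β) ≤
        C * ∫⁻ x in patch Ω K v 1, ‖u x - c‖ₑ ^ 2 ∂(wMeas Λ β) := by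
  classical
  set N : ℕ := ⌈(((0 : ℕ) + 1) * κ ^ 2) ^ d⌉₊
  set k : ℝ≥0∞ := (1 + ENNReal.ofReal (κ ^ 2) ^ 2) * invConst d κ A with hk
  have hfin : N * k ≠ ⊤ := by
    have := invConst_ne_top d κ A
    rw [hk]
    finiteness
  refine ⟨(N * k).toNNReal, ?_⟩
  intro Ω H K Λ β _ hμ hvμ hΩ hK v hv u hu c hc
  rw [ENNReal.coe_toNNReal hfin]
  have hSfin : (patchElts K v 0).Finite := hK.elements_finite.subset (patchElts_subset v 0)
  set S := hSfin.toFinset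
  have hS : ∀ t, t ∈ S ↔ t ∈ patchElts K v 0 := fun t => hSfin.mem_toFinset
  have hcard : S.card ≤ N := by
    have := card_patchElts_le hK hd (S := S) fun t ht => (hS t).1 ht
    exact (Nat.cast_le (α := ℝ)).1 (this.trans (Nat.le_ceil _))
  set Q := ∫⁻ x in patch Ω K v 1, ‖u x - c‖ₑ ^ 2 ∂(wMeas Λ β)
  have hsum : ∀ (g : E d → ℝ≥0∞), (∀ t ∈ S, ∫⁻ x in convexHull ℝ (t : Set (E d)), g x ∂(wMeas Λ β) ≤
      k * Q) → ∫⁻ x in patch Ω K v 0, g x ∂(wMeas Λ β) ≤ N * k * Q := by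
    intro g hg
    calc _ ≤ ∑ t ∈ S, ∫⁻ x in convexHull ℝ (t : Set (E d)), g x ∂(wMeas Λ β) :=
          hK.setLIntegral_patch_le hΩ hS g
      _ ≤ S.card • (k * Q) := Finset.sum_le_card_nsmul _ _ _ hg
      _ = S.card * (k * Q) := nsmul_eq_mul _ _
      _ ≤ N * (k * Q) := by gcongr
      _ = _ := (mul_assoc _ _ _).symm
  constructor
  · refine hsum _ fun t ht => ?_
    refine (quasiInterp_element_le hμ hd hΩ hK hvμ hu hc ((hS t).1 ht)).1.trans ?_
    gcongr
    rw [hk]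
    exact le_mul_of_one_le_left' le_self_add
  · rw [← lintegral_const_mul' _ _ (by finiteness)]
    refine hsum _ fun t ht => ?_
    rw [lintegral_const_mul' _ _ (by finiteness)]
    refine (quasiInterp_element_le hμ hd hΩ hK hvμ hu hc ((hS t).1 ht)).2.trans ?_
    rw [hk, mul_assoc]
    gcongr
    exact le_add_self

/-! ### Lipschitz continuity of the finite element functions -/

/-- A function on a segment that is Lipschitz on each set of a finite closed cover. -/
lemma sub_le_of_closed_cover {ι : Type*} [Finite ι] {s : ι → Set ℝ} (hs : ∀ i, IsClosed (s i))
    (hcov : ⋃ i, s i = univ) {g : ℝ → ℝ} {M : ℝ}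
    (hg : ∀ i, ∀ x ∈ s i, ∀ y ∈ s i, |g x - g y| ≤ M * |x - y|) : g 1 - g 0 ≤ M := by
  have hcont : Continuous g := by
    refine (locallyFinite_of_finite s).continuous hcov hs fun i => ?_
    refine (LipschitzOnWith.of_dist_le_mul (K := M.toNNReal) fun x hx y hy => ?_).continuousOn
    rw [Real.dist_eq, Real.dist_eq]
    refine (hg i x hx y hy).trans ?_
    gcongr
    exact Real.le_coe_toNNReal M
  -- Growth is controlled by right slopes. Near `x` only sets of the finite closed cover that
  -- contain `x` matter, and on each of them the slope from `x` is at most `M`.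
  have h := image_le_of_liminf_slope_right_le_deriv_boundary (f := g) (a := 0) (b := 1)
    hcont.continuousOn (B := fun x => g 0 + M * x) (B' := fun _ => M) (by simp)
    (by fun_prop) (fun x _ => by
      simpa using ((hasDerivAt_id x).const_mul M).const_add (g 0) |>.hasDerivWithinAt)
    (fun x _ r hr => by
      by_contra hcon
      rw [Filter.not_frequently] at hcon
      have h1 : ∀ i, ∀ᶠ z in nhdsWithin x (Ioi x), z ∉ s i := by
        intro i
        by_cases hx : x ∈ s i
        · filter_upwards [hcon, self_mem_nhdsWithin] with z hz hxz hzs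
          refine hz (lt_of_le_of_lt ?_ hr)
          have hpos : 0 < z - x := sub_pos.2 hxz
          rw [slope_def_field, div_le_iff₀ hpos, ← abs_of_pos hpos]
          exact (le_abs_self _).trans (hg i z hzs x hx)
        · exact mem_nhdsWithin_of_mem_nhds ((hs i).isOpen_compl.mem_nhds hx)
      obtain ⟨z, hz⟩ := (Filter.eventually_all.2 h1).exists
      obtain ⟨i, hi⟩ := mem_iUnion.1 (hcov.symm ▸ mem_univ z)
      exact hz i hi) (right_mem_Icc.2 zero_le_one)
  linarith

lemma lipschitzWith_of_closed_cover {F : Type*} [NormedAddCommGroup F] [NormedSpace ℝ F]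
    {ι : Type*} [Finite ι] {s : ι → Set F} (hs : ∀ i, IsClosed (s i))
    (hcov : ⋃ i, s i = univ) {f : F → ℝ} {M : ℝ≥0} (hf : ∀ i, LipschitzOnWith M f (s i)) :
    LipschitzWith M f := by
  refine LipschitzWith.of_le_add_mul M fun x y => ?_
  have h := sub_le_of_closed_cover (s := fun i => (fun t : ℝ => y + t • (x - y)) ⁻¹' s i)
    (g := fun t => f (y + t • (x - y))) (M := M * dist x y)
    (fun i => (hs i).preimage (by fun_prop)) (by rw [← preimage_iUnion, hcov, preimage_univ])
    (fun i a ha b hb => by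
      have := (hf i).dist_le_mul _ ha _ hb
      rw [Real.dist_eq, dist_eq_norm] at this
      refine this.trans (le_of_eq ?_)
      rw [add_sub_add_left_eq_sub, ← sub_smul, norm_smul, dist_eq_norm, Real.norm_eq_abs]
      ring)
  simp only [one_smul, zero_smul, add_zero, add_sub_cancel] at h
  linarith

section Mesh

variable {Ω : Set (E d)} {κ H : ℝ} {K : Geometry.SimplicialComplex ℝ (E d)}

lemma VH_eq_zero (hΩ : IsLipschitzDomain Ω) {f : E d → ℝ} (hf : f ∈ VH Ω K) {x : E d}
    (hx : x ∉ Ω) : f x = 0 := by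
  by_cases h : x ∈ closure Ω
  · exact hf.2 x (by rw [hΩ.isOpen.frontier_eq]; exact ⟨h, hx⟩)
  · exact hf.1.2.1 x h

/-- The elements and the complement of `Ω`, where `f` is 0, form a finite closed cover. Global
Lipschitz continuity makes Rademacher's theorem available for the weak gradient. -/
lemma VH_lipschitz (hΩ : IsLipschitzDomain Ω) (hK : IsMesh Ω κ H K) {f : E d → ℝ}
    (hf : f ∈ VH Ω K) : ∃ M : ℝ≥0, LipschitzWith M f := by
  choose! F hF using hf.1.2.2
  have hfin : Finite (elements K) := hK.elements_finite
  obtain ⟨M, hM⟩ : ∃ M : ℝ≥0, ∀ t ∈ elements K,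
      ‖LinearMap.toContinuousLinearMap (F t).linear‖₊ ≤ M := by
    obtain ⟨M, hM⟩ := (hK.elements_finite.image fun t =>
      ‖LinearMap.toContinuousLinearMap (F t).linear‖₊).bddAbove
    exact ⟨M, fun t ht => hM (mem_image_of_mem _ ht)⟩
  refine ⟨M, lipschitzWith_of_closed_cover
    (s := fun o : Option (elements K) => o.elim Ωᶜ fun t => convexHull ℝ ((t : Finset (E d)) : Set (E d)))
    ?_ ?_ ?_⟩
  · rintro (_ | t)
    · exact hΩ.isOpen.isClosed_compl
    · exact isClosed_convexHull _
  · refine eq_univ_of_forall fun x => ?_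
    rw [mem_iUnion]
    by_cases hx : x ∈ Ω
    · obtain ⟨t, ht, hxt⟩ := hK.exists_mem_of_mem_closure (subset_closure hx)
      exact ⟨some ⟨t, ht⟩, hxt⟩
    · exact ⟨none, hx⟩
  · rintro (_ | ⟨t, ht⟩)
    · refine LipschitzOnWith.of_dist_le_mul fun x hx y hy => ?_
      rw [VH_eq_zero hΩ hf hx, VH_eq_zero hΩ hf hy, dist_self]
      positivity
    · refine LipschitzOnWith.of_dist_le_mul fun x hx y hy => ?_
      rw [hF t ht x hx, hF t ht y hy, dist_eq_norm, dist_eq_norm, ← vsub_eq_sub,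
        ← (F t).linearMap_vsub, vsub_eq_sub]
      exact ((LinearMap.toContinuousLinearMap (F t).linear).le_opNorm _).trans
        (mul_le_mul_of_nonneg_right (hM t ht) (norm_nonneg _))

end Mesh

/-! ### Weak gradients -/

section WeakGrad

variable {Ω : Set (E d)}

lemma measurable_gradient (f : E d → ℝ) : Measurable (gradient f) :=
  (InnerProductSpace.toDual ℝ (E d)).symm.continuous.measurable.comp (measurable_fderiv ℝ f)

lemma norm_gradient (f : E d → ℝ) (x : E d) : ‖gradient f x‖ = ‖fderiv ℝ f x‖ := by
  rw [gradient, LinearIsometryEquiv.norm_map]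

lemma setIntegral_eq_integral_of_isTest {F : Type*} [NormedAddCommGroup F] [NormedSpace ℝ F]
    {φ : E d → ℝ} (hφ : IsTest Ω φ) {h : E d → F} (hh : ∀ x ∉ tsupport φ, h x = 0) :
    ∫ x in Ω, h x = ∫ x, h x :=
  setIntegral_eq_integral_of_forall_compl_eq_zero fun x hx => hh x fun h' => hx (hφ.2.2 h')

lemma fderiv_eq_zero_of_notMem {φ : E d → ℝ} {x : E d} (hx : x ∉ tsupport φ) : fderiv ℝ φ x = 0 :=
  image_eq_zero_of_notMem_tsupport fun h => hx (tsupport_fderiv_subset ℝ h)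

lemma LipschitzWith.locallyIntegrable_gradient {f : E d → ℝ} {M : ℝ≥0} (hf : LipschitzWith M f) :
    LocallyIntegrable (gradient f) :=
  (locallyIntegrable_const (M : ℝ)).mono (measurable_gradient f).aestronglyMeasurable
    (ae_of_all _ fun x => by
      rw [norm_gradient]
      exact (norm_fderiv_le_of_lipschitz ℝ hf).trans (le_abs_self _))

/-- Rademacher's theorem: the gradient of a Lipschitz function is its weak gradient. -/
lemma LipschitzWith.hasWeakGrad {f : E d → ℝ} {M : ℝ≥0} (hf : LipschitzWith M f) :
    HasWeakGrad Ω f (gradient f) := by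
  refine ⟨hf.continuous.locallyIntegrable.locallyIntegrableOn _,
    (LipschitzWith.locallyIntegrable_gradient hf).locallyIntegrableOn _, fun φ hφ e => ?_⟩
  obtain ⟨D, hD⟩ := ContDiff.lipschitzWith_of_hasCompactSupport hφ.2.1 hφ.1 (by simp)
  rw [setIntegral_eq_integral_of_isTest hφ, setIntegral_eq_integral_of_isTest hφ]
  · have h := LipschitzWith.integral_lineDeriv_mul_eq (μ := volume) hf hD hφ.2.1 e
    have h1 : ∫ x, inner ℝ (gradient f x) e * φ x = ∫ x, lineDeriv ℝ f x e * φ x := by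
      refine integral_congr_ae ?_
      filter_upwards [hf.ae_differentiableAt (μ := volume)] with x hx
      rw [hx.lineDeriv_eq_fderiv, inner_gradient_left]
    rw [h1, h, ← integral_neg]
    congr 1 with x
    rw [(hφ.1.differentiable (by simp) x).lineDeriv_eq_fderiv, map_neg]
    ring
  · intro x hx
    rw [image_eq_zero_of_notMem_tsupport hx, mul_zero]
  · intro x hx
    simp [fderiv_eq_zero_of_notMem hx]

lemma integrableOn_mul_of_isTest {F : Type*} [NormedAddCommGroup F] [NormedSpace ℝ F]
    {h : E d → F} (hh : LocallyIntegrableOn h Ω) {ψ : E d → ℝ}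
    (hψ : Continuous ψ) (hc : HasCompactSupport ψ) (hs : tsupport ψ ⊆ Ω) :
    IntegrableOn (fun x => ψ x • h x) Ω := by
  have h1 : IntegrableOn (fun x => ψ x • h x) (tsupport ψ) :=
    (hh.integrableOn_compact_subset hs hc).continuousOn_smul hψ.continuousOn hc
  refine (integrableOn_iff_integrable_of_support_subset fun x hx => ?_).1 h1 |>.integrableOn
  by_contra hx'
  exact hx (by simp [image_eq_zero_of_notMem_tsupport hx'])

lemma IsTest.fderiv_apply {φ : E d → ℝ} (hφ : IsTest Ω φ) (e : E d) :
    Continuous (fun x => fderiv ℝ φ x e) ∧ HasCompactSupport (fun x => fderiv ℝ φ x e) ∧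
      tsupport (fun x => fderiv ℝ φ x e) ⊆ Ω := by
  have hs : Function.support (fun x => fderiv ℝ φ x e) ⊆ tsupport φ := fun x hx => by
    by_contra h
    exact hx (by simp [fderiv_eq_zero_of_notMem h])
  have ht : tsupport (fun x => fderiv ℝ φ x e) ⊆ tsupport φ :=
    closure_minimal hs (isClosed_tsupport _)
  exact ⟨(hφ.1.continuous_fderiv (by simp)).clm_apply continuous_const,
    hφ.2.1.of_isClosed_subset (isClosed_tsupport _) ht, ht.trans hφ.2.2⟩

lemma IsTest.integrableOn_inner {φ : E d → ℝ} (hφ : IsTest Ω φ) {k : E d → E d}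
    (hk : LocallyIntegrableOn k Ω) (e : E d) : IntegrableOn (fun x => inner ℝ (k x) e * φ x) Ω := by
  have h : IntegrableOn (fun x => inner ℝ e (φ x • k x)) Ω :=
    Integrable.const_inner (𝕜 := ℝ) e
      (integrableOn_mul_of_isTest hk hφ.1.continuous hφ.2.1 hφ.2.2)
  refine h.congr (ae_of_all _ fun x => ?_)
  simp only [inner_smul_right]
  rw [real_inner_comm, mul_comm]

lemma HasWeakGrad.add_smul {u w : E d → ℝ} {g h : E d → E d} (hu : HasWeakGrad Ω u g)
    (hw : HasWeakGrad Ω w h) (a b : ℝ) : HasWeakGrad Ω (a • u + b • w) (a • g + b • h) := by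
  refine ⟨(hu.1.smul a).add (hw.1.smul b), (hu.2.1.smul a).add (hw.2.1.smul b), fun φ hφ e => ?_⟩
  obtain ⟨hc, hcs, hts⟩ := hφ.fderiv_apply e
  have h1 := (integrableOn_mul_of_isTest hu.1 hc hcs hts).const_mul a
  have h2 := (integrableOn_mul_of_isTest hw.1 hc hcs hts).const_mul b
  have h3 := (hφ.integrableOn_inner hu.2.1 e).const_mul a
  have h4 := (hφ.integrableOn_inner hw.2.1 e).const_mul b
  have e1 : ∀ x, (a • u + b • w) x * fderiv ℝ φ x e =
      a * (fderiv ℝ φ x e • u x) + b * (fderiv ℝ φ x e • w x) := fun x => by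
    simp only [Pi.add_apply, Pi.smul_apply, smul_eq_mul]
    ring
  have e2 : ∀ x, inner ℝ ((a • g + b • h) x) e * φ x =
      a * (inner ℝ (g x) e * φ x) + b * (inner ℝ (h x) e * φ x) := fun x => by
    simp only [Pi.add_apply, Pi.smul_apply, inner_add_left, real_inner_smul_left]
    ring
  simp only [e1, e2]
  rw [integral_add h1 h2, integral_add h3 h4, integral_const_mul, integral_const_mul,
    integral_const_mul, integral_const_mul]
  have h5 := hu.2.2 φ hφ e
  have h6 := hw.2.2 φ hφ e
  simp only [smul_eq_mul, mul_comm (fderiv ℝ φ _ e)]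
  rw [h5, h6]
  ring

lemma HasWeakGrad.ae_eq (hΩ : IsOpen Ω) {u : E d → ℝ} {g h : E d → E d} (hg : HasWeakGrad Ω u g)
    (hh : HasWeakGrad Ω u h) : g =ᵐ[volume.restrict Ω] h := by
  have hl : LocallyIntegrableOn (g - h) Ω := hg.2.1.sub hh.2.1
  have key := hΩ.ae_eq_zero_of_integral_contDiff_smul_eq_zero hl fun φ h1 h2 h3 => by
    have hφ : IsTest Ω φ := ⟨h1, h2, h3⟩
    rw [← setIntegral_eq_integral_of_isTest hφ fun x hx => by
      rw [image_eq_zero_of_notMem_tsupport hx, zero_smul]]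
    refine ext_inner_left ℝ fun e => ?_
    rw [inner_zero_right, ← integral_inner (integrableOn_mul_of_isTest hl h1.continuous h2 h3)]
    have e1 : ∀ x, inner ℝ e (φ x • (g - h) x) =
        inner ℝ (g x) e * φ x - inner ℝ (h x) e * φ x := fun x => by
      rw [inner_smul_right, Pi.sub_apply, inner_sub_right, real_inner_comm, real_inner_comm (h x)]
      ring
    simp only [e1]
    rw [integral_sub (hφ.integrableOn_inner hg.2.1 e) (hφ.integrableOn_inner hh.2.1 e)]
    have h4 := hg.2.2 φ hφ e
    have h5 := hh.2.2 φ hφ e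
    linarith
  rw [Filter.EventuallyEq, ae_restrict_iff' hΩ.measurableSet]
  filter_upwards [key] with x hx hxΩ
  exact sub_eq_zero.1 (hx hxΩ)

lemma HasWeakGrad.weakGrad_ae_eq (hΩ : IsOpen Ω) {u : E d → ℝ} {g : E d → E d}
    (hg : HasWeakGrad Ω u g) {μ : Measure (E d)} (hμ : μ ≪ volume) :
    weakGrad Ω u =ᵐ[μ.restrict Ω] g := by
  have h : ∃ g, HasWeakGrad Ω u g := ⟨g, hg⟩
  rw [weakGrad, dif_pos h]
  exact (hμ.restrict Ω).ae_eq (h.choose_spec.ae_eq hΩ hg)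

end WeakGrad

/-! ### Mollification in weighted spaces -/

lemma eLpNorm_two_sq {F : Type*} [NormedAddCommGroup F] (ν : Measure (E d)) (g : E d → F) :
    eLpNorm g 2 ν ^ 2 = ∫⁻ x, ‖g x‖ₑ ^ 2 ∂ν := by
  rw [eLpNorm_eq_lintegral_rpow_enorm_toReal two_ne_zero ENNReal.ofNat_ne_top, ← ENNReal.rpow_natCast,
    ← ENNReal.rpow_mul]
  simp

lemma eLpNorm_le_of_sq_le {F G : Type*} [NormedAddCommGroup F] [NormedAddCommGroup G]
    {ν ν' : Measure (E d)} {g : E d → F}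
    {h : E d → G} {C : ℝ≥0∞}
    (hC : ∫⁻ x, ‖g x‖ₑ ^ 2 ∂ν ≤ C ^ 2 * ∫⁻ x, ‖h x‖ₑ ^ 2 ∂ν') :
    eLpNorm g 2 ν ≤ C * eLpNorm h 2 ν' := by
  rw [← eLpNorm_two_sq, ← eLpNorm_two_sq, ← mul_pow] at hC
  exact (ENNReal.pow_le_pow_left_iff two_ne_zero).1 hC

section Mollify

variable {F : Type*} [NormedAddCommGroup F] [NormedSpace ℝ F]

/-- Convolution with a normalized bump function. -/
def mollify (ρ : ContDiffBump (0 : E d)) (g : E d → F) : E d → F :=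
  convolution (ρ.normed volume) g (ContinuousLinearMap.lsmul ℝ ℝ) volume

lemma mollify_apply (ρ : ContDiffBump (0 : E d)) (g : E d → F) (x : E d) :
    mollify ρ g x = ∫ y, ρ.normed volume (x - y) • g y := by
  rw [mollify, convolution_def, ← integral_sub_left_eq_self _ volume x]
  simp

lemma mollify_congr (ρ : ContDiffBump (0 : E d)) {g h : E d → F} (hgh : g =ᵐ[volume] h) :
    mollify ρ g = mollify ρ h := by
  ext x
  rw [mollify_apply, mollify_apply]
  refine integral_congr_ae ?_
  filter_upwards [hgh] with y hy
  rw [hy]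

lemma contDiff_mollify [CompleteSpace F] (ρ : ContDiffBump (0 : E d)) {g : E d → F}
    (hg : LocallyIntegrable g) : ContDiff ℝ ∞ (mollify ρ g) :=
  ρ.hasCompactSupport_normed.contDiff_convolution_left _ ρ.contDiff_normed hg

/-- The kernel is at most the inverse volume of the inner ball and vanishes off the outer one, so
mollification is dominated by the ball integrals in `AvgBounded`. -/
lemma enorm_mollify_mul_le (ρ : ContDiffBump (0 : E d)) (g : E d → F) (x : E d) :
    volume (closedBall (0 : E d) ρ.rIn) * ‖mollify ρ g x‖ₑ ≤
      ∫⁻ y in closedBall x ρ.rOut, ‖g y‖ₑ := by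
  have hV0 : volume (closedBall (0 : E d) ρ.rIn) ≠ 0 := (measure_closedBall_pos volume _ ρ.rIn_pos).ne'
  have hVt : volume (closedBall (0 : E d) ρ.rIn) ≠ ⊤ := measure_closedBall_lt_top.ne
  rw [mollify_apply]
  calc _ ≤ volume (closedBall (0 : E d) ρ.rIn) * ∫⁻ y, ‖ρ.normed volume (x - y) • g y‖ₑ := by
        gcongr
        exact enorm_integral_le_lintegral_enorm _
    _ = ∫⁻ y, volume (closedBall (0 : E d) ρ.rIn) * ‖ρ.normed volume (x - y) • g y‖ₑ :=
        (lintegral_const_mul' _ _ hVt).symm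
    _ ≤ ∫⁻ y, (closedBall x ρ.rOut).indicator (fun y => ‖g y‖ₑ) y := by
        refine lintegral_mono fun y => ?_
        by_cases hy : y ∈ closedBall x ρ.rOut
        · rw [indicator_of_mem hy, enorm_smul, ← mul_assoc]
          refine mul_le_of_le_one_left' ?_
          rw [Real.enorm_of_nonneg (ρ.nonneg_normed _)]
          calc _ ≤ volume (closedBall (0 : E d) ρ.rIn) *
                ENNReal.ofReal (1 / volume.real (closedBall (0 : E d) ρ.rIn)) := by
                gcongr
                exact ρ.normed_le_div_measure_closedBall_rIn volume _
            _ = 1 := by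
                rw [← ofReal_measureReal hVt, ← ENNReal.ofReal_mul measureReal_nonneg,
                  mul_one_div_cancel ((measureReal_ne_zero_iff hVt).2 hV0), ENNReal.ofReal_one]
        · have h : ρ.normed volume (x - y) = 0 := by
            rw [← Function.notMem_support, ρ.support_normed_eq, mem_ball_zero_iff, ← dist_eq_norm]
            rw [mem_closedBall, dist_comm] at hy
            exact fun h => hy h.le
          rw [indicator_of_notMem hy, h, zero_smul, enorm_zero, mul_zero]
    _ = _ := lintegral_indicator measurableSet_closedBall _

/-- A bound for the squared norm of mollification in the weighted space. -/
def mollifyConst (d : ℕ) (A : ℝ≥0) : ℝ≥0∞ :=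
  ENNReal.ofReal (2 * A / ((2⁻¹ : ℝ) ^ d * (volume (ball (0 : E d) 1)).toReal) ^ 2)

variable {A : ℝ≥0} {μ : Measure (E d)}

lemma AvgBounded.lintegral_mollify_le (hμ : AvgBounded A μ) (hμv : μ ≪ volume)
    {ρ : ContDiffBump (0 : E d)} (hρ : ρ.rOut = 2 * ρ.rIn) {g : E d → F}
    (hg : AEStronglyMeasurable g volume) :
    ∫⁻ x, ‖mollify ρ g x‖ₑ ^ 2 ∂μ ≤ mollifyConst d A * ∫⁻ x, ‖g x‖ₑ ^ 2 ∂μ := by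
  -- `AvgBounded` asks for measurable functions; a representative changes neither the mollification
  -- nor, since `μ ≪ volume`, the weighted norm.
  have h0 : ∫⁻ x, ‖hg.mk g x‖ₑ ^ 2 ∂μ = ∫⁻ x, ‖g x‖ₑ ^ 2 ∂μ := by
    refine lintegral_congr_ae ?_
    filter_upwards [hμv.ae_eq hg.ae_eq_mk] with x hx
    rw [hx]
  rw [mollify_congr ρ hg.ae_eq_mk, ← h0]
  have hV : 0 < (volume (ball (0 : E d) 1)).toReal :=
    ENNReal.toReal_pos (measure_ball_pos volume 0 one_pos).ne' measure_ball_lt_top.ne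
  refine sq_cancel (d := d) (H := ρ.rOut) (V := volume (closedBall (0 : E d) ρ.rIn)) (by positivity)
    ρ.rOut_pos ?_ ?_
  · rw [Measure.addHaar_closedBall volume _ ρ.rIn_pos.le, finrank_euclideanSpace, Fintype.card_fin,
      ← ENNReal.ofReal_toReal (measure_ball_lt_top (μ := volume) (x := (0 : E d)) (r := 1)).ne,
      ← ENNReal.ofReal_mul (pow_nonneg ρ.rIn_pos.le _), hρ,
      ENNReal.toReal_ofReal ENNReal.toReal_nonneg]
    refine ENNReal.ofReal_le_ofReal (le_of_eq ?_)
    rw [mul_pow, inv_pow]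
    field_simp
  · rw [← lintegral_const_mul' _ _ (ENNReal.pow_ne_top measure_closedBall_lt_top.ne)]
    calc _ ≤ ∫⁻ x, (∫⁻ y in closedBall x ρ.rOut, ‖hg.mk g y‖ₑ) ^ 2 ∂μ := by
          refine lintegral_mono fun x => ?_
          rw [← mul_pow]
          exact pow_le_pow_left' (enorm_mollify_mul_le ρ _ x) 2
      _ ≤ A * ENNReal.ofReal ρ.rOut ^ (2 * d) * ∫⁻ x, ‖hg.mk g x‖ₑ ^ 2 ∂μ :=
          hμ _ ρ.rOut_pos _ hg.stronglyMeasurable_mk.enorm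
      _ ≤ _ := mul_le_mul_left (le_mul_of_one_le_left' one_le_two) _

variable [CompleteSpace F] [IsLocallyFiniteMeasure μ]

lemma continuous_mollify (ρ : ContDiffBump (0 : E d)) {g : E d → F} (hg : LocallyIntegrable g) :
    Continuous (mollify ρ g) := (contDiff_mollify ρ hg).continuous

lemma tendsto_mollify_of_continuous {g : E d → F} (hg : Continuous g) (hc : HasCompactSupport g)
    {ε : ℝ≥0∞} (hε : ε ≠ 0) : ∃ s > 0, ∀ ρ : ContDiffBump (0 : E d), ρ.rOut < s →
      eLpNorm (mollify ρ g - g) 2 μ ≤ ε := by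
  set N := cthickening 1 (tsupport g) with hN
  have hNc : IsCompact N := hc.cthickening
  have hNt : μ N < ⊤ := hNc.measure_lt_top
  obtain ⟨η, hη, hηε⟩ : ∃ η : ℝ, 0 < η ∧ ENNReal.ofReal η * (μ N + 1) ≤ ε := by
    have h1 : ε / (μ N + 1) ≠ 0 := ENNReal.div_ne_zero.2 ⟨hε, by finiteness⟩
    obtain ⟨η, hη0, hη⟩ := ENNReal.lt_iff_exists_nnreal_btwn.1 (pos_iff_ne_zero.2 h1)
    refine ⟨η, by exact_mod_cast hη0, ?_⟩
    rw [ENNReal.ofReal_coe_nnreal]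
    exact ((ENNReal.le_div_iff_mul_le (by simp) (by simp [hNt.ne])).1 hη.le)
  obtain ⟨s, hs, hsu⟩ := Metric.uniformContinuous_iff.1
    (hc.uniformContinuous_of_continuous hg) η hη
  refine ⟨min s 1, lt_min hs one_pos, fun ρ hρ => ?_⟩
  have hbd : ∀ x, ‖(mollify ρ g - g) x‖ ≤ η := fun x => by
    rw [Pi.sub_apply, ← dist_eq_norm]
    refine ContDiffBump.dist_normed_convolution_le hg.aestronglyMeasurable fun y hy => ?_
    exact (hsu (lt_of_lt_of_le (mem_ball.1 hy) (hρ.le.trans (min_le_left _ _)))).le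
  have hz : ∀ x ∉ N, (mollify ρ g - g) x = 0 := fun x hx => by
    have h0 : ∀ y ∈ closedBall x 1, g y = 0 := fun y hy => by
      refine image_eq_zero_of_notMem_tsupport fun h => hx ?_
      exact mem_cthickening_of_dist_le x y 1 _ h (by rw [dist_comm]; exact hy)
    have h1 : mollify ρ g x = 0 := by
      rw [mollify_apply]
      refine integral_eq_zero_of_ae (ae_of_all _ fun y => ?_)
      by_cases hy : y ∈ closedBall x 1
      · simp [h0 y hy]
      · have h : ρ.normed volume (x - y) = 0 := by
          rw [← Function.notMem_support, ρ.support_normed_eq, mem_ball_zero_iff, ← dist_eq_norm]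
          rw [mem_closedBall, dist_comm] at hy
          exact fun h => hy (h.le.trans (hρ.le.trans (min_le_right _ _)))
        simp [h]
    rw [Pi.sub_apply, h1, h0 x (mem_closedBall_self zero_le_one), sub_zero]
  have hsq : (eLpNorm (mollify ρ g - g) 2 μ) ^ 2 ≤ ε ^ 2 := by
    rw [eLpNorm_two_sq]
    calc _ ≤ ∫⁻ x, N.indicator (fun _ => ENNReal.ofReal η ^ 2) x ∂μ := by
          refine lintegral_mono fun x => ?_
          by_cases hx : x ∈ N
          · rw [indicator_of_mem hx, ← ofReal_norm]
            exact pow_le_pow_left' (ENNReal.ofReal_le_ofReal (hbd x)) 2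
          · simp [hz x hx]
      _ = ENNReal.ofReal η ^ 2 * μ N := by
          rw [lintegral_indicator hNc.measurableSet, setLIntegral_const]
      _ ≤ ENNReal.ofReal η ^ 2 * (μ N + 1) ^ 2 := by
          gcongr
          exact le_self_add.trans (le_self_pow₀ le_add_self two_ne_zero)
      _ = (ENNReal.ofReal η * (μ N + 1)) ^ 2 := by rw [mul_pow]
      _ ≤ ε ^ 2 := by gcongr
  exact (ENNReal.pow_le_pow_left_iff two_ne_zero).1 hsq

/-- Mollifications converge in the weighted space. -/
lemma AvgBounded.tendsto_mollify (hμ : AvgBounded A μ) (hμv : μ ≪ volume) {g : E d → F}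
    (hg : LocallyIntegrable g) (hg2 : MemLp g 2 μ) {ε : ℝ≥0∞} (hε : ε ≠ 0) :
    ∃ s > 0, ∀ ρ : ContDiffBump (0 : E d), ρ.rOut = 2 * ρ.rIn → ρ.rOut < s →
      eLpNorm (mollify ρ g - g) 2 μ ≤ ε := by
  set k : ℝ≥0∞ := mollifyConst d A + 1 with hk
  have hkt : k ≠ ⊤ := by rw [hk, mollifyConst]; finiteness
  -- Replacing `g` by a continuous `ψ` of compact support costs `k + 1` times their distance: `k`
  -- for the mollified difference, 1 for the difference itself.
  have hε' : ε / (2 * (k + 1)) ≠ 0 := ENNReal.div_ne_zero.2 ⟨hε, by finiteness⟩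
  obtain ⟨ψ, hψc, hψ, hψcont, hψ2⟩ := hg2.exists_hasCompactSupport_eLpNorm_sub_le
    (by norm_num) hε'
  obtain ⟨s, hs, hsρ⟩ := tendsto_mollify_of_continuous (μ := μ) hψcont hψc
    (ε := ε / 2) (ENNReal.div_ne_zero.2 ⟨hε, by norm_num⟩)
  refine ⟨s, hs, fun ρ hρ hρs => ?_⟩
  have hψl : LocallyIntegrable ψ := hψcont.locallyIntegrable
  have hdl : LocallyIntegrable (g - ψ) := hg.sub hψl
  have hsplit : mollify ρ g = mollify ρ (g - ψ) + mollify ρ ψ := by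
    ext x
    have h := ((ρ.hasCompactSupport_normed (μ := volume)).convolutionExists_left (ContinuousLinearMap.lsmul ℝ ℝ)
      ρ.continuous_normed hdl (μ := volume) x).distrib_add
      ((ρ.hasCompactSupport_normed (μ := volume)).convolutionExists_left (ContinuousLinearMap.lsmul ℝ ℝ)
      ρ.continuous_normed hψl (μ := volume) x)
    rw [sub_add_cancel] at h
    exact h
  have h1 : eLpNorm (mollify ρ (g - ψ)) 2 μ ≤ k * eLpNorm (g - ψ) 2 μ := by
    refine eLpNorm_le_of_sq_le ((hμ.lintegral_mollify_le hμv hρ hdl.aestronglyMeasurable).trans ?_)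
    gcongr
    exact le_self_add.trans (le_self_pow₀ le_add_self two_ne_zero)
  have e1 : mollify ρ g - g = mollify ρ (g - ψ) + (mollify ρ ψ - ψ) - (g - ψ) := by
    rw [hsplit]
    abel
  have m1 : AEStronglyMeasurable (mollify ρ (g - ψ)) μ :=
    (continuous_mollify ρ hdl).aestronglyMeasurable
  have m2 : AEStronglyMeasurable (mollify ρ ψ - ψ) μ :=
    ((continuous_mollify ρ hψl).sub hψcont).aestronglyMeasurable
  have m3 : AEStronglyMeasurable (g - ψ) μ := hg2.1.sub hψ2.1
  have hfin : 2 * (k + 1) ≠ ⊤ := by finiteness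
  calc eLpNorm (mollify ρ g - g) 2 μ
      ≤ eLpNorm (mollify ρ (g - ψ)) 2 μ + eLpNorm (mollify ρ ψ - ψ) 2 μ +
        eLpNorm (g - ψ) 2 μ := by
        rw [e1]
        refine (eLpNorm_sub_le (m1.add m2) m3 one_le_two).trans ?_
        gcongr
        exact eLpNorm_add_le m1 m2 one_le_two
    _ ≤ k * eLpNorm (g - ψ) 2 μ + ε / 2 + eLpNorm (g - ψ) 2 μ := by
        gcongr
        exact hsρ ρ hρs
    _ = (k + 1) * eLpNorm (g - ψ) 2 μ + ε / 2 := by ring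
    _ ≤ (k + 1) * (ε / (2 * (k + 1))) + ε / 2 := by gcongr
    _ = ε := by
        have : (k + 1) * (ε / (2 * (k + 1))) = ε / 2 := by
          rw [← mul_div_assoc, mul_comm 2, ENNReal.mul_div_mul_left _ _ (by simp) (by finiteness)]
        rw [this, ENNReal.add_halves]

end Mollify

/-! ### Smooth approximation -/

section Approx

lemma isTest_mollifier (ρ : ContDiffBump (0 : E d)) {x : E d} {U : Set (E d)}
    (hx : closedBall x ρ.rOut ⊆ U) :
    IsTest U (fun y => ρ.normed volume (x - y)) ∧
      tsupport (fun y => ρ.normed volume (x - y)) ⊆ closedBall x ρ.rOut := by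
  have hs : tsupport (fun y => ρ.normed volume (x - y)) ⊆ closedBall x ρ.rOut := by
    refine closure_minimal (fun y hy => ?_) isClosed_closedBall
    rw [Function.mem_support, ← Function.mem_support (f := ρ.normed volume), ρ.support_normed_eq,
      mem_ball_zero_iff, ← dist_eq_norm, dist_comm] at hy
    exact hy.le
  refine ⟨⟨ρ.contDiff_normed.comp (contDiff_const.sub contDiff_id), ?_, hs.trans hx⟩, hs⟩
  exact (isCompact_closedBall x ρ.rOut).of_isClosed_subset (isClosed_tsupport _) hs

lemma fderiv_convolution_apply {r F : E d → ℝ} (hrc : HasCompactSupport r) (hr : ContDiff ℝ ∞ r)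
    (hF : LocallyIntegrable F) (x e : E d) :
    fderiv ℝ (convolution r F (ContinuousLinearMap.lsmul ℝ ℝ) volume) x e =
      ∫ y, fderiv ℝ r (x - y) e * F y := by
  have hce : ConvolutionExistsAt (fderiv ℝ r) F x
      (ContinuousLinearMap.precompL (E d) (ContinuousLinearMap.lsmul ℝ ℝ)) volume :=
    (hrc.fderiv ℝ).convolutionExists_left _ (hr.continuous_fderiv (by simp)) hF x
  rw [(hrc.hasFDerivAt_convolution_left (ContinuousLinearMap.lsmul ℝ ℝ)
    (hr.of_le (by simp)) hF x).fderiv, convolution_def, ContinuousLinearMap.integral_apply hce,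
    ← integral_sub_left_eq_self _ volume x]
  refine integral_congr_ae (ae_of_all _ fun y => ?_)
  simp [ContinuousLinearMap.precompL_apply]

/-- The gradient of a mollification is the mollification of the weak gradient. -/
lemma HasWeakGrad.gradient_mollify {U N : Set (E d)} {u : E d → ℝ} {g : E d → E d}
    (h : HasWeakGrad U u g) (hN : IsCompact N) (hNU : N ⊆ U) {ρ : ContDiffBump (0 : E d)} {x : E d}
    (hx : closedBall x ρ.rOut ⊆ N) :
    gradient (mollify ρ (N.indicator u)) x = mollify ρ (N.indicator g) x := by
  have hF : LocallyIntegrable (N.indicator u) :=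
    ((integrable_indicator_iff hN.measurableSet).2
      (h.1.integrableOn_compact_subset hNU hN)).locallyIntegrable
  have hG : LocallyIntegrable (N.indicator g) :=
    ((integrable_indicator_iff hN.measurableSet).2
      (h.2.1.integrableOn_compact_subset hNU hN)).locallyIntegrable
  set r : E d → ℝ := ρ.normed volume with hr
  have hrc : HasCompactSupport r := ρ.hasCompactSupport_normed
  have hrd : ContDiff ℝ ∞ r := ρ.contDiff_normed
  obtain ⟨hφ, hφs⟩ := isTest_mollifier ρ (hx.trans hNU)
  refine ext_inner_right ℝ fun e => ?_
  have h1 : inner ℝ (gradient (mollify ρ (N.indicator u)) x) e =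
      ∫ y, fderiv ℝ r (x - y) e * N.indicator u y := by
    rw [inner_gradient_left, mollify, ← hr, fderiv_convolution_apply hrc hrd hF]
  -- The sign from reflecting the kernel cancels the one in the definition of the weak gradient.
  have h2 : ∀ y, fderiv ℝ (fun y => r (x - y)) y e = -fderiv ℝ r (x - y) e := fun y => by
    have h3 : HasFDerivAt (fun y => r (x - y)) _ y :=
      ((hrd.differentiable (by simp) (x - y)).hasFDerivAt).comp y ((hasFDerivAt_id y).const_sub x)
    rw [h3.fderiv]
    simp
  have h3 := h.2.2 _ hφ e
  rw [setIntegral_eq_integral_of_isTest hφ (fun y hy => by simp [fderiv_eq_zero_of_notMem hy]),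
    setIntegral_eq_integral_of_isTest hφ (fun y hy =>
      mul_eq_zero_of_right _ (image_eq_zero_of_notMem_tsupport hy))] at h3
  have h4 : inner ℝ (mollify ρ (N.indicator g) x) e =
      ∫ y, inner ℝ (g y) e * r (x - y) := by
    rw [mollify_apply, real_inner_comm, ← integral_inner]
    · refine integral_congr_ae (ae_of_all _ fun y => ?_)
      simp only [inner_smul_right]
      by_cases hy : y ∈ N
      · rw [indicator_of_mem hy, real_inner_comm, mul_comm]
      · have : r (x - y) = 0 := image_eq_zero_of_notMem_tsupport
          (f := fun y => r (x - y)) fun h => hy (hx (hφs h))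
        simp [← hr, this]
    · have := integrableOn_mul_of_isTest (Ω := univ) (hG.locallyIntegrableOn _)
        hφ.1.continuous hφ.2.1 (subset_univ _)
      rwa [integrableOn_univ] at this
  rw [h1, h4, ← neg_inj, ← h3, ← integral_neg]
  refine integral_congr_ae (ae_of_all _ fun y => ?_)
  simp only
  rw [h2]
  by_cases hy : y ∈ N
  · rw [indicator_of_mem hy]
    ring
  · have : fderiv ℝ (fun y => r (x - y)) y = 0 :=
      fderiv_eq_zero_of_notMem fun h => hy (hx (hφs h))
    have h5 := h2 y
    rw [this] at h5
    have h6 : fderiv ℝ r (x - y) e = 0 := by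
      simpa using h5.symm
    rw [h6]
    simp

variable {A : ℝ≥0} {μ : Measure (E d)} [IsLocallyFiniteMeasure μ]

/-- Cutting off outside the compact set `N` makes `u` and `g` integrable on the whole space; with
radius below `δ` the mollifications on `D` do not notice the cut, so gradient and mollification
commute there. The control of the support keeps approximations of compactly supported functions
inside the domain. -/
lemma AvgBounded.exists_smooth (hμ : AvgBounded A μ) (hμv : μ ≪ volume) {U N D : Set (E d)}
    {u : E d → ℝ} {g : E d → E d} (h : HasWeakGrad U u g) (hN : IsCompact N) (hNU : N ⊆ U)
    (hu : MemLp u 2 (μ.restrict N)) (hg : MemLp g 2 (μ.restrict N)) (hD : MeasurableSet D) {δ : ℝ}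
    (hδ : 0 < δ) (hDN : ∀ x ∈ D, closedBall x δ ⊆ N) {ε : ℝ≥0∞} (hε : ε ≠ 0) :
    ∃ φ : E d → ℝ, ContDiff ℝ ∞ φ ∧
      Function.support φ ⊆ cthickening δ (Function.support (N.indicator u)) ∧
      eLpNorm (fun x => u x - φ x) 2 (μ.restrict D) ≤ ε ∧
      eLpNorm (fun x => g x - gradient φ x) 2 (μ.restrict D) ≤ ε := by
  have hF : LocallyIntegrable (N.indicator u) :=
    ((integrable_indicator_iff hN.measurableSet).2
      (h.1.integrableOn_compact_subset hNU hN)).locallyIntegrable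
  have hG : LocallyIntegrable (N.indicator g) :=
    ((integrable_indicator_iff hN.measurableSet).2
      (h.2.1.integrableOn_compact_subset hNU hN)).locallyIntegrable
  obtain ⟨s, hs, hs'⟩ := hμ.tendsto_mollify hμv hF
    ((memLp_indicator_iff_restrict hN.measurableSet).2 hu) hε
  obtain ⟨r, hr, hr'⟩ := hμ.tendsto_mollify hμv hG
    ((memLp_indicator_iff_restrict hN.measurableSet).2 hg) hε
  set τ := min δ (min s r) / 2 with hτ
  have hm : 0 < min δ (min s r) := lt_min hδ (lt_min hs hr)
  have hτ0 : 0 < τ := half_pos hm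
  have hτm : τ < min δ (min s r) := half_lt_self hm
  let ρ : ContDiffBump (0 : E d) := ⟨τ / 2, τ, half_pos hτ0, half_lt_self hτ0⟩
  have hρ : ρ.rOut = 2 * ρ.rIn := (mul_div_cancel₀ τ two_ne_zero).symm
  have hτδ : τ ≤ δ := hτm.le.trans (min_le_left _ _)
  have hτs : τ < s := hτm.trans_le ((min_le_right _ _).trans (min_le_left _ _))
  have hτr : τ < r := hτm.trans_le ((min_le_right _ _).trans (min_le_right _ _))
  have hDN' : ∀ x ∈ D, x ∈ N := fun x hx => hDN x hx (mem_closedBall_self hδ.le)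
  refine ⟨mollify ρ (N.indicator u), contDiff_mollify ρ hF, fun x hx => ?_, ?_, ?_⟩
  · by_contra hcon
    refine hx ?_
    rw [mollify_apply]
    refine integral_eq_zero_of_ae (ae_of_all _ fun y => ?_)
    by_cases hy : N.indicator u y = 0
    · simp [hy]
    · have : ρ.normed volume (x - y) = 0 := by
        rw [← Function.notMem_support, ρ.support_normed_eq, mem_ball_zero_iff, ← dist_eq_norm]
        exact fun h => hcon (mem_cthickening_of_dist_le x y δ _ hy (h.le.trans hτδ))
      simp [this]
  · refine le_trans ?_ ((eLpNorm_mono_measure _ (Measure.restrict_le_self (s := D))).trans (hs' ρ hρ hτs))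
    rw [eLpNorm_sub_comm]
    refine (eLpNorm_congr_ae ?_).le
    filter_upwards [ae_restrict_mem hD] with x hx
    rw [Pi.sub_apply, indicator_of_mem (hDN' x hx)]
  · refine le_trans ?_ ((eLpNorm_mono_measure _ (Measure.restrict_le_self (s := D))).trans (hr' ρ hρ hτr))
    rw [eLpNorm_sub_comm]
    refine (eLpNorm_congr_ae ?_).le
    filter_upwards [ae_restrict_mem hD] with x hx
    rw [Pi.sub_apply, indicator_of_mem (hDN' x hx),
      h.gradient_mollify hN hNU ((closedBall_subset_closedBall hτδ).trans (hDN x hx))]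

end Approx

/-! ### Finite element functions in the weighted Sobolev space -/

section VH

variable {Ω : Set (E d)} {κ H : ℝ} {K : Geometry.SimplicialComplex ℝ (E d)}

/-- Truncation at height `ε`. -/
def clamp (ε : ℝ) (f : E d → ℝ) (x : E d) : ℝ := max (-ε) (min ε (f x))

lemma LipschitzWith.clamp {f : E d → ℝ} {M : ℝ≥0} (hf : LipschitzWith M f) (ε : ℝ) :
    LipschitzWith M (clamp ε f) := (hf.const_min ε).const_max (-ε)

lemma abs_clamp_le {ε : ℝ} (hε : 0 ≤ ε) (f : E d → ℝ) (x : E d) : |clamp ε f x| ≤ ε :=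
  abs_le.2 ⟨le_max_left _ _, max_le (by linarith) (min_le_left _ _)⟩

lemma clamp_eq {ε : ℝ} {f : E d → ℝ} {x : E d} (h : |f x| ≤ ε) : clamp ε f x = f x := by
  rw [abs_le] at h
  rw [clamp, min_eq_right h.2, max_eq_right h.1]

lemma gradient_clamp_eq_zero {ε : ℝ} (hε : 0 ≤ ε) {f : E d → ℝ} (hf : Continuous f) {x : E d}
    (hx : ε < |f x|) : gradient (clamp ε f) x = 0 := by
  have key : ∃ c : ℝ, clamp ε f =ᶠ[nhds x] fun _ => c := by
    rcases lt_abs.1 hx with h | h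
    · refine ⟨ε, ?_⟩
      filter_upwards [hf.continuousAt.eventually (lt_mem_nhds h)] with y hy
      rw [clamp, min_eq_left hy.le, max_eq_right (by linarith)]
    · refine ⟨-ε, ?_⟩
      filter_upwards [hf.continuousAt.eventually (gt_mem_nhds (show f x < -ε by linarith))] with y hy
      rw [clamp, max_eq_left ((min_le_right _ _).trans hy.le)]
  obtain ⟨c, hc⟩ := key
  rw [gradient, hc.fderiv_eq]
  simp

lemma volume_affine_eq_zero {F : E d →ᵃ[ℝ] ℝ} (hF : F.linear ≠ 0) : volume {x | F x = 0} = 0 := by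
  have h := Measure.addHaar_affineSubspace volume ((affineSpan ℝ {(0 : ℝ)}).comap F) (by
    intro h
    have h0 : ∀ x, F x = 0 := fun x => by
      have : x ∈ (affineSpan ℝ {(0 : ℝ)}).comap F := h ▸ AffineSubspace.mem_top ℝ (E d) x
      simpa using this
    refine hF (LinearMap.ext fun v => ?_)
    have := F.linearMap_vsub v 0
    simpa [h0] using this)
  refine measure_mono_null (fun x hx => ?_) h
  simpa using hx

/-- Where `f x ≠ 0`, the truncation is eventually constant near `x`. An affine function with nonzero
linear part has a null zero set, so at almost every zero `f` vanishes on the whole surrounding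
element. -/
lemma ae_gradient_clamp (hΩ : IsLipschitzDomain Ω) (hK : IsMesh Ω κ H K) {f : E d → ℝ}
    (hf : f ∈ VH Ω K) {μ : Measure (E d)} (hμv : μ ≪ volume) :
    ∀ᵐ x ∂(μ.restrict Ω), Filter.Tendsto
      (fun n : ℕ => ‖gradient (clamp (1 / ((n : ℝ) + 1)) f) x‖ₑ ^ 2) Filter.atTop (nhds 0) := by
  obtain ⟨M, hM⟩ := VH_lipschitz hΩ hK hf
  choose! F hF using hf.1.2.2
  have h1 : ∀ᵐ x ∂μ, ∀ t ∈ elements K, x ∈ convexHull ℝ (t : Set (E d)) →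
      x ∈ interior (convexHull ℝ (t : Set (E d))) :=
    (ae_ball_iff hK.elements_finite.countable).2 fun t _ => ae_interior hμv t
  have h2 : ∀ᵐ x ∂μ, ∀ t ∈ elements K, (F t).linear ≠ 0 → F t x ≠ 0 := by
    refine (ae_ball_iff hK.elements_finite.countable).2 fun t _ => ?_
    by_cases h : (F t).linear = 0
    · exact ae_of_all _ fun x h' => absurd h h'
    · filter_upwards [measure_eq_zero_iff_ae_notMem.1 (hμv (volume_affine_eq_zero h))] with x hx _
      exact hx
  rw [ae_restrict_iff' hΩ.isOpen.measurableSet]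
  filter_upwards [h1, h2] with x hx1 hx2 hxΩ
  refine tendsto_const_nhds.congr' ?_
  suffices h : ∀ᶠ n : ℕ in Filter.atTop, gradient (clamp (1 / ((n : ℝ) + 1)) f) x = 0 by
    filter_upwards [h] with n hn
    rw [hn, enorm_zero, zero_pow two_ne_zero]
  by_cases hfx : f x = 0
  · obtain ⟨t, ht, hxt⟩ := hK.exists_mem_of_mem_closure (subset_closure hxΩ)
    have hlin : (F t).linear = 0 := by
      by_contra h
      exact hx2 t ht h (by rw [← hF t ht x hxt, hfx])
    refine Filter.Eventually.of_forall fun n => ?_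
    have h3 : clamp (1 / ((n : ℝ) + 1)) f =ᶠ[nhds x] fun _ => (0 : ℝ) := by
      filter_upwards [isOpen_interior.mem_nhds (hx1 t ht hxt)] with y hy
      have h4 := (F t).linearMap_vsub y x
      rw [hlin, ← hF t ht x hxt, hfx, ← hF t ht y (interior_subset hy)] at h4
      have h5 : f y = 0 := by simpa using h4.symm
      rw [clamp_eq (by rw [h5, abs_zero]; positivity), h5]
    rw [gradient, h3.fderiv_eq]
    simp
  · filter_upwards [tendsto_one_div_add_atTop_nhds_zero_nat.eventually
      (gt_mem_nhds (abs_pos.2 hfx))] with n hn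
    exact gradient_clamp_eq_zero (by positivity) hM.continuous hn

variable {A : ℝ≥0} {Λ : Set (E d)} {β : ℝ} [IsLocallyFiniteMeasure (wMeas Λ β)]

lemma memLp_of_bounded {μ : Measure (E d)} [IsLocallyFiniteMeasure μ]
    {F : Type*} [NormedAddCommGroup F] {f : E d → F} (hf : AEStronglyMeasurable f μ) {M : ℝ}
    (hM : ∀ x, ‖f x‖ ≤ M) {D : Set (E d)} (hD : Bornology.IsBounded D) :
    MemLp f 2 (μ.restrict D) := by
  have : IsFiniteMeasure (μ.restrict D) := ⟨by
    rw [Measure.restrict_apply_univ]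
    exact (measure_mono subset_closure).trans_lt hD.isCompact_closure.measure_lt_top⟩
  exact MemLp.of_bound hf.restrict M (ae_of_all _ hM)

lemma LipschitzWith.memLp_gradient {μ : Measure (E d)}
    [IsLocallyFiniteMeasure μ] {f : E d → ℝ} {M : ℝ≥0} (hf : LipschitzWith M f) {D : Set (E d)}
    (hD : Bornology.IsBounded D) : MemLp (gradient f) 2 (μ.restrict D) :=
  memLp_of_bounded (measurable_gradient f).aestronglyMeasurable
    (fun x => (norm_gradient f x).trans_le (norm_fderiv_le_of_lipschitz ℝ hf)) hD

lemma VH_memH1 (hΩ : IsLipschitzDomain Ω) (hK : IsMesh Ω κ H K) {f : E d → ℝ}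
    (hf : f ∈ VH Ω K) : MemH1 Λ β Ω f := by
  obtain ⟨M, hM⟩ := VH_lipschitz hΩ hK hf
  exact ⟨SH_memLp hΩ hf.1 subset_closure, _, LipschitzWith.hasWeakGrad hM,
    LipschitzWith.memLp_gradient hM hΩ.isBounded⟩

/-- The truncations `f - clamp ε f` approximate `f`. -/
lemma exists_clamp_le (hΩ : IsLipschitzDomain Ω) (hK : IsMesh Ω κ H K) {f : E d → ℝ}
    (hf : f ∈ VH Ω K) {μ : Measure (E d)} [IsLocallyFiniteMeasure μ] (hμv : μ ≪ volume)
    {ε : ℝ≥0∞} (hε : ε ≠ 0) : ∃ s > 0, eLpNorm (clamp s f) 2 (μ.restrict Ω) ≤ ε ∧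
      eLpNorm (gradient (clamp s f)) 2 (μ.restrict Ω) ≤ ε := by
  obtain ⟨M, hM⟩ := VH_lipschitz hΩ hK hf
  have hμΩ : μ Ω < ⊤ :=
    (measure_mono subset_closure).trans_lt hΩ.isBounded.isCompact_closure.measure_lt_top
  have h1 := tendsto_lintegral_of_dominated_convergence (μ := μ.restrict Ω)
    (F := fun n x => ‖gradient (clamp (1 / ((n : ℝ) + 1)) f) x‖ₑ ^ 2) (f := fun _ => 0)
    (fun _ => (M : ℝ≥0∞) ^ 2) (fun n => (measurable_gradient _).enorm.pow_const 2)
    (fun n => ae_of_all _ fun x => by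
      refine pow_le_pow_left' ?_ 2
      rw [enorm_gradient, ← ofReal_norm, ← ENNReal.ofReal_coe_nnreal]
      exact ENNReal.ofReal_le_ofReal
        (norm_fderiv_le_of_lipschitz ℝ (LipschitzWith.clamp hM _)))
    (by rw [lintegral_const, Measure.restrict_apply_univ]; finiteness)
    (ae_gradient_clamp hΩ hK hf hμv)
  have h2 : Filter.Tendsto (fun n : ℕ => ENNReal.ofReal (1 / ((n : ℝ) + 1)) ^ 2 * μ Ω)
      Filter.atTop (nhds 0) := by
    have h3 : Filter.Tendsto (fun n : ℕ => ENNReal.ofReal (1 / ((n : ℝ) + 1)))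
        Filter.atTop (nhds 0) := by
      simpa using ENNReal.tendsto_ofReal (tendsto_one_div_add_atTop_nhds_zero_nat (𝕜 := ℝ))
    have h4 := ENNReal.Tendsto.mul_const (ENNReal.Tendsto.pow (n := 2) h3) (Or.inr hμΩ.ne)
    simpa using h4
  rw [lintegral_zero] at h1
  have hε2 : 0 < ε ^ 2 := pos_iff_ne_zero.2 (pow_ne_zero 2 hε)
  obtain ⟨n, hn1, hn2⟩ := ((h1.eventually (gt_mem_nhds hε2)).and
    (h2.eventually (gt_mem_nhds hε2))).exists
  refine ⟨1 / ((n : ℝ) + 1), by positivity, ?_, ?_⟩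
  · refine (ENNReal.pow_le_pow_left_iff two_ne_zero).1 (le_trans ?_ hn2.le)
    rw [eLpNorm_two_sq, ← setLIntegral_const]
    refine lintegral_mono fun x => pow_le_pow_left' ?_ 2
    rw [← ofReal_norm]
    exact ENNReal.ofReal_le_ofReal (abs_clamp_le (by positivity) f x)
  · refine (ENNReal.pow_le_pow_left_iff two_ne_zero).1 (le_trans ?_ hn1.le)
    rw [eLpNorm_two_sq]

/-- `V_H` is contained in the closure of the test functions. -/
lemma VH_memH1Zero (hμ : AvgBounded A (wMeas Λ β)) (hΩ : IsLipschitzDomain Ω)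
    (hK : IsMesh Ω κ H K) {f : E d → ℝ} (hf : f ∈ VH Ω K) : MemH1Zero Λ β Ω f := by
  refine ⟨VH_memH1 hΩ hK hf, fun ε hε => ?_⟩
  obtain ⟨ε', hε'0, hε'⟩ := ENNReal.lt_iff_exists_nnreal_btwn.1 hε
  have hη : (ε' : ℝ≥0∞) / 2 ≠ 0 := ENNReal.div_ne_zero.2 ⟨hε'0.ne', by norm_num⟩
  have hμv : wMeas Λ β ≪ volume := wMeas_absolutelyContinuous
  obtain ⟨M, hM⟩ := VH_lipschitz hΩ hK hf
  obtain ⟨s, hs, hs1, hs2⟩ := exists_clamp_le hΩ hK hf hμv hη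
  have hcl := LipschitzWith.clamp hM s
  have hw : LipschitzWith (M + M) (fun x => f x - clamp s f x) := hM.sub hcl
  set w : E d → ℝ := fun x => f x - clamp s f x with hwdef
  -- Removing the part of `f` below height `s` leaves a support in `Z`, which is compact in `Ω`
  -- because `f` vanishes outside `Ω`.
  set Z : Set (E d) := {x | s ≤ |f x|} with hZ
  have hZΩ : Z ⊆ Ω := fun x hx => by
    by_contra h
    rw [hZ, mem_ofPred_eq, VH_eq_zero hΩ hf h, abs_zero] at hx
    linarith
  have hZc : IsCompact Z := isCompact_of_isClosed_isBounded
    (isClosed_le continuous_const hM.continuous.abs) (hΩ.isBounded.subset hZΩ)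
  have hwZ : Function.support w ⊆ Z := fun x hx => by
    by_contra h
    rw [hZ, mem_ofPred_eq, not_le] at h
    exact hx (by rw [hwdef]; simp [clamp_eq h.le])
  obtain ⟨δ, hδ, hδΩ⟩ := hZc.exists_cthickening_subset_open hΩ.isOpen hZΩ
  -- As `w` is Lipschitz on the whole space, it may be mollified across the boundary, and the
  -- approximation holds on all of `Ω`.
  set N : Set (E d) := cthickening δ (closure Ω) with hN
  have hNc : IsCompact N := hΩ.isBounded.isCompact_closure.cthickening
  have hwL : MemLp w 2 ((wMeas Λ β).restrict N) := by
    have hb : ∃ B : ℝ, ∀ x, ‖w x‖ ≤ B := hw.continuous.bounded_above_of_compact_support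
      (HasCompactSupport.of_support_subset_isCompact hZc hwZ)
    obtain ⟨B, hB⟩ := hb
    exact memLp_of_bounded hw.continuous.aestronglyMeasurable hB hNc.isBounded
  obtain ⟨φ, hφ, hφs, hφ1, hφ2⟩ := hμ.exists_smooth hμv (U := univ) (N := N) (D := Ω)
    (LipschitzWith.hasWeakGrad hw) hNc (subset_univ _) hwL
    (LipschitzWith.memLp_gradient hw hNc.isBounded) hΩ.isOpen.measurableSet hδ
    (fun x hx y hy => mem_cthickening_of_dist_le y x δ _ (subset_closure hx) hy) hη
  have hφZ : tsupport φ ⊆ cthickening δ Z := by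
    refine closure_minimal (hφs.trans (cthickening_subset_of_subset δ ?_)) isClosed_cthickening
    rw [support_indicator]
    exact inter_subset_right.trans hwZ
  refine ⟨φ, ⟨hφ, hZc.cthickening.of_isClosed_subset (isClosed_tsupport _) hφZ,
    hφZ.trans hδΩ⟩, lt_of_le_of_lt ?_ hε', lt_of_le_of_lt ?_ hε'⟩
  · have e1 : (fun x => f x - φ x) = clamp s f + fun x => w x - φ x := by
      ext x
      simp only [hwdef, Pi.add_apply]
      ring
    rw [wNorm, e1]
    refine (eLpNorm_add_le hcl.continuous.aestronglyMeasurable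
      (hw.continuous.sub hφ.continuous).aestronglyMeasurable one_le_two).trans ?_
    rw [← ENNReal.add_halves (ε' : ℝ≥0∞)]
    exact add_le_add hs1 hφ1
  · have hae : (fun x => weakGrad Ω f x - gradient φ x) =ᵐ[(wMeas Λ β).restrict Ω]
        gradient (clamp s f) + fun x => gradient w x - gradient φ x := by
      filter_upwards [HasWeakGrad.weakGrad_ae_eq hΩ.isOpen
        (LipschitzWith.hasWeakGrad hM) hμv,
        ae_restrict_of_ae (hμv.ae_le hM.ae_differentiableAt),
        ae_restrict_of_ae (hμv.ae_le hcl.ae_differentiableAt)] with x hx hx1 hx2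
      rw [hx, Pi.add_apply]
      have : gradient w x = gradient f x - gradient (clamp s f) x := by
        rw [gradient, gradient, gradient, ← map_sub, ← fderiv_fun_sub hx1 hx2]
      rw [this]
      abel
    rw [wNorm, eLpNorm_congr_ae hae]
    refine (eLpNorm_add_le (measurable_gradient _).aestronglyMeasurable
      ((measurable_gradient _).sub (measurable_gradient _)).aestronglyMeasurable
      one_le_two).trans ?_
    rw [← ENNReal.add_halves (ε' : ℝ≥0∞)]
    exact add_le_add hs2 hφ2

end VH

/-! ### The local estimates -/

section Estimates

lemma exists_wNorm_poincare_patch (hd : 0 < d) (κ : ℝ) (A : ℝ≥0) (k : ℕ) : ∃ C : ℝ≥0,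
    ∀ (Ω : Set (E d)) (H : ℝ) (K : Geometry.SimplicialComplex ℝ (E d)) (Λ : Set (E d)) (β : ℝ)
      [IsLocallyFiniteMeasure (wMeas Λ β)], AvgBounded A (wMeas Λ β) →
      IsLipschitzDomain Ω → IsMesh Ω κ H K → ∀ v ∈ K.vertices, ∀ φ : E d → ℝ, ContDiff ℝ 1 φ →
      (∃ c : ℝ, wNorm Λ β (patch Ω K v k) (fun x => φ x - c) ≤
        C * ENNReal.ofReal H * wNorm Λ β (patch Ω K v k) (gradient φ)) ∧
      ∀ t ∈ patchElts K v k, ∀ f ⊆ t, f.card = d → (∀ x ∈ convexHull ℝ (f : Set (E d)), φ x = 0) →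
        wNorm Λ β (patch Ω K v k) φ ≤
        C * ENNReal.ofReal H * wNorm Λ β (patch Ω K v k) (gradient φ) := by
  obtain ⟨C, hC⟩ := AvgBounded.exists_poincare_patch (d := d) hd κ A k
  -- `C ≤ (C + 1)²` replaces a square root in passing from squared integrals to norms.
  refine ⟨C + 1, ?_⟩
  intro Ω H K Λ β _ hμ hΩ hK v hv φ hφ
  have hC2 : (C : ℝ≥0∞) ≤ ((C + 1 : ℝ≥0) : ℝ≥0∞) ^ 2 := by
    push_cast
    exact le_self_add.trans (le_self_pow₀ le_add_self two_ne_zero)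
  have key : ∀ {g : E d → ℝ}, ∫⁻ x in patch Ω K v k, ‖g x‖ₑ ^ 2 ∂(wMeas Λ β) ≤
      C * (ENNReal.ofReal H ^ 2 * ∫⁻ x in patch Ω K v k, ‖gradient φ x‖ₑ ^ 2 ∂(wMeas Λ β)) →
      wNorm Λ β (patch Ω K v k) g ≤
        ((C + 1 : ℝ≥0) : ℝ≥0∞) * ENNReal.ofReal H * wNorm Λ β (patch Ω K v k) (gradient φ) := by
    intro g hg
    refine eLpNorm_le_of_sq_le (hg.trans ?_)
    rw [mul_pow, mul_assoc]
    gcongr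
  obtain ⟨⟨c, hc⟩, h2⟩ := hC Ω H K (wMeas Λ β) hμ wMeas_absolutelyContinuous hΩ hK v hv φ hφ
  exact ⟨⟨c, key hc⟩, fun t ht f hf hfc h0 => key (h2 t ht f hf hfc h0)⟩

lemma exists_wNorm_quasiInterp_le (hd : 0 < d) (κ : ℝ) (A : ℝ≥0) : ∃ C : ℝ≥0,
    ∀ (Ω : Set (E d)) (H : ℝ) (K : Geometry.SimplicialComplex ℝ (E d)) (Λ : Set (E d)) (β : ℝ)
      [IsLocallyFiniteMeasure (wMeas Λ β)], AvgBounded A (wMeas Λ β) → volume ≪ wMeas Λ β →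
      IsLipschitzDomain Ω → IsMesh Ω κ H K → ∀ v ∈ K.vertices, ∀ u : E d → ℝ,
      MemL2 Λ β Ω u → ∀ c : ℝ, (c = 0 ∨ closure (patch Ω K v 1) ⊆ Ω) →
      wNorm Λ β (patch Ω K v 0) (fun x => quasiInterp Ω K Λ β u x - c) ≤
        C * wNorm Λ β (patch Ω K v 1) (fun x => u x - c) ∧
      ENNReal.ofReal H * wNorm Λ β (patch Ω K v 0) (gradient (quasiInterp Ω K Λ β u)) ≤
        C * wNorm Λ β (patch Ω K v 1) (fun x => u x - c) := by
  obtain ⟨C, hC⟩ := exists_quasiInterp_stable (d := d) hd κ A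
  refine ⟨C + 1, ?_⟩
  intro Ω H K Λ β _ hμ hvμ hΩ hK v hv u hu c hc
  have hC2 : (C : ℝ≥0∞) ≤ ((C + 1 : ℝ≥0) : ℝ≥0∞) ^ 2 := by
    push_cast
    exact le_self_add.trans (le_self_pow₀ le_add_self two_ne_zero)
  obtain ⟨h1, h2⟩ := hC Ω H K Λ β hμ hvμ hΩ hK v hv u hu c hc
  refine ⟨eLpNorm_le_of_sq_le (h1.trans (by gcongr)), ?_⟩
  refine (ENNReal.pow_le_pow_left_iff two_ne_zero).1 ?_
  rw [mul_pow, mul_pow, wNorm, wNorm, eLpNorm_two_sq, eLpNorm_two_sq]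
  exact h2.trans (by gcongr)

lemma le_of_forall_le_add_mul {Y B D : ℝ≥0∞} (hD : D ≠ ⊤)
    (h : ∀ η : ℝ≥0∞, η ≠ 0 → Y ≤ B + D * η) : Y ≤ B := by
  refine ENNReal.le_of_forall_pos_le_add fun ε hε _ => ?_
  refine (h (ε / (D + 1)) (ENNReal.div_ne_zero.2 ⟨by exact_mod_cast hε.ne', by finiteness⟩)).trans ?_
  gcongr
  rw [← mul_div_assoc]
  refine ENNReal.div_le_of_le_mul ?_
  rw [mul_comm]
  gcongr
  exact le_self_add

variable {Ω Λ : Set (E d)} {κ H β : ℝ} {K : Geometry.SimplicialComplex ℝ (E d)}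

lemma MemH1.weakGrad_spec (hΩ : IsLipschitzDomain Ω) {u : E d → ℝ} (hu : MemH1 Λ β Ω u) :
    HasWeakGrad Ω u (weakGrad Ω u) ∧ MemL2 Λ β Ω (weakGrad Ω u) := by
  obtain ⟨-, g, hg, hgL⟩ := hu
  have h : ∃ g, HasWeakGrad Ω u g := ⟨g, hg⟩
  refine ⟨?_, (memLp_congr_ae (hg.weakGrad_ae_eq hΩ.isOpen wMeas_absolutelyContinuous)).2 hgL⟩
  rw [weakGrad, dif_pos h]
  exact h.choose_spec

lemma wNorm_mono {F : Type*} [NormedAddCommGroup F] {D D' : Set (E d)} (h : D ≤ᵐ[wMeas Λ β] D')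
    (u : E d → F) : wNorm Λ β D u ≤ wNorm Λ β D' u :=
  eLpNorm_mono_measure _ (Measure.restrict_mono' h le_rfl)

lemma wNorm_congr {F : Type*} [NormedAddCommGroup F] {D : Set (E d)} (hD : D ⊆ Ω) {u w : E d → F}
    (h : u =ᵐ[(wMeas Λ β).restrict Ω] w) : wNorm Λ β D u = wNorm Λ β D w :=
  eLpNorm_congr_ae (ae_mono (Measure.restrict_mono hD le_rfl) h)

/-- The gradient bounds follow from the stability of the quasi-interpolation and a Poincaré
inequality for smooth approximations. -/
lemma gradientBounds_of_approx [IsLocallyFiniteMeasure (wMeas Λ β)] (hΩ : IsLipschitzDomain Ω)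
    (hK : IsMesh Ω κ H K) (hH : 0 < H) {C₁ C₂ : ℝ≥0} {v : E d} {k : ℕ}
    (h0k : patchElts K v 0 ⊆ patchElts K v k) (h1k : patchElts K v 1 ⊆ patchElts K v k)
    {u : E d → ℝ} (hu : MemH1 Λ β Ω u)
    (hI : ∀ c : ℝ, (c = 0 ∨ closure (patch Ω K v 1) ⊆ Ω) →
      wNorm Λ β (patch Ω K v 0) (fun x => quasiInterp Ω K Λ β u x - c) ≤
        C₂ * wNorm Λ β (patch Ω K v 1) (fun x => u x - c) ∧
      ENNReal.ofReal H * wNorm Λ β (patch Ω K v 0) (gradient (quasiInterp Ω K Λ β u)) ≤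
        C₂ * wNorm Λ β (patch Ω K v 1) (fun x => u x - c))
    (hφ : ∀ η : ℝ≥0∞, η ≠ 0 → ∃ (c : ℝ) (φ : E d → ℝ), (c = 0 ∨ closure (patch Ω K v 1) ⊆ Ω) ∧
      ContDiff ℝ 1 φ ∧ wNorm Λ β (patch Ω K v k) (fun x => u x - φ x) ≤ η ∧
      wNorm Λ β (patch Ω K v k) (fun x => weakGrad Ω u x - gradient φ x) ≤ η ∧
      wNorm Λ β (patch Ω K v k) (fun x => φ x - c) ≤
        C₁ * ENNReal.ofReal H * wNorm Λ β (patch Ω K v k) (gradient φ)) :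
    GradientBounds Ω Λ β H (1 + (1 + C₂) * C₁) u (quasiInterp Ω K Λ β u)
      (patch Ω K v 0) (patch Ω K v k) := by
  have hμv : wMeas Λ β ≪ volume := wMeas_absolutelyContinuous
  set I := quasiInterp Ω K Λ β u with hIdef
  have hIV : I ∈ VH Ω K := quasiInterp_mem_VH hΩ hK u
  obtain ⟨M, hM⟩ := VH_lipschitz hΩ hK hIV
  have hr : ∀ {F : Type} [NormedAddCommGroup F] {f : E d → F} {j : ℕ}, MemL2 Λ β Ω f →
      AEStronglyMeasurable f ((wMeas Λ β).restrict (patch Ω K v j)) := fun hf =>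
    (hf.mono_measure (Measure.restrict_mono (patch_subset_domain v _) le_rfl)).1
  obtain ⟨hug, hugL⟩ := hu.weakGrad_spec hΩ
  have hIL : MemL2 Λ β Ω I := SH_memLp hΩ hIV.1 subset_closure
  set G := wNorm Λ β (patch Ω K v k) (weakGrad Ω u) with hG
  set h := ENNReal.ofReal H with hh
  -- The constant `c` may vary with the accuracy `η`, since it does not occur in the final bounds;
  -- no limit of these constants is needed.
  have hX : ∀ η : ℝ≥0∞, η ≠ 0 → ∃ c : ℝ, (c = 0 ∨ closure (patch Ω K v 1) ⊆ Ω) ∧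
      wNorm Λ β (patch Ω K v k) (fun x => u x - c) ≤ C₁ * h * G + (1 + C₁ * h) * η := by
    intro η hη
    obtain ⟨c, φ, hc, hφ, h1, h2, h3⟩ := hφ η hη
    refine ⟨c, hc, ?_⟩
    have m1 : AEStronglyMeasurable (fun x => u x - φ x)
        ((wMeas Λ β).restrict (patch Ω K v k)) :=
      (hr hu.1).sub hφ.continuous.aestronglyMeasurable
    have m2 : AEStronglyMeasurable (fun x => φ x - c)
        ((wMeas Λ β).restrict (patch Ω K v k)) :=
      (hφ.continuous.sub continuous_const).aestronglyMeasurable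
    have e1 : (fun x => u x - c) = (fun x => u x - φ x) + fun x => φ x - c := by
      ext x
      simp
    have h4 : wNorm Λ β (patch Ω K v k) (gradient φ) ≤ G + η := by
      have e2 : gradient φ = weakGrad Ω u - fun x => weakGrad Ω u x - gradient φ x := by
        ext1 x
        simp
      rw [wNorm, e2]
      exact (eLpNorm_sub_le (hr hugL) ((hr hugL).sub
        (measurable_gradient φ).aestronglyMeasurable) one_le_two).trans (add_le_add le_rfl h2)
    calc _ ≤ wNorm Λ β (patch Ω K v k) (fun x => u x - φ x) +
          wNorm Λ β (patch Ω K v k) (fun x => φ x - c) := by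
          rw [e1]
          exact eLpNorm_add_le m1 m2 one_le_two
      _ ≤ η + C₁ * h * (G + η) := add_le_add h1 (h3.trans (by gcongr))
      _ = _ := by ring
  have hgrad : h * wNorm Λ β (patch Ω K v 0) (gradient I) ≤ (1 + C₂) * C₁ * h * G := by
    refine le_of_forall_le_add_mul (D := C₂ * (1 + C₁ * h)) (by finiteness) fun η hη => ?_
    obtain ⟨c, hc, hX⟩ := hX η hη
    calc _ ≤ C₂ * wNorm Λ β (patch Ω K v 1) (fun x => u x - c) := (hI c hc).2
      _ ≤ C₂ * (C₁ * h * G + (1 + C₁ * h) * η) := by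
          gcongr
          exact (wNorm_mono (patch_ae_le hΩ hK hμv h1k) _).trans hX
      _ = C₂ * C₁ * h * G + C₂ * (1 + C₁ * h) * η := by ring
      _ ≤ _ := by
          gcongr
          exact le_add_self
  have hval : wNorm Λ β (patch Ω K v 0) (u - I) ≤ (1 + C₂) * C₁ * h * G := by
    refine le_of_forall_le_add_mul (D := (1 + C₂) * (1 + C₁ * h)) (by finiteness) fun η hη => ?_
    obtain ⟨c, hc, hX⟩ := hX η hη
    have e1 : u - I = (fun x => u x - c) - fun x => I x - c := by
      ext x
      simp
    calc _ ≤ wNorm Λ β (patch Ω K v 0) (fun x => u x - c) +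
          wNorm Λ β (patch Ω K v 0) (fun x => I x - c) := by
          rw [e1]
          exact eLpNorm_sub_le ((hr hu.1).sub aestronglyMeasurable_const)
            ((hr hIL).sub aestronglyMeasurable_const) one_le_two
      _ ≤ (C₁ * h * G + (1 + C₁ * h) * η) + C₂ * (C₁ * h * G + (1 + C₁ * h) * η) := by
          refine add_le_add ((wNorm_mono (patch_ae_le hΩ hK hμv h0k) _).trans hX)
            ((hI c hc).1.trans ?_)
          gcongr
          exact (wNorm_mono (patch_ae_le hΩ hK hμv h1k) _).trans hX
      _ = _ := by ring
  have hgrad' : wNorm Λ β (patch Ω K v 0) (gradient I) ≤ (1 + C₂) * C₁ * G := by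
    refine (ENNReal.mul_le_mul_iff_right (ENNReal.ofReal_pos.2 hH).ne' ENNReal.ofReal_ne_top).1
      (hgrad.trans (le_of_eq ?_))
    rw [← hh]
    ring
  have hIg : HasWeakGrad Ω I (gradient I) := LipschitzWith.hasWeakGrad hM
  refine ⟨?_, ?_, ?_⟩
  · rw [wNorm_congr (patch_subset_domain v 0) (hIg.weakGrad_ae_eq hΩ.isOpen hμv)]
    refine hgrad'.trans ?_
    gcongr
    push_cast
    exact le_add_self
  · refine hval.trans ?_
    gcongr
    push_cast
    exact le_add_self
  · have hsub : HasWeakGrad Ω (u - I) (weakGrad Ω u - gradient I) := by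
      have := hug.add_smul hIg 1 (-1)
      simpa [sub_eq_add_neg] using this
    rw [wNorm_congr (patch_subset_domain v 0) (hsub.weakGrad_ae_eq hΩ.isOpen hμv)]
    calc _ ≤ wNorm Λ β (patch Ω K v 0) (weakGrad Ω u) +
          wNorm Λ β (patch Ω K v 0) (gradient I) :=
          eLpNorm_sub_le (hr hugL) (measurable_gradient I).aestronglyMeasurable one_le_two
      _ ≤ G + (1 + C₂) * C₁ * G :=
          add_le_add (wNorm_mono (patch_ae_le hΩ hK hμv h0k) _) hgrad'
      _ = _ := by
          push_cast
          ring

lemma GradientBounds.mono {C C' : ℝ≥0} (hC : C ≤ C') {u I : E d → ℝ} {D D' D'' : Set (E d)}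
    (h : GradientBounds Ω Λ β H C u I D D') (hD : D' ≤ᵐ[wMeas Λ β] D'') :
    GradientBounds Ω Λ β H C' u I D D'' := by
  have hC' : (C : ℝ≥0∞) ≤ C' := by exact_mod_cast hC
  have hm := wNorm_mono hD (weakGrad Ω u)
  exact ⟨h.1.trans (by gcongr), h.2.1.trans (by gcongr), h.2.2.trans (by gcongr)⟩

variable {A : ℝ≥0}

/-- Smooth approximation in the interior of the domain. -/
lemma MemH1.exists_smooth [IsLocallyFiniteMeasure (wMeas Λ β)] (hμ : AvgBounded A (wMeas Λ β))
    (hΩ : IsLipschitzDomain Ω) {u : E d → ℝ} (hu : MemH1 Λ β Ω u) {D : Set (E d)}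
    (hDm : MeasurableSet D) (hD : closure D ⊆ Ω) {η : ℝ≥0∞} (hη : η ≠ 0) :
    ∃ φ : E d → ℝ, ContDiff ℝ 1 φ ∧ wNorm Λ β D (fun x => u x - φ x) ≤ η ∧
      wNorm Λ β D (fun x => weakGrad Ω u x - gradient φ x) ≤ η := by
  have hc : IsCompact (closure D) :=
    (hΩ.isBounded.subset (subset_closure.trans hD)).isCompact_closure
  obtain ⟨δ, hδ, hδΩ⟩ := hc.exists_cthickening_subset_open hΩ.isOpen hD
  obtain ⟨hg, hgL⟩ := hu.weakGrad_spec hΩ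
  obtain ⟨φ, h1, -, h2, h3⟩ := hμ.exists_smooth wMeas_absolutelyContinuous hg hc.cthickening hδΩ
    (hu.1.mono_measure (Measure.restrict_mono hδΩ le_rfl))
    (hgL.mono_measure (Measure.restrict_mono hδΩ le_rfl)) hDm hδ
    (fun x hx y hy => mem_cthickening_of_dist_le y x δ _ (subset_closure hx) hy) hη
  exact ⟨φ, h1.of_le (by simp), h2, h3⟩

lemma MemH1Zero.exists_test (hΩ : IsLipschitzDomain Ω) {u : E d → ℝ} (hu : MemH1Zero Λ β Ω u)
    {D : Set (E d)} (hD : D ⊆ Ω) {η : ℝ≥0∞} (hη : η ≠ 0) :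
    ∃ φ : E d → ℝ, ContDiff ℝ 1 φ ∧ (∀ x ∈ frontier Ω, φ x = 0) ∧
      wNorm Λ β D (fun x => u x - φ x) ≤ η ∧
      wNorm Λ β D (fun x => weakGrad Ω u x - gradient φ x) ≤ η := by
  obtain ⟨φ, hφ, h1, h2⟩ := hu.2 η (pos_iff_ne_zero.2 hη)
  refine ⟨φ, hφ.1.of_le (by simp), fun x hx => ?_,
    (wNorm_mono hD.eventuallyLE _).trans h1.le, (wNorm_mono hD.eventuallyLE _).trans h2.le⟩
  refine image_eq_zero_of_notMem_tsupport fun h => ?_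
  rw [hΩ.isOpen.frontier_eq] at hx
  exact hx.2 (hφ.2.2 h)

/-- A patch that reaches the boundary has a boundary face in its next layer. -/
lemma exists_boundary_face_of_not_subset (hΩ : IsLipschitzDomain Ω) (hK : IsMesh Ω κ H K) {v : E d}
    {k : ℕ} (h : ¬closure (patch Ω K v k) ⊆ Ω) :
    ∃ t ∈ patchElts K v (k + 1), ∃ f ⊆ t, f.card = d ∧
      convexHull ℝ (f : Set (E d)) ⊆ frontier Ω := by
  obtain ⟨p, hp, hpΩ⟩ := not_subset.1 h
  have hpf : p ∈ frontier Ω := by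
    rw [hΩ.isOpen.frontier_eq]
    exact ⟨closure_mono (patch_subset_domain v k) hp, hpΩ⟩
  obtain ⟨t, ht, hpt, f, hf⟩ := exists_boundary_face hΩ hK hpf
  rw [closure_patch hΩ hK] at hp
  obtain ⟨s, hs, hps⟩ := mem_iUnion₂.1 hp
  exact ⟨t, ⟨ht, s, hs, inter_nonempty_of_mem ht (patchElts_subset v k hs) hpt hps⟩, f, hf⟩

end Estimates

end WeightedQI

end

/-! ### Assembly of the lemma -/

theorem lemma3p1 (d ℓ m : ℕ) (hd : d = 2 ∨ d = 3) (hℓ : ℓ < d) (hm : 0 < m)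
    (β : ℝ) (hβ : β ∈ Set.Ioo (-(((d : ℝ) - ℓ) / 2)) (((d : ℝ) - ℓ) / 2)) (κ L : ℝ)
    (Ω : Set (WeightedQI.E d)) (hΩ : WeightedQI.IsLipschitzDomain Ω) :
    ∃ C : ℝ≥0, ∀ (Λ : Set (WeightedQI.E d)), WeightedQI.IsFracture ℓ m L Λ → Λ ⊆ Ω →
      ∀ (H : ℝ) (K : Geometry.SimplicialComplex ℝ (WeightedQI.E d)),
      WeightedQI.IsMesh Ω κ H K →
      -- `I_H^β` maps `H¹_β(Ω)` into `V_H`, within the functions of `H¹_β(Ω)` that vanish on `∂Ω`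
      (∀ u, WeightedQI.MemH1 Λ β Ω u →
        WeightedQI.quasiInterp Ω K Λ β u ∈ WeightedQI.VH Ω K ∧
        WeightedQI.MemH1Zero Λ β Ω (WeightedQI.quasiInterp Ω K Λ β u)) ∧
      -- it is a linear projection onto `V_H`
      (∀ u w, WeightedQI.MemH1 Λ β Ω u → WeightedQI.MemH1 Λ β Ω w → ∀ a b : ℝ,
        WeightedQI.quasiInterp Ω K Λ β (a • u + b • w) =
          a • WeightedQI.quasiInterp Ω K Λ β u + b • WeightedQI.quasiInterp Ω K Λ β w) ∧
      (∀ u ∈ WeightedQI.VH Ω K,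
        WeightedQI.MemH1Zero Λ β Ω u ∧ WeightedQI.quasiInterp Ω K Λ β u = u) ∧
      -- local stability in `L²_β`
      (∀ u, WeightedQI.MemH1 Λ β Ω u → ∀ v ∈ K.vertices,
        WeightedQI.wNorm Λ β (WeightedQI.patch Ω K v 0) (WeightedQI.quasiInterp Ω K Λ β u) ≤
          C * WeightedQI.wNorm Λ β (WeightedQI.patch Ω K v 1) u) ∧
      -- local `H¹` stability and approximation: patches inside the domain
      (∀ u, WeightedQI.MemH1 Λ β Ω u → ∀ v ∈ K.vertices,
        closure (WeightedQI.patch Ω K v 1) ⊆ Ω →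
        WeightedQI.GradientBounds Ω Λ β H C u (WeightedQI.quasiInterp Ω K Λ β u)
          (WeightedQI.patch Ω K v 0) (WeightedQI.patch Ω K v 1)) ∧
      -- local `H¹` stability and approximation: patches at the boundary
      (∀ u, WeightedQI.MemH1Zero Λ β Ω u → ∀ v ∈ K.vertices,
        WeightedQI.HasBoundaryFace Ω K (WeightedQI.patch Ω K v 1) →
        WeightedQI.GradientBounds Ω Λ β H C u (WeightedQI.quasiInterp Ω K Λ β u)
          (WeightedQI.patch Ω K v 0) (WeightedQI.patch Ω K v 1)) ∧
      -- all patches, with one more layer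
      (∀ u, WeightedQI.MemH1Zero Λ β Ω u → ∀ v ∈ K.vertices,
        WeightedQI.GradientBounds Ω Λ β H C u (WeightedQI.quasiInterp Ω K Λ β u)
          (WeightedQI.patch Ω K v 0) (WeightedQI.patch Ω K v 2)) := by
  open WeightedQI in
  have hd0 : 0 < d := by omega
  obtain ⟨A, hA⟩ := IsFracture.exists_avgBounded (d := d) hℓ hm L hβ
  obtain ⟨C₂, hC₂⟩ := exists_wNorm_quasiInterp_le (d := d) hd0 κ A
  obtain ⟨C₁, hC₁⟩ := exists_wNorm_poincare_patch (d := d) hd0 κ A 1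
  obtain ⟨C₁', hC₁'⟩ := exists_wNorm_poincare_patch (d := d) hd0 κ A 2
  refine ⟨C₂ + (1 + (1 + C₂) * C₁) + (1 + (1 + C₂) * C₁'), fun Λ hΛ _ H K hK => ?_⟩
  obtain ⟨hμ, hvμ, hlf⟩ := hA Λ hΛ
  have hμv : wMeas Λ β ≪ MeasureTheory.volume := wMeas_absolutelyContinuous
  -- Positivity of `H` is read off from an element, so it is available as soon as there is a node.
  have hH : ∀ v ∈ K.vertices, 0 < H := fun v hv => by
    obtain ⟨t, ht, -⟩ := hK.exists_mem_of_vertex hv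
    exact (hK.exists_ball hd0 ht).1
  have hinner : ∀ u, MemH1 Λ β Ω u → ∀ v ∈ K.vertices, closure (patch Ω K v 1) ⊆ Ω →
      GradientBounds Ω Λ β H (1 + (1 + C₂) * C₁) u (quasiInterp Ω K Λ β u)
        (patch Ω K v 0) (patch Ω K v 1) := fun u hu v hv hvΩ =>
    gradientBounds_of_approx hΩ hK (hH v hv) (patchElts_subset_succ v 0) subset_rfl hu
      (hC₂ Ω H K Λ β hμ hvμ hΩ hK v hv u hu.1) fun η hη => by
        obtain ⟨φ, hφ, h1, h2⟩ := hu.exists_smooth hμ hΩ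
          (isOpen_interior.inter hΩ.isOpen).measurableSet hvΩ hη
        obtain ⟨c, hc⟩ := (hC₁ Ω H K Λ β hμ hΩ hK v hv φ hφ).1
        exact ⟨c, φ, Or.inr hvΩ, hφ, h1, h2, hc⟩
  refine ⟨fun u _ => ⟨quasiInterp_mem_VH hΩ hK u, VH_memH1Zero hμ hΩ hK
    (quasiInterp_mem_VH hΩ hK u)⟩, fun u w hu hw a b =>
    quasiInterp_add_smul hμ hd0 hΩ hK hvμ hu.1 hw.1 a b, fun u hu => ⟨VH_memH1Zero hμ hΩ hK hu,
    quasiInterp_eq_self hμ hd0 hΩ hK hvμ hu⟩, fun u hu v hv => ?_, fun u hu v hv hvΩ =>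
    (hinner u hu v hv hvΩ).mono (le_add_self.trans le_self_add) Filter.EventuallyLE.rfl,
    fun u hu v hv => ?_, fun u hu v hv => ?_⟩
  · have h := (hC₂ Ω H K Λ β hμ hvμ hΩ hK v hv u hu.1 0 (Or.inl rfl)).1
    simp only [sub_zero] at h
    refine h.trans ?_
    gcongr
    exact le_self_add.trans le_self_add
  · rintro ⟨t, ht, htv, f, hft, hfc, hf⟩
    refine GradientBounds.mono (C := 1 + (1 + C₂) * C₁) (le_add_self.trans le_self_add)
      (gradientBounds_of_approx hΩ hK (hH v hv) (patchElts_subset_succ v 0) subset_rfl hu.1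
      (hC₂ Ω H K Λ β hμ hvμ hΩ hK v hv u hu.1.1) fun η hη => ?_) Filter.EventuallyLE.rfl
    obtain ⟨φ, hφ, h0, h1, h2⟩ := hu.exists_test hΩ (patch_subset_domain v 1) hη
    refine ⟨0, φ, Or.inl rfl, hφ, h1, h2, ?_⟩
    simp only [sub_zero]
    exact (hC₁ Ω H K Λ β hμ hΩ hK v hv φ hφ).2 t (mem_patchElts_of_subset hΩ hK ht htv) f hft hfc
      fun x hx => h0 x (hf hx)
  -- Either the interior estimate applies, followed by enlarging the patch, or the first layer
  -- touches the boundary and the second one contains a boundary face.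
  · by_cases hvΩ : closure (patch Ω K v 1) ⊆ Ω
    · exact (hinner u hu.1 v hv hvΩ).mono (le_add_self.trans le_self_add)
        (patch_ae_le hΩ hK hμv (patchElts_subset_succ v 1))
    · obtain ⟨t, ht, f, hft, hfc, hf⟩ := exists_boundary_face_of_not_subset hΩ hK hvΩ
      refine GradientBounds.mono (C := 1 + (1 + C₂) * C₁') le_add_self
        (gradientBounds_of_approx hΩ hK (hH v hv)
        ((patchElts_subset_succ v 0).trans (patchElts_subset_succ v 1))
        (patchElts_subset_succ v 1) hu.1
        (hC₂ Ω H K Λ β hμ hvμ hΩ hK v hv u hu.1.1) fun η hη => ?_) Filter.EventuallyLE.rfl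
      obtain ⟨φ, hφ, h0, h1, h2⟩ := hu.exists_test hΩ (patch_subset_domain v 2) hη
      refine ⟨0, φ, Or.inl rfl, hφ, h1, h2, ?_⟩
      simp only [sub_zero]
      exact (hC₁' Ω H K Λ β hμ hΩ hK v hv φ hφ).2 t ht f hft hfc fun x hx => h0 x (hf hx)
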